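/- Fix a positive integer $d$. The $d$-Simultaneous Conjugacy problem asks, given $n$ and two $d$-tuples $(a_1,\dots,a_d)$, $(b_1,\dots,b_d)$ of permutations in the symmetric group $S_n$, whether there is a $\tau\in S_n$ such that $b_j=\tau^{-1}a_j\tau$ for all $j=1,\dots,d$. For every fixed positive integer $d$ this problem can be decided in $o(n^2)$ time on a word RAM: there are a single program $P$, a constant $c$ and a function $T:\mathbb N\to\mathbb N$ with $T(n)=o(n^2)$ (all depending only on $d$) such that for every $n$, every word length $w\ge c(\lfloor\log_2 n\rfloor+1)$ (reading $\lfloor\log_2 0\rfloor$ as $0$) and all $d$-tuples $a,b$ of permutations in $S_n$, the program $P$, started with $n$ in a register and the tables of values of $a_1,\dots,a_d,b_1,\dots,b_d$ in consecutive memory cells (all else being $0$), halts after at most $T(n)$ steps with output $1$ if $a$ and $b$ are simultaneously conjugate and $0$ otherwise. Here a word RAM with word length $w$ is the usual random access machine with finitely many registers and an indirectly addressable memory whose cells hold $w$-bit integers, where each copy, load, store, arithmetic operation ($+$, truncated $-$, $\times$, $\lfloor\cdot/\cdot\rfloor$, $\bmod$; sums and products modulo $2^w$) and comparison is one step. -/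

import Mathlib

namespace SCP

/-- The `d`-tuples `a` and `b` of permutations in `S_n` are simultaneously conjugate: some `τ`
satisfies `b_j = τ⁻¹ a_j τ` for all `j`. -/
def SimConj {d n : ℕ} (a b : Fin d → Equiv.Perm (Fin n)) : Prop :=
  ∃ τ : Equiv.Perm (Fin n), ∀ j : Fin d, b j = τ⁻¹ * a j * τ

/-! A word RAM with unit-cost instructions and structured control flow. -/

/-- A configuration: registers and an addressable memory, both holding natural numbers. A program
mentions only finitely many registers, by name; memory is addressed indirectly. -/
structure State where
  reg : ℕ → ℕ
  mem : ℕ → ℕ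

/-- Arithmetic instructions. -/
inductive Op where
  | add | sub | mul | div | mod

/-- Arithmetic on words of `w` bits: sums and products wrap around modulo `2 ^ w`, subtraction is
truncated at `0`, and `x / 0 = 0`, `x mod 0 = x`. -/
def Op.eval (w : ℕ) : Op → ℕ → ℕ → ℕ
  | .add, x, y => (x + y) % 2 ^ w
  | .sub, x, y => x - y
  | .mul, x, y => (x * y) % 2 ^ w
  | .div, x, y => x / y
  | .mod, x, y => x % y

/-- Comparisons of two registers. -/
inductive Test where
  | eq (r s : ℕ)
  | ne (r s : ℕ)
  | lt (r s : ℕ)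
  | le (r s : ℕ)

/-- The truth of a comparison in a configuration. -/
def Test.Holds : Test → State → Prop
  | .eq r s, σ => σ.reg r = σ.reg s
  | .ne r s, σ => σ.reg r ≠ σ.reg s
  | .lt r s, σ => σ.reg r < σ.reg s
  | .le r s, σ => σ.reg r ≤ σ.reg s

/-- Programs of the machine. -/
inductive Prog where
  /-- do nothing -/
  | skip
  /-- `R_r := k` -/
  | const (r k : ℕ)
  /-- `R_r := R_s` -/
  | copy (r s : ℕ)
  /-- `R_r := R_s op R_t` -/
  | arith (o : Op) (r s t : ℕ)
  /-- `R_r := M[R_s]` -/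
  | load (r s : ℕ)
  /-- `M[R_r] := R_s` -/
  | store (r s : ℕ)
  /-- first `P`, then `Q` -/
  | seq (P Q : Prog)
  /-- `P` if the test holds, and `Q` otherwise -/
  | cond (c : Test) (P Q : Prog)
  /-- repeat `P` as long as the test holds -/
  | loop (c : Test) (P : Prog)

/-- Write `x` into register `r`. -/
def State.setReg (σ : State) (r x : ℕ) : State :=
  { σ with reg := Function.update σ.reg r x }

/-- Write `x` into memory cell `p`. -/
def State.setMem (σ : State) (p x : ℕ) : State :=
  { σ with mem := Function.update σ.mem p x }

/-- `Exec w P σ σ' t`: with word length `w`, the program `P` started in `σ` halts in `σ'` after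
exactly `t` steps. Every elementary instruction and every evaluation of a test is one step. -/
inductive Exec (w : ℕ) : Prog → State → State → ℕ → Prop where
  | skip (σ : State) : Exec w .skip σ σ 1
  | const (r k : ℕ) (σ : State) : Exec w (.const r k) σ (σ.setReg r (k % 2 ^ w)) 1
  | copy (r s : ℕ) (σ : State) : Exec w (.copy r s) σ (σ.setReg r (σ.reg s)) 1
  | arith (o : Op) (r s t : ℕ) (σ : State) :
      Exec w (.arith o r s t) σ (σ.setReg r (o.eval w (σ.reg s) (σ.reg t))) 1
  | load (r s : ℕ) (σ : State) : Exec w (.load r s) σ (σ.setReg r (σ.mem (σ.reg s))) 1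
  | store (r s : ℕ) (σ : State) : Exec w (.store r s) σ (σ.setMem (σ.reg r) (σ.reg s)) 1
  | seq {P Q : Prog} {σ σ₁ σ₂ : State} {t₁ t₂ : ℕ} :
      Exec w P σ σ₁ t₁ → Exec w Q σ₁ σ₂ t₂ → Exec w (.seq P Q) σ σ₂ (t₁ + t₂)
  | cond_true {c : Test} {P Q : Prog} {σ σ₁ : State} {t : ℕ} :
      c.Holds σ → Exec w P σ σ₁ t → Exec w (.cond c P Q) σ σ₁ (t + 1)
  | cond_false {c : Test} {P Q : Prog} {σ σ₁ : State} {t : ℕ} :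
      ¬ c.Holds σ → Exec w Q σ σ₁ t → Exec w (.cond c P Q) σ σ₁ (t + 1)
  | loop_true {c : Test} {P : Prog} {σ σ₁ σ₂ : State} {t₁ t₂ : ℕ} :
      c.Holds σ → Exec w P σ σ₁ t₁ → Exec w (.loop c P) σ₁ σ₂ t₂ →
      Exec w (.loop c P) σ σ₂ (t₁ + t₂ + 1)
  | loop_false {c : Test} {P : Prog} {σ : State} :
      ¬ c.Holds σ → Exec w (.loop c P) σ σ 1

/-- The input configuration of an instance: `n` is in register `0`, the image of `i` under `a_j` in
memory cell `j n + i` and its image under `b_j` in cell `d n + j n + i` (for `0 ≤ j < d` and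
`0 ≤ i < n`), and every other register and cell holds `0`. -/
def input {d n : ℕ} (a b : Fin d → Equiv.Perm (Fin n)) : State where
  reg := fun r => if r = 0 then n else 0
  mem := fun p =>
    if h : p < d * n then
      (a (Fin.divNat ⟨p, h⟩) (Fin.modNat ⟨p, h⟩) : ℕ)
    else if h : p - d * n < d * n then
      (b (Fin.divNat ⟨p - d * n, h⟩) (Fin.modNat ⟨p - d * n, h⟩) : ℕ)
    else 0

/-- With word length `w`, the program `P` started on the instance `(a, b)` halts after at most `T`
steps, with the answer `1` (yes) or `0` (no) in register `0`. -/
def DecidesWithin {d n : ℕ} (w : ℕ) (P : Prog) (T : ℕ) (a b : Fin d → Equiv.Perm (Fin n)) : Prop :=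
  ∃ (σ : State) (t : ℕ), Exec w P (input a b) σ t ∧ t ≤ T ∧
    (SimConj a b → σ.reg 0 = 1) ∧ (¬ SimConj a b → σ.reg 0 = 0)

/-!
Put `a` and `b` side by side as one system of `d` permutations of `2 * n` points. The tuples are
conjugate iff every isomorphism type of connected components occurs equally often on both sides, so
the program classifies the components against a list of representatives. Breadth-first search
compares two components of size `m` in time `O(m)` from a given pair of base points, and a failed
comparison yields a word on which the two behave differently. Applying that word to all candidate
base points and keeping the smaller half of the candidates leaves `O(log m)` rounds. Since the
actions of all words of length `κ`, a small multiple of `log n`, are tabulated in time `o(n ^ 2)`,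
a word of length `m` is applied to a point in `O(m / κ)` steps. Hence a comparison costs the
*weight* `m / κ + log m + 1` per point, instead of `m`. There are boundedly many types of small
components, and large components have a small weight in proportion to their size, so the total
weight of pairwise non-isomorphic components is `o(n)`. Each point of the system takes part in at
most one comparison with each representative, which gives `o(n ^ 2)` in all.
-/

section Systems

variable {ι α : Type*}

/-- The action of the word `l` on points, when the letter `j` acts by `G j`; the first letter of
`l` acts first. -/
def act (G : ι → α → α) (l : List ι) (x : α) : α := l.foldl (fun y j => G j y) x

/-- The point `y` is the image of `x` under some word. -/
def Reach (G : ι → α → α) (x y : α) : Prop := ∃ l, act G l x = y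

/-- The points `x` and `y` satisfy the same relations between words: there is an isomorphism of
their components that maps `x` to `y`. -/
def SameRel (G : ι → α → α) (x y : α) : Prop :=
  ∀ l l', act G l x = act G l' x ↔ act G l y = act G l' y

/-- The components of `x` and `y` are isomorphic. -/
def SameType (G : ι → α → α) (x y : α) : Prop := ∃ l, SameRel G x (act G l y)

/-- Each letter permutes the finite set `X`. -/
structure ActsOn (G : ι → α → α) (X : Finset α) : Prop where
  mapsTo : ∀ j, ∀ x ∈ X, G j x ∈ X
  injOn : ∀ j, Set.InjOn (G j) X

open Classical in
/-- The component of `x` in `X`. -/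
noncomputable def orb (G : ι → α → α) (X : Finset α) (x : α) : Finset α := X.filter (Reach G x)

variable {G : ι → α → α} {X Y : Finset α} {x y z : α}

@[simp] theorem act_nil : act G [] x = x := rfl

@[simp] theorem act_cons (j : ι) (l : List ι) : act G (j :: l) x = act G l (G j x) := rfl

@[simp] theorem act_append (l l' : List ι) : act G (l ++ l') x = act G l' (act G l x) :=
  List.foldl_append ..

theorem Reach.refl (x : α) : Reach G x x := ⟨[], rfl⟩

theorem Reach.act (x : α) (l : List ι) : Reach G x (act G l x) := ⟨l, rfl⟩

theorem Reach.trans : Reach G x y → Reach G y z → Reach G x z :=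
  fun ⟨l, hl⟩ ⟨l', hl'⟩ => ⟨l ++ l', by rw [act_append, hl, hl']⟩

theorem Reach.step (h : Reach G x y) (j : ι) : Reach G x (G j y) := h.trans ⟨[j], rfl⟩

theorem SameRel.refl (x : α) : SameRel G x x := fun _ _ => Iff.rfl

theorem SameRel.symm (h : SameRel G x y) : SameRel G y x := fun l l' => (h l l').symm

theorem SameRel.trans (h : SameRel G x y) (h' : SameRel G y z) : SameRel G x z :=
  fun l l' => (h l l').trans (h' l l')

theorem SameRel.act (h : SameRel G x y) (l : List ι) : SameRel G (act G l x) (act G l y) :=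
  fun m m' => by simpa only [act_append] using h (l ++ m) (l ++ m')

theorem SameRel.sameType (h : SameRel G x y) : SameType G x y := ⟨[], h⟩

theorem SameType.refl (x : α) : SameType G x x := (SameRel.refl x).sameType

theorem SameType.trans : SameType G x y → SameType G y z → SameType G x z :=
  fun ⟨l, h⟩ ⟨l', h'⟩ => ⟨l' ++ l, h.trans (by simpa only [act_append] using h'.act l)⟩

theorem exists_map_act (h : ∀ l l', act G l x = act G l' x → act G l y = act G l' y) :
    ∃ f : α → α, ∀ l, f (act G l x) = act G l y := by
  classical
  refine ⟨fun z => if hz : Reach G x z then act G hz.choose y else z, fun l => ?_⟩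
  have hz := Reach.act (G := G) x l
  simpa only [dif_pos hz] using h _ _ hz.choose_spec

theorem orb_subset : orb G X x ⊆ X := by
  classical
  exact Finset.filter_subset _ _

theorem card_orb_le : (orb G X x).card ≤ X.card := Finset.card_le_card orb_subset

namespace ActsOn

theorem act_mem (hX : ActsOn G X) (hx : x ∈ X) (l : List ι) : act G l x ∈ X := by
  induction l generalizing x with
  | nil => exact hx
  | cons j _ ih => exact ih (hX.mapsTo j x hx)

theorem reach_mem (hX : ActsOn G X) (hx : x ∈ X) : Reach G x y → y ∈ X := by
  rintro ⟨l, rfl⟩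
  exact hX.act_mem hx l

theorem reach_back (hX : ActsOn G X) (hx : x ∈ X) (j : ι) : Reach G (G j x) x := by
  let f : X → X := fun z => ⟨G j z, hX.mapsTo j z z.2⟩
  have hf : Function.Injective f := fun a b hab =>
    Subtype.ext (hX.injOn j a.2 b.2 (congrArg Subtype.val hab))
  have act_replicate (k : ℕ) : ∀ z : X, act G (List.replicate k j) z = f^[k] z := by
    induction k with
    | zero => exact fun z => rfl
    | succ _ ih => exact fun z => ih (f z)
  obtain ⟨k, hk, hp⟩ := hf.mem_periodicPts ⟨x, hx⟩
  obtain ⟨k, rfl⟩ := Nat.exists_eq_succ_of_ne_zero hk.ne'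
  exact ⟨List.replicate k j, (act_replicate (k + 1) ⟨x, hx⟩).trans (congrArg Subtype.val hp.eq)⟩

theorem reach_symm (hX : ActsOn G X) (hx : x ∈ X) : Reach G x y → Reach G y x := by
  rintro ⟨l, rfl⟩
  induction l generalizing x with
  | nil => exact Reach.refl x
  | cons j l ih => exact (ih (hX.mapsTo j x hx)).trans (hX.reach_back hx j)

theorem mem_orb (hX : ActsOn G X) (hx : x ∈ X) : y ∈ orb G X x ↔ Reach G x y := by
  simpa only [orb, Finset.mem_filter, and_iff_right_iff_imp] using hX.reach_mem hx

theorem act_mem_orb (hX : ActsOn G X) (hx : x ∈ X) (l : List ι) : act G l x ∈ orb G X x :=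
  (hX.mem_orb hx).2 (Reach.act x l)

theorem self_mem_orb (hX : ActsOn G X) (hx : x ∈ X) : x ∈ orb G X x := hX.act_mem_orb hx []

theorem restrict_orb (hX : ActsOn G X) (hx : x ∈ X) : ActsOn G (orb G X x) where
  mapsTo j y hy := by
    rw [hX.mem_orb hx] at hy ⊢
    exact hy.step j
  injOn j := (hX.injOn j).mono orb_subset

theorem orb_eq (hX : ActsOn G X) (hx : x ∈ X) (h : Reach G x y) : orb G X y = orb G X x := by
  ext z
  rw [hX.mem_orb (hX.reach_mem hx h), hX.mem_orb hx]
  exact ⟨h.trans, (hX.reach_symm hx h).trans⟩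

theorem reach_step_iff (hX : ActsOn G X) (hy : y ∈ X) (j : ι) : Reach G x (G j y) ↔ Reach G x y :=
  ⟨fun h => h.trans (hX.reach_back hy j), fun h => h.step j⟩

theorem sdiff_orb (hX : ActsOn G X) (hx : x ∈ X) [DecidableEq α] : ActsOn G (X \ orb G X x) := by
  refine ⟨fun j z hz => ?_, fun j => (hX.injOn j).mono (by simp)⟩
  rw [Finset.mem_sdiff, hX.mem_orb hx] at hz ⊢
  exact ⟨hX.mapsTo j z hz.1, by rw [hX.reach_step_iff hz.1]; exact hz.2⟩

theorem sameType_of_reach (hX : ActsOn G X) (hx : x ∈ X) (h : Reach G x y) : SameType G x y := by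
  obtain ⟨l, hl⟩ := hX.reach_symm hx h
  exact ⟨l, hl.symm ▸ SameRel.refl x⟩

theorem sameType_symm (hX : ActsOn G X) (hy : y ∈ X) : SameType G x y → SameType G y x :=
  fun ⟨l, h⟩ => (hX.sameType_of_reach hy (Reach.act y l)).trans h.symm.sameType

theorem sameType_congr_right (hX : ActsOn G X) (hx : x ∈ X) (h : Reach G x y) :
    SameType G z y ↔ SameType G z x :=
  ⟨fun hz => hz.trans (hX.sameType_of_reach (hX.reach_mem hx h) (hX.reach_symm hx h)),
    fun hz => hz.trans (hX.sameType_of_reach hx h)⟩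

section Isomorphism

variable {f : α → α}

theorem image_orb [DecidableEq α] (hX : ActsOn G X) (hY : ActsOn G Y) (hx : x ∈ X) (hy : y ∈ Y)
    (hf : ∀ l, f (act G l x) = act G l y) : (orb G X x).image f = orb G Y y := by
  ext z
  simp only [Finset.mem_image, hX.mem_orb hx, hY.mem_orb hy]
  constructor
  · rintro ⟨_, ⟨l, rfl⟩, rfl⟩
    exact ⟨l, (hf l).symm⟩
  · rintro ⟨l, rfl⟩
    exact ⟨_, ⟨l, rfl⟩, hf l⟩

theorem bijOn_orb (hX : ActsOn G X) (hY : ActsOn G Y) (hx : x ∈ X) (hy : y ∈ Y)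
    (h : SameRel G x y) (hf : ∀ l, f (act G l x) = act G l y) :
    Set.BijOn f (orb G X x) (orb G Y y) := by
  classical
  have hinj : Set.InjOn f (orb G X x) := by
    intro a ha b hb hab
    obtain ⟨l, rfl⟩ := (hX.mem_orb hx).1 ha
    obtain ⟨l', rfl⟩ := (hX.mem_orb hx).1 hb
    rw [hf, hf] at hab
    exact (h l l').2 hab
  simpa only [← Finset.coe_image, hX.image_orb hY hx hy hf] using hinj.bijOn_image

end Isomorphism

theorem card_orb_of_sameRel (hX : ActsOn G X) (hY : ActsOn G Y) (hx : x ∈ X) (hy : y ∈ Y)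
    (h : SameRel G x y) : (orb G X x).card = (orb G Y y).card := by
  classical
  obtain ⟨f, hf⟩ := exists_map_act fun l l' => (h l l').1
  exact Finset.card_nbij f (hX.bijOn_orb hY hx hy h hf).mapsTo (hX.bijOn_orb hY hx hy h hf).injOn
    (hX.bijOn_orb hY hx hy h hf).surjOn

theorem card_orb_of_sameType (hX : ActsOn G X) (hx : x ∈ X) (hy : y ∈ X) :
    SameType G x y → (orb G X x).card = (orb G X y).card := by
  rintro ⟨l, h⟩
  rw [hX.card_orb_of_sameRel hX hx (hX.act_mem hy l) h, hX.orb_eq hy (Reach.act y l)]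

/-- A surjection between finite sets of equal size is injective, so a homomorphism of components
of equal size is an isomorphism. -/
theorem sameRel_of_hom (hX : ActsOn G X) (hx : x ∈ X) (hy : y ∈ X)
    (h : ∀ l l', act G l x = act G l' x → act G l y = act G l' y)
    (hc : (orb G X x).card = (orb G X y).card) : SameRel G x y := by
  classical
  obtain ⟨f, hf⟩ := exists_map_act h
  have hinj : Set.InjOn f (orb G X x) :=
    Finset.injOn_of_card_image_eq (by rw [hX.image_orb hX hx hy hf, hc])
  exact fun l l' => ⟨h l l', fun he =>
    hinj (hX.act_mem_orb hx l) (hX.act_mem_orb hx l') (by rw [hf, hf, he])⟩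

end ActsOn

/-- An isomorphism of the subsystems on `U` and `V`. -/
structure IsoOn (G : ι → α → α) (f : α → α) (U V : Finset α) : Prop where
  bijOn : Set.BijOn f U V
  comm : ∀ j, ∀ x ∈ U, f (G j x) = G j (f x)

namespace IsoOn

variable {U V U' V' : Finset α} {f g : α → α}

theorem congr (h : IsoOn G f U V) (hU : ActsOn G U) (hfg : ∀ x ∈ U, f x = g x) : IsoOn G g U V :=
  ⟨h.bijOn.congr hfg, fun j x hx => by
    rw [← hfg x hx, ← hfg _ (hU.mapsTo j x hx), h.comm j x hx]⟩

theorem union [DecidableEq α] (h : IsoOn G f U V) (h' : IsoOn G f U' V') (hV : Disjoint V V') :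
    IsoOn G f (U ∪ U') (V ∪ V') := by
  refine ⟨?_, fun j x hx => (Finset.mem_union.1 hx).elim (h.comm j x) (h'.comm j x)⟩
  rw [Finset.coe_union, Finset.coe_union]
  refine h.bijOn.union h'.bijOn ((Set.injOn_union ?_).2
    ⟨h.bijOn.injOn, h'.bijOn.injOn, fun a ha b hb =>
      (Finset.disjoint_coe.2 hV).ne_of_mem (h.bijOn.mapsTo ha) (h'.bijOn.mapsTo hb)⟩)
  refine Set.disjoint_left.2 fun a ha hb => ?_
  exact Finset.disjoint_left.1 hV (h.bijOn.mapsTo ha) (h'.bijOn.mapsTo hb)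

theorem glue [DecidableEq α] (h : IsoOn G f U V) (h' : IsoOn G g U' V') (hU : ActsOn G U)
    (hU' : ActsOn G U') (hUU' : Disjoint U U') (hVV' : Disjoint V V') :
    IsoOn G (fun z => if z ∈ U' then g z else f z) (U ∪ U') (V ∪ V') :=
  (h.congr hU fun _ hz => (if_neg (Finset.disjoint_left.1 hUU' hz)).symm).union
    (h'.congr hU' fun _ hz => (if_pos hz).symm) hVV'

theorem map_act (h : IsoOn G f U V) (hU : ActsOn G U) (hx : x ∈ U) (l : List ι) :
    f (act G l x) = act G l (f x) := by
  induction l generalizing x with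
  | nil => rfl
  | cons j l ih => rw [act_cons, ih (hU.mapsTo j x hx), h.comm j x hx, act_cons]

theorem sameRel (h : IsoOn G f U V) (hU : ActsOn G U) (hx : x ∈ U) : SameRel G x (f x) :=
  fun l l' => by
    rw [← h.map_act hU hx, ← h.map_act hU hx]
    exact (h.bijOn.injOn.eq_iff (hU.act_mem hx l) (hU.act_mem hx l')).symm

open Classical in
theorem card_filter_sameType (h : IsoOn G f U V) (hU : ActsOn G U) (x : α) :
    (U.filter (SameType G x)).card = (V.filter (SameType G x)).card := by
  refine Finset.card_nbij f ?_
    (h.bijOn.injOn.mono (Finset.coe_subset.2 (Finset.filter_subset _ _))) ?_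
  · intro z hz
    obtain ⟨hz, hs⟩ := Finset.mem_filter.1 hz
    exact Finset.mem_filter.2 ⟨h.bijOn.mapsTo hz, hs.trans (h.sameRel hU hz).sameType⟩
  · intro b hb
    obtain ⟨hb, hs⟩ := Finset.mem_filter.1 hb
    obtain ⟨a, ha, rfl⟩ := h.bijOn.surjOn hb
    exact ⟨a, Finset.mem_filter.2 ⟨ha, hs.trans (h.sameRel hU ha).symm.sameType⟩, rfl⟩

end IsoOn

namespace ActsOn

variable {U V : Finset α}

theorem exists_isoOn_orb (hU : ActsOn G U) (hV : ActsOn G V) (hx : x ∈ U) (hy : y ∈ V)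
    (h : SameRel G x y) : ∃ f, IsoOn G f (orb G U x) (orb G V y) := by
  classical
  obtain ⟨f, hf⟩ := exists_map_act fun l l' => (h l l').1
  refine ⟨f, hU.bijOn_orb hV hx hy h hf, fun j z hz => ?_⟩
  obtain ⟨l, rfl⟩ := (hU.mem_orb hx).1 hz
  simpa only [act_append, act_cons, act_nil, ← hf l] using hf (l ++ [j])

open Classical in
theorem card_filter_sdiff_orb (hU : ActsOn G U) (hx : x ∈ U) (z : α) :
    ((U \ orb G U x).filter (SameType G z)).card +
      (if SameType G z x then (orb G U x).card else 0) = (U.filter (SameType G z)).card := by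
  have hfilter : (orb G U x).filter (SameType G z) = if SameType G z x then orb G U x else ∅ := by
    have hiff : ∀ a ∈ orb G U x, (SameType G z a ↔ SameType G z x) :=
      fun a ha => hU.sameType_congr_right hx ((hU.mem_orb hx).1 ha)
    split_ifs with h
    · exact Finset.filter_true_of_mem fun a ha => (hiff a ha).2 h
    · exact Finset.filter_false_of_mem fun a ha => mt (hiff a ha).1 h
  have hsub : orb G U x ⊆ U := orb_subset
  conv_rhs => rw [← Finset.sdiff_union_of_subset hsub, Finset.filter_union, hfilter,
    Finset.card_union_of_disjoint (by
      rw [← hfilter]; exact Finset.disjoint_filter_filter Finset.sdiff_disjoint)]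
  split_ifs <;> rfl

open Classical in
/-- The isomorphism is built by splitting off isomorphic components one after the other. -/
theorem exists_isoOn (hU : ActsOn G U) (hV : ActsOn G V)
    (hc : ∀ x, x ∈ U ∨ x ∈ V →
      (U.filter (SameType G x)).card = (V.filter (SameType G x)).card) :
    ∃ f, IsoOn G f U V := by
  induction hk : U.card using Nat.strong_induction_on generalizing U V with
  | _ k ih =>
  rcases U.eq_empty_or_nonempty with rfl | ⟨x, hx⟩
  · obtain rfl : V = ∅ := Finset.eq_empty_of_forall_notMem fun y hy => by
      have h := hc y (Or.inr hy)
      rw [Finset.filter_empty, Finset.card_empty, eq_comm, Finset.card_eq_zero] at h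
      exact Finset.notMem_empty y (h ▸ Finset.mem_filter.2 ⟨hy, SameType.refl y⟩)
    exact ⟨id, by simp, by simp⟩
  obtain ⟨y, hy, hxy⟩ : ∃ y ∈ V, SameRel G x y := by
    have hpos : 0 < (V.filter (SameType G x)).card := by
      rw [← hc x (Or.inl hx), Finset.card_pos]
      exact ⟨x, Finset.mem_filter.2 ⟨hx, SameType.refl x⟩⟩
    obtain ⟨y, hy⟩ := Finset.card_pos.1 hpos
    obtain ⟨hy, l, hl⟩ := Finset.mem_filter.1 hy
    exact ⟨_, hV.act_mem hy l, hl⟩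
  obtain ⟨f, hf⟩ := ih (U \ orb G U x).card
    (hk ▸ Finset.card_lt_card (Finset.sdiff_ssubset orb_subset ⟨x, hU.self_mem_orb hx⟩))
    (hU.sdiff_orb hx) (hV.sdiff_orb hy) (fun z hz => by
      have hzx : SameType G z x ↔ SameType G z y :=
        ⟨fun h => h.trans hxy.sameType, fun h => h.trans hxy.symm.sameType⟩
      have hcU := hU.card_filter_sdiff_orb hx z
      have hcV := hV.card_filter_sdiff_orb hy z
      have hcz := hc z (hz.imp (fun h => Finset.sdiff_subset h) fun h => Finset.sdiff_subset h)
      simp only [hzx, hU.card_orb_of_sameRel hV hx hy hxy] at hcU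
      omega) rfl
  obtain ⟨g, hg⟩ := hU.exists_isoOn_orb hV hx hy hxy
  have hiso := hf.glue hg (hU.sdiff_orb hx) (hU.restrict_orb hx) Finset.sdiff_disjoint
    Finset.sdiff_disjoint
  rw [Finset.sdiff_union_of_subset orb_subset, Finset.sdiff_union_of_subset orb_subset] at hiso
  exact ⟨_, hiso⟩

end ActsOn

section BoundedComponents

variable {J : Finset ι} {f : ℕ}

/-- The points of a component of size at most `f` can be numbered. The multiplication table is then
a function of bounded size, and the component can be recovered from it. -/
theorem exists_numbering (hx : (orb G X x).card ≤ f) :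
    ∃ e : α → Fin (f + 1), Set.InjOn e (orb G X x) := by
  classical
  refine ⟨fun z => if hz : z ∈ orb G X x then
    Fin.castLE (hx.trans f.le_succ) ((orb G X x).equivFin ⟨z, hz⟩) else 0, fun a ha b hb hab => ?_⟩
  simpa [dif_pos (Finset.mem_coe.1 ha), dif_pos (Finset.mem_coe.1 hb)] using hab

open Classical in
/-- The action of the letters in `J` on the component of `x`, in the numbering `e`, together with
the number of `x`. -/
noncomputable def actionTable (G : ι → α → α) (J : Finset ι) (X : Finset α) (e : α → Fin (f + 1))
    (x : α) : (J → Fin (f + 1) → Fin (f + 1)) × Fin (f + 1) :=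
  (fun j i => if h : ∃ z ∈ orb G X x, e z = i then e (G j h.choose) else 0, e x)

theorem actionTable_apply {e : α → Fin (f + 1)} (he : Set.InjOn e (orb G X x)) (j : J)
    (hz : z ∈ orb G X x) : (actionTable G J X e x).1 j (e z) = e (G j z) := by
  have h : ∃ z' ∈ orb G X x, e z' = e z := ⟨z, hz, rfl⟩
  simp only [actionTable, dif_pos h, he h.choose_spec.1 hz h.choose_spec.2]

theorem ActsOn.sameRel_of_actionTable_eq (hX : ActsOn G X) (hJ : ∀ j ∉ J, ∀ x ∈ X, G j x = x)
    (hx : x ∈ X) (hy : y ∈ X) {e e' : α → Fin (f + 1)} (he : Set.InjOn e (orb G X x))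
    (he' : Set.InjOn e' (orb G X y)) (h : actionTable G J X e x = actionTable G J X e' y) :
    SameRel G x y := by
  have key (l : List ι) : e (act G l x) = e' (act G l y) := by
    induction l using List.reverseRecOn with
    | nil => exact congrArg Prod.snd h
    | append_singleton l j ih =>
      rw [act_append, act_append]
      by_cases hj : j ∈ J
      · have hxl := actionTable_apply he ⟨j, hj⟩ (hX.act_mem_orb hx l)
        have hyl := actionTable_apply he' ⟨j, hj⟩ (hX.act_mem_orb hy l)
        exact hxl.symm.trans ((by rw [h, ih] : _ = _).trans hyl)
      · simpa only [act_cons, act_nil, hJ j hj _ (hX.act_mem hx l), hJ j hj _ (hX.act_mem hy l)]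
          using ih
  intro l l'
  rw [← he.eq_iff (hX.act_mem_orb hx l) (hX.act_mem_orb hx l'), key, key,
    he'.eq_iff (hX.act_mem_orb hy l) (hX.act_mem_orb hy l')]

theorem ActsOn.card_le_of_pairwise_not_sameType (hX : ActsOn G X)
    (hJ : ∀ j ∉ J, ∀ x ∈ X, G j x = x) {T : Finset α} (hT : T ⊆ X)
    (hf : ∀ x ∈ T, (orb G X x).card ≤ f) (hsep : ∀ x ∈ T, ∀ y ∈ T, SameType G x y → x = y) :
    T.card ≤ ((f + 1) ^ (f + 1)) ^ J.card * (f + 1) := by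
  classical
  have hnum : ∀ x, ∃ e : α → Fin (f + 1), x ∈ T → Set.InjOn e (orb G X x) := fun x => by
    by_cases hx : x ∈ T
    · obtain ⟨e, he⟩ := exists_numbering (hf x hx)
      exact ⟨e, fun _ => he⟩
    · exact ⟨0, fun h => absurd h hx⟩
  choose e he using hnum
  have hcard : Fintype.card ((J → Fin (f + 1) → Fin (f + 1)) × Fin (f + 1)) =
      ((f + 1) ^ (f + 1)) ^ J.card * (f + 1) := by simp
  rw [← hcard, ← Finset.card_univ]
  refine Finset.card_le_card_of_injOn (fun x => actionTable G J X (e x) x) (by simp) ?_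
  intro x hx y hy hxy
  exact hsep x hx y hy
    (hX.sameRel_of_actionTable_eq hJ (hT hx) (hT hy) (he x hx) (he y hy) hxy).sameType

end BoundedComponents

end Systems

section Language

/-- The data of a program in the high-level language: the values of its variables and arrays, and
the time elapsed so far. -/
structure Store (V A : Type) where
  var : V → ℕ
  arr : A → ℕ → ℕ
  time : ℕ

/-- Expressions over the variables `V` and the arrays `A`. -/
inductive Exp (V A : Type) where
  | lit (k : ℕ)
  | var (x : V)
  | bin (o : Op) (a b : Exp V A)
  | idx (B : A) (a : Exp V A)

/-- The relations that can be tested. -/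
inductive Rel where
  | eq | ne | lt | le

/-- Programs of the high-level language. -/
inductive Cmd (V A : Type) where
  | skip
  | assign (x : V) (a : Exp V A)
  | write (B : A) (a b : Exp V A)
  | seq (P Q : Cmd V A)
  | ite (R : Rel) (a b : Exp V A) (P Q : Cmd V A)
  | loop (R : Rel) (a b : Exp V A) (P : Cmd V A)

/-- Composition of a list of commands. -/
def Cmd.block {V A : Type} : List (Cmd V A) → Cmd V A
  | [] => .skip
  | [P] => P
  | P :: Ps => .seq P (Cmd.block Ps)

/-- The operations on unbounded natural numbers. -/
def Op.val : Op → ℕ → ℕ → ℕ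
  | .add, x, y => x + y
  | .sub, x, y => x - y
  | .mul, x, y => x * y
  | .div, x, y => x / y
  | .mod, x, y => x % y

/-- The operation does not leave the numbers below `Z`. -/
def Op.Safe (Z : ℕ) : Op → ℕ → ℕ → Prop
  | .add, x, y => x + y < Z
  | .mul, x, y => x * y < Z
  | _, _, _ => True

/-- The truth of a relation. -/
def Rel.Holds : Rel → ℕ → ℕ → Prop
  | .eq, x, y => x = y
  | .ne, x, y => x ≠ y
  | .lt, x, y => x < y
  | .le, x, y => x ≤ y

variable {V A : Type}

instance : Coe V (Exp V A) := ⟨Exp.var⟩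
instance (k : ℕ) : OfNat (Exp V A) k := ⟨Exp.lit k⟩
instance : Add (Exp V A) := ⟨Exp.bin .add⟩
instance : Sub (Exp V A) := ⟨Exp.bin .sub⟩
instance : Mul (Exp V A) := ⟨Exp.bin .mul⟩
instance : Div (Exp V A) := ⟨Exp.bin .div⟩
instance : Mod (Exp V A) := ⟨Exp.bin .mod⟩

namespace Exp

/-- The value of an expression. -/
def val (σ : Store V A) : Exp V A → ℕ
  | lit k => k
  | var x => σ.var x
  | bin o a b => o.val (a.val σ) (b.val σ)
  | idx B a => σ.arr B (a.val σ)

/-- All intermediate values and all array indices are below `Z`. -/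
def Good (Z : ℕ) (σ : Store V A) : Exp V A → Prop
  | lit k => k < Z
  | var _ => True
  | bin o a b => a.Good Z σ ∧ b.Good Z σ ∧ o.Safe Z (a.val σ) (b.val σ)
  | idx _ a => a.Good Z σ ∧ a.val σ < Z

section Simp

variable (Z k : ℕ) (σ : Store V A) (x : V) (B : A) (a b : Exp V A)

@[simp] theorem val_lit : (lit k : Exp V A).val σ = k := rfl
@[simp] theorem val_ofNat : (ofNat(k) : Exp V A).val σ = OfNat.ofNat k := rfl
@[simp] theorem val_zero : (0 : Exp V A).val σ = 0 := rfl
@[simp] theorem val_var : (var x : Exp V A).val σ = σ.var x := rfl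
@[simp] theorem val_idx : (idx B a).val σ = σ.arr B (a.val σ) := rfl
@[simp] theorem val_add : (a + b).val σ = a.val σ + b.val σ := rfl
@[simp] theorem val_sub : (a - b).val σ = a.val σ - b.val σ := rfl
@[simp] theorem val_mul : (a * b).val σ = a.val σ * b.val σ := rfl
@[simp] theorem val_div : (a / b).val σ = a.val σ / b.val σ := rfl
@[simp] theorem val_mod : (a % b).val σ = a.val σ % b.val σ := rfl
@[simp] theorem good_lit : (lit k : Exp V A).Good Z σ ↔ k < Z := Iff.rfl
@[simp] theorem good_ofNat : (ofNat(k) : Exp V A).Good Z σ ↔ OfNat.ofNat k < Z := Iff.rfl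
@[simp] theorem good_zero : (0 : Exp V A).Good Z σ ↔ 0 < Z := Iff.rfl
@[simp] theorem good_var : (var x : Exp V A).Good Z σ := trivial
@[simp] theorem good_idx : (idx B a).Good Z σ ↔ a.Good Z σ ∧ a.val σ < Z := Iff.rfl
@[simp] theorem good_add :
    (a + b).Good Z σ ↔ a.Good Z σ ∧ b.Good Z σ ∧ a.val σ + b.val σ < Z := Iff.rfl
@[simp] theorem good_mul :
    (a * b).Good Z σ ↔ a.Good Z σ ∧ b.Good Z σ ∧ a.val σ * b.val σ < Z := Iff.rfl
@[simp] theorem good_sub : (a - b).Good Z σ ↔ a.Good Z σ ∧ b.Good Z σ :=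
  and_congr_right' (and_iff_left trivial)
@[simp] theorem good_div : (a / b).Good Z σ ↔ a.Good Z σ ∧ b.Good Z σ :=
  and_congr_right' (and_iff_left trivial)
@[simp] theorem good_mod : (a % b).Good Z σ ↔ a.Good Z σ ∧ b.Good Z σ :=
  and_congr_right' (and_iff_left trivial)

end Simp

end Exp

namespace Rel

variable (x y : ℕ)

@[simp] theorem holds_eq : Rel.eq.Holds x y ↔ x = y := Iff.rfl
@[simp] theorem holds_ne : Rel.ne.Holds x y ↔ x ≠ y := Iff.rfl
@[simp] theorem holds_lt : Rel.lt.Holds x y ↔ x < y := Iff.rfl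
@[simp] theorem holds_le : Rel.le.Holds x y ↔ x ≤ y := Iff.rfl

end Rel

variable [DecidableEq V] [DecidableEq A]

namespace Store

/-- Assign `a` to the variable `x`, which takes one unit of time. -/
def assign (σ : Store V A) (x : V) (a : ℕ) : Store V A where
  var := Function.update σ.var x a
  arr := σ.arr
  time := σ.time + 1

/-- Write `a` into the array `B` at index `i`, which takes one unit of time. -/
def write (σ : Store V A) (B : A) (i a : ℕ) : Store V A where
  var := σ.var
  arr := Function.update σ.arr B (Function.update (σ.arr B) i a)
  time := σ.time + 1

/-- Let one unit of time pass. -/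
def tick (σ : Store V A) : Store V A where
  var := σ.var
  arr := σ.arr
  time := σ.time + 1

section Simp

variable {V A : Type} (σ : Store V A) (x y : V) (B C : A) (i a : ℕ)

@[simp] theorem var_tick : σ.tick.var x = σ.var x := rfl
@[simp] theorem arr_tick : σ.tick.arr B = σ.arr B := rfl
@[simp] theorem time_tick : σ.tick.time = σ.time + 1 := rfl

section

variable [DecidableEq V]

@[simp] theorem var_assign : (σ.assign x a).var y = if y = x then a else σ.var y :=
  Function.update_apply ..
@[simp] theorem arr_assign : (σ.assign x a).arr B = σ.arr B := rfl
@[simp] theorem time_assign : (σ.assign x a).time = σ.time + 1 := rfl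

end

variable [DecidableEq A]

@[simp] theorem var_write : (σ.write B i a).var x = σ.var x := rfl
@[simp] theorem arr_write :
    (σ.write B i a).arr C = if C = B then Function.update (σ.arr B) i a else σ.arr C :=
  Function.update_apply ..
@[simp] theorem time_write : (σ.write B i a).time = σ.time + 1 := rfl

end Simp

end Store

/-- Weakest precondition of a loop with body transformer `W` and at most `f` tests. -/
def iterWp (Z : ℕ) (R : Rel) (a b : Exp V A) (W : (Store V A → Prop) → Store V A → Prop)
    (Q : Store V A → Prop) : ℕ → Store V A → Prop
  | 0, _ => False
  | f + 1, σ => a.Good Z σ ∧ b.Good Z σ ∧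
      (R.Holds (a.val σ) (b.val σ) → W (iterWp Z R a b W Q f) σ.tick) ∧
      (¬ R.Holds (a.val σ) (b.val σ) → Q σ.tick)

/-- Weakest precondition for termination in a store that satisfies `Q`, without ever computing a
value or an array index that is not below `Z`. -/
def wp (Z : ℕ) : Cmd V A → (Store V A → Prop) → Store V A → Prop
  | .skip, Q, σ => Q σ.tick
  | .assign x a, Q, σ => a.Good Z σ ∧ Q (σ.assign x (a.val σ))
  | .write B a b, Q, σ =>
      a.Good Z σ ∧ b.Good Z σ ∧ a.val σ < Z ∧ Q (σ.write B (a.val σ) (b.val σ))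
  | .seq P P', Q, σ => wp Z P (wp Z P' Q) σ
  | .ite R a b P P', Q, σ => a.Good Z σ ∧ b.Good Z σ ∧
      (R.Holds (a.val σ) (b.val σ) → wp Z P Q σ.tick) ∧
      (¬ R.Holds (a.val σ) (b.val σ) → wp Z P' Q σ.tick)
  | .loop R a b P, Q, σ => ∃ f, iterWp Z R a b (wp Z P) Q f σ

variable {Z : ℕ} {Q Q' : Store V A → Prop} {σ : Store V A} {R : Rel} {a b : Exp V A}
  {P P' : Cmd V A}

section Simp

@[simp] theorem wp_skip : wp Z .skip Q σ ↔ Q σ.tick := Iff.rfl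

@[simp] theorem wp_assign {x : V} :
    wp Z (.assign x a) Q σ ↔ a.Good Z σ ∧ Q (σ.assign x (a.val σ)) := Iff.rfl

@[simp] theorem wp_write {B : A} : wp Z (.write B a b) Q σ ↔
    a.Good Z σ ∧ b.Good Z σ ∧ a.val σ < Z ∧ Q (σ.write B (a.val σ) (b.val σ)) := Iff.rfl

@[simp] theorem wp_seq : wp Z (.seq P P') Q σ ↔ wp Z P (wp Z P' Q) σ := Iff.rfl

@[simp] theorem wp_ite : wp Z (.ite R a b P P') Q σ ↔
    a.Good Z σ ∧ b.Good Z σ ∧ (R.Holds (a.val σ) (b.val σ) → wp Z P Q σ.tick) ∧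
      (¬ R.Holds (a.val σ) (b.val σ) → wp Z P' Q σ.tick) := Iff.rfl

end Simp

omit [DecidableEq V] [DecidableEq A] in
theorem iterWp_mono {W : (Store V A → Prop) → Store V A → Prop}
    (hW : ∀ {Q Q' : Store V A → Prop}, (∀ σ, Q σ → Q' σ) → ∀ σ, W Q σ → W Q' σ)
    (h : ∀ σ, Q σ → Q' σ) : ∀ f σ, iterWp Z R a b W Q f σ → iterWp Z R a b W Q' f σ
  | 0, _ => id
  | f + 1, _ => fun ⟨ha, hb, htrue, hfalse⟩ =>
      ⟨ha, hb, fun hr => hW (iterWp_mono hW h f) _ (htrue hr), fun hr => h _ (hfalse hr)⟩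

theorem wp_mono (P : Cmd V A) : ∀ {Q Q' : Store V A → Prop}, (∀ σ, Q σ → Q' σ) →
    ∀ σ, wp Z P Q σ → wp Z P Q' σ := by
  induction P with
  | skip => exact fun h σ => h _
  | assign x a => exact fun h σ => And.imp_right (h _)
  | write B a b => exact fun h σ ⟨ha, hb, hi, hQ⟩ => ⟨ha, hb, hi, h _ hQ⟩
  | seq _ P' ih ih' => exact fun h σ => ih (ih' h) σ
  | ite R a b P P' ih ih' =>
    exact fun h σ ⟨ha, hb, htrue, hfalse⟩ =>
      ⟨ha, hb, fun hr => ih h _ (htrue hr), fun hr => ih' h _ (hfalse hr)⟩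
  | loop R a b P ih => exact fun h σ ⟨f, hf⟩ => ⟨f, iterWp_mono ih h f σ hf⟩

theorem wp_loop_of_variant (Inv : Store V A → Prop) (μ : Store V A → ℕ)
    (h : ∀ σ, Inv σ → a.Good Z σ ∧ b.Good Z σ ∧
      (R.Holds (a.val σ) (b.val σ) → wp Z P (fun σ' => Inv σ' ∧ μ σ' < μ σ) σ.tick) ∧
      (¬ R.Holds (a.val σ) (b.val σ) → Q σ.tick)) (hσ : Inv σ) :
    wp Z (.loop R a b P) Q σ := by
  have key (k : ℕ) : ∀ σ, Inv σ → μ σ < k → iterWp Z R a b (wp Z P) Q k σ := by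
    induction k with
    | zero => exact fun σ _ hk => absurd hk (Nat.not_lt_zero _)
    | succ k ih =>
      intro σ hσ hk
      obtain ⟨ha, hb, htrue, hfalse⟩ := h σ hσ
      exact ⟨ha, hb, fun hr => wp_mono P (fun σ' ⟨hi, _⟩ => ih σ' hi (by omega)) _ (htrue hr),
        hfalse⟩
  exact ⟨_, key _ σ hσ (Nat.lt_succ_self _)⟩

namespace Cmd

/-- Whether the program contains an assignment to the variable `y`. -/
def assigns (y : V) : Cmd V A → Bool
  | .assign x _ => decide (y = x)
  | .seq P Q | .ite _ _ _ P Q => P.assigns y || Q.assigns y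
  | .loop _ _ _ P => P.assigns y
  | _ => false

/-- Whether the program contains a write to the array `C`. -/
def writes (C : A) : Cmd V A → Bool
  | .write B _ _ => decide (C = B)
  | .seq P Q | .ite _ _ _ P Q => P.writes C || Q.writes C
  | .loop _ _ _ P => P.writes C
  | _ => false

/-- The stores agree on all variables and arrays that `P` does not modify. -/
structure Frame (P : Cmd V A) (σ σ' : Store V A) : Prop where
  var : ∀ x, P.assigns x = false → σ'.var x = σ.var x
  arr : ∀ B, P.writes B = false → σ'.arr B = σ.arr B

namespace Frame

variable {σ' σ'' : Store V A}

theorem refl (P : Cmd V A) (σ : Store V A) : P.Frame σ σ := ⟨fun _ _ => rfl, fun _ _ => rfl⟩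

theorem trans (h : P.Frame σ σ') (h' : P.Frame σ' σ'') : P.Frame σ σ'' :=
  ⟨fun x hx => (h'.var x hx).trans (h.var x hx), fun B hB => (h'.arr B hB).trans (h.arr B hB)⟩

theorem mono (h : P.Frame σ σ') (hv : ∀ x, P'.assigns x = false → P.assigns x = false)
    (ha : ∀ B, P'.writes B = false → P.writes B = false) : P'.Frame σ σ' :=
  ⟨fun x hx => h.var x (hv x hx), fun B hB => h.arr B (ha B hB)⟩

theorem of_tick (h : P.Frame σ.tick σ') : P.Frame σ σ' := ⟨h.var, h.arr⟩

end Frame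

end Cmd

theorem wp_frame (P : Cmd V A) : ∀ {Q : Store V A → Prop} {σ : Store V A}, wp Z P Q σ →
    wp Z P (fun σ' => P.Frame σ σ' ∧ Q σ') σ := by
  induction P with
  | skip => exact fun h => ⟨⟨fun _ _ => rfl, fun _ _ => rfl⟩, h⟩
  | assign x a =>
    exact fun h => ⟨h.1, ⟨fun y hy => Function.update_of_ne (of_decide_eq_false hy) ..,
      fun _ _ => rfl⟩, h.2⟩
  | write B a b =>
    exact fun ⟨ha, hb, hi, h⟩ => ⟨ha, hb, hi, ⟨fun _ _ => rfl,
      fun C hC => Function.update_of_ne (of_decide_eq_false hC) ..⟩, h⟩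
  | seq P P' ih ih' =>
    refine fun h => wp_mono P (fun σ' hσ' => wp_mono P' (fun σ'' hσ'' => ⟨?_, hσ''.2⟩) _
      (ih' hσ'.2)) _ (ih h)
    exact (hσ'.1.mono (by simp +contextual [Cmd.assigns]) (by simp +contextual [Cmd.writes])).trans
      (hσ''.1.mono (by simp +contextual [Cmd.assigns]) (by simp +contextual [Cmd.writes]))
  | ite R a b P P' ih ih' =>
    refine fun ⟨ha, hb, htrue, hfalse⟩ => ⟨ha, hb,
      fun hr => wp_mono P (fun σ' => And.imp_left fun h => ?_) _ (ih (htrue hr)),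
      fun hr => wp_mono P' (fun σ' => And.imp_left fun h => ?_) _ (ih' (hfalse hr))⟩
    · exact h.of_tick.mono (by simp +contextual [Cmd.assigns]) (by simp +contextual [Cmd.writes])
    · exact h.of_tick.mono (by simp +contextual [Cmd.assigns]) (by simp +contextual [Cmd.writes])
  | loop R a b P ih =>
    intro Q σ ⟨f, hf⟩
    refine ⟨f, ?_⟩
    have key (f : ℕ) : ∀ σ', P.Frame σ σ' → iterWp Z R a b (wp Z P) Q f σ' →
        iterWp Z R a b (wp Z P) (fun σ'' => P.Frame σ σ'' ∧ Q σ'') f σ' := by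
      induction f with
      | zero => exact fun _ _ => id
      | succ f ihf =>
        exact fun σ' hσ' ⟨ha, hb, htrue, hfalse⟩ => ⟨ha, hb, fun hr =>
          wp_mono P (fun σ'' h => ihf σ'' (hσ'.trans h.1.of_tick) h.2) _ (ih (htrue hr)),
          fun hr => ⟨⟨hσ'.var, hσ'.arr⟩, hfalse hr⟩⟩
    exact iterWp_mono (fun h => wp_mono P h) (fun σ' => And.imp_left fun h => ⟨h.var, h.arr⟩) f σ
      (key f σ (Cmd.Frame.refl P σ) hf)

theorem wp_call (h : wp Z P Q σ) (hQ : ∀ σ', P.Frame σ σ' → Q σ' → Q' σ') : wp Z P Q' σ :=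
  wp_mono P (fun σ' hσ' => hQ σ' hσ'.1 hσ'.2) _ (wp_frame P h)

/-- Total correctness of a loop from an invariant and a variant. The invariant only has to mention
what the body modifies. -/
theorem wp_loop (Inv : Store V A → Prop) (μ : Store V A → ℕ) (hσ : Inv σ)
    (h : ∀ σ', P.Frame σ σ' → Inv σ' → a.Good Z σ' ∧ b.Good Z σ' ∧
      (R.Holds (a.val σ') (b.val σ') → wp Z P (fun σ'' => Inv σ'' ∧ μ σ'' < μ σ') σ'.tick) ∧
      (¬ R.Holds (a.val σ') (b.val σ') → Q σ'.tick)) :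
    wp Z (.loop R a b P) Q σ := by
  refine wp_loop_of_variant (fun σ' => P.Frame σ σ' ∧ Inv σ') μ (fun σ' ⟨hf, hi⟩ => ?_)
    ⟨Cmd.Frame.refl P σ, hσ⟩
  obtain ⟨ha, hb, htrue, hfalse⟩ := h σ' hf hi
  exact ⟨ha, hb, fun hr => wp_call (htrue hr) fun σ'' hf' hi' =>
    ⟨⟨hf.trans hf'.of_tick, hi'.1⟩, hi'.2⟩, hfalse⟩

end Language

section Compiler

/-- The registers and memory segments in which a machine keeps the variables and the arrays. All
segments have the same length `Z`, which is held by register `regs`; the registers above it are used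
to evaluate expressions. -/
structure Layout (V A : Type) where
  reg : V ↪ ℕ
  seg : A ↪ ℕ
  regs : ℕ
  segs : ℕ
  reg_lt : ∀ x, reg x < regs
  seg_lt : ∀ B, seg B < segs

variable {V A : Type} (L : Layout V A)

/-- Turn the index in register `t` into the address of the cell of the array `B`. -/
def Layout.addr (B : A) (t : ℕ) : Prog :=
  .seq (.const (t + 1) (L.seg B))
    (.seq (.arith .mul (t + 1) (t + 1) L.regs) (.arith .add t t (t + 1)))

/-- The machine program that evaluates an expression into register `t`. -/
def Exp.comp : Exp V A → ℕ → Prog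
  | lit k, t => .const t k
  | var x, t => .copy t (L.reg x)
  | bin o a b, t => .seq (a.comp t) (.seq (b.comp (t + 1)) (.arith o t t (t + 1)))
  | idx B a, t => .seq (a.comp t) (.seq (L.addr B t) (.load t t))

/-- The number of machine steps in the evaluation of an expression. -/
def Exp.cost : Exp V A → ℕ
  | lit _ => 1
  | var _ => 1
  | bin _ a b => a.cost + (b.cost + 1)
  | idx _ a => a.cost + (3 + 1)

/-- The machine test for a relation. -/
def Rel.test : Rel → ℕ → ℕ → Test
  | .eq => .eq
  | .ne => .ne
  | .lt => .lt
  | .le => .le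

/-- The machine program that evaluates two expressions into the first two free registers. -/
def Layout.operands (a b : Exp V A) : Prog :=
  .seq (a.comp L (L.regs + 1)) (b.comp L (L.regs + 2))

/-- The machine program for a command. -/
def Cmd.comp : Cmd V A → Prog
  | .skip => .skip
  | .assign x a => .seq (a.comp L (L.regs + 1)) (.copy (L.reg x) (L.regs + 1))
  | .write B a b => .seq (a.comp L (L.regs + 1)) (.seq (L.addr B (L.regs + 1))
      (.seq (b.comp L (L.regs + 2)) (.store (L.regs + 1) (L.regs + 2))))
  | .seq P Q => .seq P.comp Q.comp
  | .ite R a b P Q =>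
    .seq (L.operands a b) (.cond (R.test (L.regs + 1) (L.regs + 2)) P.comp Q.comp)
  | .loop R a b P => .seq (L.operands a b)
      (.loop (R.test (L.regs + 1) (L.regs + 2)) (.seq P.comp (L.operands a b)))

/-- A bound for the number of machine steps that one unit of time stands for. -/
def Cmd.stepsPerTime : Cmd V A → ℕ
  | .skip => 1
  | .assign _ a => a.cost + 1
  | .write _ a b => a.cost + b.cost + 4
  | .seq P Q => max P.stepsPerTime Q.stepsPerTime
  | .ite _ a b P Q => max (a.cost + b.cost + 1) (max P.stepsPerTime Q.stepsPerTime)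
  | .loop _ a b P => max (a.cost + b.cost + 1) P.stepsPerTime

/-- The configuration `ρ` represents the store `σ`. -/
structure Layout.Repr (Z : ℕ) (σ : Store V A) (ρ : State) : Prop where
  reg : ∀ x, ρ.reg (L.reg x) = σ.var x
  size : ρ.reg L.regs = Z
  mem : ∀ B, ∀ i < Z, ρ.mem (L.seg B * Z + i) = σ.arr B i

variable {L} {w Z : ℕ} {σ : Store V A} {ρ ρ' : State} {R : Rel} {a b : Exp V A}

namespace Layout.Repr

theorem congr (h : L.Repr Z σ ρ) (hm : ρ'.mem = ρ.mem)
    (hr : ∀ q ≤ L.regs, ρ'.reg q = ρ.reg q) : L.Repr Z σ ρ' where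
  reg x := (hr _ (L.reg_lt x).le).trans (h.reg x)
  size := (hr _ le_rfl).trans h.size
  mem B i hi := by rw [hm, h.mem B i hi]

theorem tick (h : L.Repr Z σ ρ) : L.Repr Z σ.tick ρ := ⟨h.reg, h.size, h.mem⟩

theorem assign [DecidableEq V] (h : L.Repr Z σ ρ) (x : V) (k : ℕ) :
    L.Repr Z (σ.assign x k) (ρ.setReg (L.reg x) k) where
  reg y := by
    simp only [State.setReg, Store.var_assign, Function.update_apply, L.reg.injective.eq_iff, h.reg]
  size := (Function.update_of_ne (L.reg_lt x).ne' ..).trans h.size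
  mem := h.mem

theorem write [DecidableEq A] (h : L.Repr Z σ ρ) (B : A) {i : ℕ} (hi : i < Z) (k : ℕ) :
    L.Repr Z (σ.write B i k) (ρ.setMem (L.seg B * Z + i) k) where
  reg := h.reg
  size := h.size
  mem C j hj := by
    have seg_eq {D : A} {l : ℕ} (hl : l < Z) : (L.seg D * Z + l) / Z = L.seg D := by
      rw [Nat.add_comm, Nat.add_mul_div_right _ _ (by omega), Nat.div_eq_of_lt hl, Nat.zero_add]
    simp only [State.setMem, Store.arr_write, Function.update_apply]
    by_cases hCB : C = B
    · subst hCB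
      simp [Function.update_apply, h.mem C j hj]
    · rw [if_neg hCB, if_neg fun he => hCB (L.seg.injective ?_), h.mem C j hj]
      exact (seg_eq hj).symm.trans ((congrArg (· / Z) he).trans (seg_eq hi))

end Layout.Repr

theorem Op.eval_eq_val {o : Op} {x y : ℕ} (hZ : Z ≤ 2 ^ w) (h : o.Safe Z x y) :
    o.eval w x y = o.val x y := by
  cases o <;> first | rfl | exact Nat.mod_eq_of_lt (lt_of_lt_of_le h hZ)

theorem Rel.test_holds (p q : ℕ) : (R.test p q).Holds ρ ↔ R.Holds (ρ.reg p) (ρ.reg q) := by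
  cases R <;> rfl

theorem Layout.exec_addr (hZ : L.segs * Z ≤ 2 ^ w) (B : A) {t : ℕ} (ht : L.regs < t)
    (hz : ρ.reg L.regs = Z) (hi : ρ.reg t < Z) :
    ∃ ρ', Exec w (L.addr B t) ρ ρ' 3 ∧ ρ'.reg t = L.seg B * Z + ρ.reg t ∧ ρ'.mem = ρ.mem ∧
      ∀ q < t, ρ'.reg q = ρ.reg q := by
  have hseg : L.seg B * Z + Z ≤ 2 ^ w :=
    (Nat.succ_mul _ _ ▸ Nat.mul_le_mul_right Z (L.seg_lt B)).trans hZ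
  have hB : L.seg B < 2 ^ w := by nlinarith [L.seg_lt B]
  refine ⟨_, .seq (.const ..) (.seq (.arith ..) (.arith ..)), ?_, rfl, fun q hq => ?_⟩
  · simp only [State.setReg, Op.eval, Function.update_self,
      Function.update_of_ne (show L.regs ≠ t + 1 by omega),
      Function.update_of_ne (show t ≠ t + 1 by omega), hz, Nat.mod_eq_of_lt hB]
    rw [Nat.mod_eq_of_lt (show L.seg B * Z < 2 ^ w by omega), Nat.mod_eq_of_lt (by omega),
      Nat.add_comm]
  · simp only [State.setReg, Function.update_of_ne (show q ≠ t by omega),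
      Function.update_of_ne (show q ≠ t + 1 by omega)]

theorem Exp.exec_comp (hZ : L.segs * Z ≤ 2 ^ w) (hZ' : Z ≤ 2 ^ w) (a : Exp V A) :
    ∀ {t : ℕ} {ρ : State}, L.regs < t → L.Repr Z σ ρ → a.Good Z σ →
    ∃ ρ', Exec w (a.comp L t) ρ ρ' a.cost ∧ ρ'.reg t = a.val σ ∧ ρ'.mem = ρ.mem ∧
      ∀ q < t, ρ'.reg q = ρ.reg q := by
  induction a with
  | lit k =>
    intro t ρ _ _ hk
    exact ⟨_, .const .., by simp [State.setReg, Exp.val, Nat.mod_eq_of_lt (lt_of_lt_of_le hk hZ')],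
      rfl, fun q hq => Function.update_of_ne hq.ne ..⟩
  | var x =>
    intro t ρ _ hρ _
    exact ⟨_, .copy .., by simp [State.setReg, Exp.val, hρ.reg], rfl,
      fun q hq => Function.update_of_ne hq.ne ..⟩
  | bin o a b iha ihb =>
    intro t ρ ht hρ ⟨ha, hb, hs⟩
    obtain ⟨ρ₁, e₁, v₁, m₁, r₁⟩ := iha ht hρ ha
    obtain ⟨ρ₂, e₂, v₂, m₂, r₂⟩ := ihb (t := t + 1) (by omega)
      (hρ.congr m₁ fun q hq => r₁ q (by omega)) hb
    refine ⟨_, .seq e₁ (.seq e₂ (.arith ..)), ?_, m₂.trans m₁, fun q hq => ?_⟩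
    · simp only [State.setReg, Function.update_self, v₂, r₂ t (by omega), v₁, Exp.val]
      exact Op.eval_eq_val hZ' hs
    · simp only [State.setReg, Function.update_of_ne hq.ne]
      rw [r₂ q (by omega), r₁ q hq]
  | idx B a ih =>
    intro t ρ ht hρ ⟨ha, hi⟩
    obtain ⟨ρ₁, e₁, v₁, m₁, r₁⟩ := ih ht hρ ha
    obtain ⟨ρ₂, e₂, v₂, m₂, r₂⟩ := L.exec_addr hZ B ht ((r₁ _ ht).trans hρ.size) (v₁ ▸ hi)
    refine ⟨_, .seq e₁ (.seq e₂ (.load ..)), ?_, m₂.trans m₁, fun q hq => ?_⟩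
    · simp only [State.setReg, Function.update_self, v₂, m₂, m₁, v₁, Exp.val]
      exact hρ.mem B _ hi
    · simp only [State.setReg, Function.update_of_ne hq.ne]
      rw [r₂ q hq, r₁ q hq]

theorem Layout.exec_operands (hZ : L.segs * Z ≤ 2 ^ w) (hZ' : Z ≤ 2 ^ w) (ha : a.Good Z σ)
    (hb : b.Good Z σ) (hρ : L.Repr Z σ ρ) :
    ∃ ρ', Exec w (L.operands a b) ρ ρ' (a.cost + b.cost) ∧ L.Repr Z σ ρ' ∧
      ρ'.reg (L.regs + 1) = a.val σ ∧ ρ'.reg (L.regs + 2) = b.val σ := by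
  obtain ⟨ρ₁, e₁, v₁, m₁, r₁⟩ := a.exec_comp hZ hZ' (t := L.regs + 1) (by omega) hρ ha
  have hρ₁ := hρ.congr m₁ fun q hq => r₁ q (by omega)
  obtain ⟨ρ₂, e₂, v₂, m₂, r₂⟩ := b.exec_comp hZ hZ' (t := L.regs + 2) (by omega) hρ₁ hb
  exact ⟨ρ₂, .seq e₁ e₂, hρ₁.congr m₂ fun q hq => r₂ q (by omega),
    (r₂ _ (by omega)).trans v₁, v₂⟩

variable [DecidableEq V] [DecidableEq A] {K : ℕ} {P P' : Cmd V A}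

/-- Started in a configuration that represents `σ`, the machine program `M` halts in one that
represents a store with the property `Q`, after at most `K` steps per unit of time (plus `e`). -/
def Layout.Runs (L : Layout V A) (w Z K e : ℕ) (M : Prog) (Q : Store V A → Prop) (σ : Store V A)
    (ρ : State) : Prop :=
  ∃ σ' ρ' t, Exec w M ρ ρ' t ∧ L.Repr Z σ' ρ' ∧ Q σ' ∧ K * σ.time + t + e ≤ K * σ'.time

theorem Cmd.runs_assign (hZ : L.segs * Z ≤ 2 ^ w) (hZ' : Z ≤ 2 ^ w) {Q : Store V A → Prop} {x : V}
    (hK : a.cost + 1 ≤ K) (h : wp Z (.assign x a) Q σ) (hρ : L.Repr Z σ ρ) :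
    L.Runs w Z K 0 (Cmd.comp L (.assign x a)) Q σ ρ := by
  obtain ⟨ρ₁, e₁, v₁, m₁, r₁⟩ := a.exec_comp hZ hZ' (t := L.regs + 1) (by omega) hρ h.1
  have hρ₁ := hρ.congr m₁ fun q hq => r₁ q (by omega)
  refine ⟨_, _, _, .seq e₁ (.copy ..), v₁ ▸ hρ₁.assign x _, h.2, ?_⟩
  rw [Store.time_assign]
  nlinarith

theorem Cmd.runs_write (hZ : L.segs * Z ≤ 2 ^ w) (hZ' : Z ≤ 2 ^ w) {Q : Store V A → Prop} {B : A}
    (hK : a.cost + b.cost + 4 ≤ K) (h : wp Z (.write B a b) Q σ) (hρ : L.Repr Z σ ρ) :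
    L.Runs w Z K 0 (Cmd.comp L (.write B a b)) Q σ ρ := by
  obtain ⟨ha, hb, hi, hQ⟩ := h
  obtain ⟨ρ₁, e₁, v₁, m₁, r₁⟩ := a.exec_comp hZ hZ' (t := L.regs + 1) (by omega) hρ ha
  have hρ₁ := hρ.congr m₁ fun q hq => r₁ q (by omega)
  obtain ⟨ρ₂, e₂, v₂, m₂, r₂⟩ := L.exec_addr hZ B (by omega) hρ₁.size (v₁ ▸ hi)
  have hρ₂ := hρ₁.congr m₂ fun q hq => r₂ q (by omega)
  obtain ⟨ρ₃, e₃, v₃, m₃, r₃⟩ := b.exec_comp hZ hZ' (t := L.regs + 2) (by omega) hρ₂ hb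
  have hρ₃ := hρ₂.congr m₃ fun q hq => r₃ q (by omega)
  refine ⟨_, _, _, .seq e₁ (.seq e₂ (.seq e₃ (.store ..))), ?_, hQ, ?_⟩
  · rw [v₃, r₃ _ (by omega), v₂, v₁]
    exact hρ₃.write B hi _
  · rw [Store.time_write]
    nlinarith

omit [DecidableEq V] [DecidableEq A] in
theorem iterWp_good {W : (Store V A → Prop) → Store V A → Prop} {Q : Store V A → Prop} :
    ∀ {f}, iterWp Z R a b W Q f σ → a.Good Z σ ∧ b.Good Z σ
  | _ + 1, h => ⟨h.1, h.2.1⟩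

omit [DecidableEq V] [DecidableEq A] in
theorem Cmd.runs_ite (hZ : L.segs * Z ≤ 2 ^ w) (hZ' : Z ≤ 2 ^ w) {Q : Store V A → Prop}
    (hK : a.cost + b.cost + 1 ≤ K) (ha : a.Good Z σ) (hb : b.Good Z σ)
    (htrue : R.Holds (a.val σ) (b.val σ) →
      ∀ {ρ}, L.Repr Z σ.tick ρ → L.Runs w Z K 0 (P.comp L) Q σ.tick ρ)
    (hfalse : ¬ R.Holds (a.val σ) (b.val σ) →
      ∀ {ρ}, L.Repr Z σ.tick ρ → L.Runs w Z K 0 (P'.comp L) Q σ.tick ρ)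
    (hρ : L.Repr Z σ ρ) : L.Runs w Z K 0 (Cmd.comp L (.ite R a b P P')) Q σ ρ := by
  obtain ⟨ρ₁, e₁, hρ₁, va, vb⟩ := L.exec_operands hZ hZ' ha hb hρ
  by_cases hR : R.Holds (a.val σ) (b.val σ)
  · obtain ⟨σ₂, ρ₂, t₂, e₂, hρ₂, h₂, ht₂⟩ := htrue hR hρ₁.tick
    rw [Store.time_tick] at ht₂
    exact ⟨σ₂, ρ₂, _, .seq e₁ (.cond_true (by rwa [Rel.test_holds, va, vb]) e₂), hρ₂, h₂,
      by nlinarith⟩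
  · obtain ⟨σ₂, ρ₂, t₂, e₂, hρ₂, h₂, ht₂⟩ := hfalse hR hρ₁.tick
    rw [Store.time_tick] at ht₂
    exact ⟨σ₂, ρ₂, _, .seq e₁ (.cond_false (by rwa [Rel.test_holds, va, vb]) e₂), hρ₂, h₂,
      by nlinarith⟩

theorem Cmd.runs_iterate (hZ : L.segs * Z ≤ 2 ^ w) (hZ' : Z ≤ 2 ^ w) {Q : Store V A → Prop}
    (hK : a.cost + b.cost + 1 ≤ K)
    (hP : ∀ {Q : Store V A → Prop} {σ ρ}, wp Z P Q σ → L.Repr Z σ ρ →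
      L.Runs w Z K 0 (P.comp L) Q σ ρ) :
    ∀ {f σ ρ}, iterWp Z R a b (wp Z P) Q f σ → L.Repr Z σ ρ →
      ρ.reg (L.regs + 1) = a.val σ → ρ.reg (L.regs + 2) = b.val σ →
      L.Runs w Z K (a.cost + b.cost) (.loop (R.test (L.regs + 1) (L.regs + 2))
        (.seq (P.comp L) (L.operands a b))) Q σ ρ
  | f + 1, σ, ρ, ⟨_, _, htrue, hfalse⟩, hρ, va, vb => by
    by_cases hR : R.Holds (a.val σ) (b.val σ)
    · obtain ⟨σ₁, ρ₁, t₁, e₁, hρ₁, h₁, ht₁⟩ := hP (htrue hR) hρ.tick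
      obtain ⟨ρ₂, e₂, hρ₂, va₂, vb₂⟩ :=
        L.exec_operands hZ hZ' (iterWp_good h₁).1 (iterWp_good h₁).2 hρ₁
      obtain ⟨σ₃, ρ₃, t₃, e₃, hρ₃, h₃, ht₃⟩ := runs_iterate hZ hZ' hK hP h₁ hρ₂ va₂ vb₂
      rw [Store.time_tick] at ht₁
      exact ⟨σ₃, ρ₃, _, .loop_true (by rwa [Rel.test_holds, va, vb]) (.seq e₁ e₂) e₃, hρ₃, h₃,
        by nlinarith⟩
    · exact ⟨_, ρ, _, .loop_false (by rwa [Rel.test_holds, va, vb]), hρ.tick, hfalse hR,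
        by rw [Store.time_tick]; nlinarith⟩

theorem Cmd.runs_comp (hZ : L.segs * Z ≤ 2 ^ w) (hZ' : Z ≤ 2 ^ w) (P : Cmd V A) :
    P.stepsPerTime ≤ K → ∀ {Q : Store V A → Prop} {σ ρ}, wp Z P Q σ → L.Repr Z σ ρ →
    L.Runs w Z K 0 (P.comp L) Q σ ρ := by
  induction P with
  | skip => exact fun hK Q σ ρ h hρ => ⟨_, ρ, 1, .skip _, hρ.tick, h, by
      simp only [stepsPerTime] at hK; rw [Store.time_tick]; nlinarith⟩
  | assign x a => exact fun hK Q σ ρ h hρ => runs_assign hZ hZ' hK h hρ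
  | write B a b => exact fun hK Q σ ρ h hρ => runs_write hZ hZ' hK h hρ
  | seq P P' ih ih' =>
    intro hK Q σ ρ h hρ
    obtain ⟨hP, hP'⟩ := max_le_iff.1 hK
    obtain ⟨σ₁, ρ₁, t₁, e₁, hρ₁, h₁, ht₁⟩ := ih hP h hρ
    obtain ⟨σ₂, ρ₂, t₂, e₂, hρ₂, h₂, ht₂⟩ := ih' hP' h₁ hρ₁
    exact ⟨σ₂, ρ₂, _, .seq e₁ e₂, hρ₂, h₂, by omega⟩
  | ite R a b P P' ih ih' =>
    intro hK Q σ ρ ⟨ha, hb, htrue, hfalse⟩ hρ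
    simp only [stepsPerTime, max_le_iff] at hK
    exact runs_ite hZ hZ' hK.1 ha hb (fun hR _ => ih hK.2.1 (htrue hR))
      (fun hR _ => ih' hK.2.2 (hfalse hR)) hρ
  | loop R a b P ih =>
    intro hK Q σ ρ ⟨f, hf⟩ hρ
    obtain ⟨hab, hP⟩ := max_le_iff.1 hK
    obtain ⟨ρ₁, e₁, hρ₁, va, vb⟩ :=
      L.exec_operands hZ hZ' (iterWp_good hf).1 (iterWp_good hf).2 hρ
    obtain ⟨σ₂, ρ₂, t₂, e₂, hρ₂, h₂, ht₂⟩ := runs_iterate hZ hZ' hab (ih hP) hf hρ₁ va vb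
    exact ⟨σ₂, ρ₂, _, .seq e₁ e₂, hρ₂, h₂, by omega⟩

end Compiler

section Words

/-- The list of letters from `1, …, d` that the number `c` encodes in base `d + 1`. -/
def word (d c : ℕ) : List ℕ := (Nat.digits (d + 1) c).reverse

/-- The concatenation of the words encoded by a list of numbers. -/
def flat (d : ℕ) (cs : List ℕ) : List ℕ := cs.flatMap (word d)

/-- Append the letter `j` to a list of encoded words, extending the last code as long as it stays
below `S`. -/
def snoc (d S : ℕ) (cs : List ℕ) (j : ℕ) : List ℕ :=
  if cs.getLastD 0 * (d + 1) + j < S then cs.dropLast ++ [cs.getLastD 0 * (d + 1) + j]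
  else cs ++ [j]

/-- All codes are positive and below `S`, and all but the last one encode at least `κ` letters. -/
structure Packed (d S κ : ℕ) (cs : List ℕ) : Prop where
  lt : ∀ c ∈ cs, c < S
  ne_zero : ∀ c ∈ cs, c ≠ 0
  le_length : ∀ c ∈ cs.dropLast, κ ≤ (word d c).length

variable {d S κ c j : ℕ} {cs : List ℕ}

@[simp] theorem word_zero : word d 0 = [] := by simp [word]

theorem word_mul_add (hj : 1 ≤ j) (hjd : j ≤ d) : word d (c * (d + 1) + j) = word d c ++ [j] := by
  rw [word, Nat.digits_def' (by omega) (by omega), Nat.mul_add_mod',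
    Nat.mod_eq_of_lt (by omega), Nat.add_comm _ j, Nat.add_mul_div_right _ _ (by omega),
    Nat.div_eq_of_lt (by omega), Nat.zero_add, List.reverse_cons, word]

theorem word_letter (hj : 1 ≤ j) (hjd : j ≤ d) : word d j = [j] := by
  simpa using word_mul_add (c := 0) hj hjd

theorem word_eq_append (hd : 0 < d) (hc : c ≠ 0) :
    word d c = word d (c / (d + 1)) ++ [c % (d + 1)] := by
  rw [word, Nat.digits_def' (by omega) (by omega), List.reverse_cons, word]

theorem flat_append (cs cs' : List ℕ) : flat d (cs ++ cs') = flat d cs ++ flat d cs' :=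
  List.flatMap_append ..

theorem flat_singleton : flat d [c] = word d c := List.flatMap_singleton ..

theorem dropLast_append_getLastD (h : cs ≠ []) : cs.dropLast ++ [cs.getLastD 0] = cs := by
  rw [List.getLastD_eq_getLast?, List.getLast?_eq_some_getLast h, Option.getD_some,
    List.dropLast_append_getLast]

theorem flat_snoc (hj : 1 ≤ j) (hjd : j ≤ d) : flat d (snoc d S cs j) = flat d cs ++ [j] := by
  rw [snoc]
  split_ifs
  · rw [flat_append, flat_singleton, word_mul_add hj hjd, ← List.append_assoc]
    rcases eq_or_ne cs [] with rfl | h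
    · simp [flat]
    · rw [← flat_singleton (c := cs.getLastD 0), ← flat_append, dropLast_append_getLastD h]
  · rw [flat_append, flat_singleton, word_letter hj hjd]

theorem le_length_word (hS : (d + 1) ^ κ ≤ S) (hj : 1 ≤ j) (hjd : j ≤ d)
    (h : S ≤ c * (d + 1) + j) : κ ≤ (word d c).length := by
  have hκ : κ < (word d (c * (d + 1) + j)).length := by
    rw [word, List.length_reverse, Nat.lt_digits_length_iff (by omega)]
    exact hS.trans h
  rw [word_mul_add hj hjd, List.length_append, List.length_singleton] at hκ
  omega

namespace Packed

theorem nil : Packed d S κ [] := ⟨by simp, by simp, by simp⟩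

theorem snoc (h : Packed d S κ cs) (hS : (d + 1) ^ κ ≤ S) (hdS : d < S) (hj : 1 ≤ j)
    (hjd : j ≤ d) : Packed d S κ (snoc d S cs j) := by
  rw [SCP.snoc]
  split_ifs with hlt
  · refine ⟨fun c hc => ?_, fun c hc => ?_, by simpa using h.le_length⟩
    all_goals
      rcases List.mem_append.1 hc with hc | hc
    · exact h.lt c (List.mem_of_mem_dropLast hc)
    · exact List.mem_singleton.1 hc ▸ hlt
    · exact h.ne_zero c (List.mem_of_mem_dropLast hc)
    · have := List.mem_singleton.1 hc
      omega
  · refine ⟨fun c hc => ?_, fun c hc => ?_, fun c hc => ?_⟩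
    · rcases List.mem_append.1 hc with hc | hc
      · exact h.lt c hc
      · have := List.mem_singleton.1 hc
        omega
    · rcases List.mem_append.1 hc with hc | hc
      · exact h.ne_zero c hc
      · have := List.mem_singleton.1 hc
        omega
    · rw [List.dropLast_concat] at hc
      rw [← dropLast_append_getLastD (List.ne_nil_of_mem hc)] at hc
      rcases List.mem_append.1 hc with hc | hc
      · exact h.le_length c hc
      · exact List.mem_singleton.1 hc ▸ le_length_word hS hj hjd (not_lt.1 hlt)

theorem length_mul_le (h : Packed d S κ cs) : cs.length * κ ≤ (flat d cs).length + κ := by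
  rcases eq_or_ne cs [] with rfl | hne
  · simp
  have hsum : cs.dropLast.length * κ ≤ (flat d cs.dropLast).length := by
    rw [flat, List.length_flatMap, ← List.length_map (f := fun c => (word d c).length),
      ← smul_eq_mul]
    refine List.card_nsmul_le_sum _ _ fun k hk => ?_
    obtain ⟨c, hc, rfl⟩ := List.mem_map.1 hk
    exact h.le_length c hc
  rw [← dropLast_append_getLastD hne, flat_append, List.length_append, List.length_append,
    List.length_singleton]
  linarith

end Packed

end Words

section Search

/-- A search tree for the component of `r`, with set of vertices `T`: the list `cs x` encodes a path
from `r` to `x`. The last code and a vertex to which the list without the last code belongs are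
stored as `code x` and `top x`. -/
structure SearchTree (d S κ : ℕ) (G : ℕ → ℕ → ℕ) (r : ℕ) (T : Finset ℕ) (top code : ℕ → ℕ)
    (cs : ℕ → List ℕ) : Prop where
  act_eq : ∀ x ∈ T, act G (flat d (cs x)) r = x
  packed : ∀ x ∈ T, Packed d S κ (cs x)
  length_lt : ∀ x ∈ T, (flat d (cs x)).length < T.card
  code_eq : ∀ x ∈ T, code x = (cs x).getLastD 0
  top_mem : ∀ x ∈ T, top x ∈ T
  top_eq : ∀ x ∈ T, cs (top x) = (cs x).dropLast

variable {d S κ : ℕ} {G : ℕ → ℕ → ℕ} {r : ℕ} {T : Finset ℕ} {top code : ℕ → ℕ} {cs : ℕ → List ℕ}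

theorem SearchTree.singleton (htop : top r = r) (hcode : code r = 0) :
    SearchTree d S κ G r {r} top code (fun _ => []) where
  act_eq := by simp [flat]
  packed := fun _ _ => Packed.nil
  length_lt := by simp [flat]
  code_eq := by simp [hcode]
  top_mem := by simp [htop]
  top_eq := by simp

theorem SearchTree.reach (h : SearchTree d S κ G r T top code cs) {x : ℕ} (hx : x ∈ T) :
    Reach G r x := ⟨_, h.act_eq x hx⟩

theorem SearchTree.code_lt (h : SearchTree d S κ G r T top code cs) (hS : 0 < S) {x : ℕ}
    (hx : x ∈ T) : code x < S := by
  rw [h.code_eq x hx]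
  rcases eq_or_ne (cs x) [] with hnil | hne
  · simpa [hnil] using hS
  · exact (h.packed x hx).lt _
      ((congrArg _ (dropLast_append_getLastD hne)).mp (List.mem_append_right _ (by simp)))

theorem SearchTree.eq_append (h : SearchTree d S κ G r T top code cs) {x : ℕ} (hx : x ∈ T)
    (hc : code x ≠ 0) : cs x = cs (top x) ++ [code x] := by
  rw [h.code_eq x hx] at hc ⊢
  rw [h.top_eq x hx, dropLast_append_getLastD fun hnil => hc (by rw [hnil]; rfl)]

theorem SearchTree.eq_nil (h : SearchTree d S κ G r T top code cs) {x : ℕ} (hx : x ∈ T)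
    (hc : code x = 0) : cs x = [] := by
  by_contra hne
  refine (h.packed x hx).ne_zero _ (List.mem_of_getLast? ?_) hc
  rw [h.code_eq x hx, List.getLastD_eq_getLast?, List.getLast?_eq_some_getLast hne,
    Option.getD_some]

theorem SearchTree.grow (h : SearchTree d S κ G r T top code cs) (hS : (d + 1) ^ κ ≤ S)
    (hdS : d < S) {j x : ℕ} (hj : 1 ≤ j) (hjd : j ≤ d) (hx : x ∈ T) (hnew : G j x ∉ T)
    {top' code' : ℕ → ℕ} (htop : ∀ y ∈ T, top' y = top y) (hcode : ∀ y ∈ T, code' y = code y)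
    (hnewtop : top' (G j x) = if code x * (d + 1) + j < S then top x else x)
    (hnewcode : code' (G j x) = if code x * (d + 1) + j < S then code x * (d + 1) + j else j) :
    SearchTree d S κ G r (insert (G j x) T) top' code'
      (Function.update cs (G j x) (snoc d S (cs x) j)) := by
  have hne {y : ℕ} (hy : y ∈ T) : y ≠ G j x := fun he => hnew (he ▸ hy)
  have hold {y : ℕ} (hy : y ∈ T) :
      Function.update cs (G j x) (snoc d S (cs x) j) y = cs y := Function.update_of_ne (hne hy) ..
  have hcard : (insert (G j x) T).card = T.card + 1 := Finset.card_insert_of_notMem hnew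
  constructor <;> refine (Finset.forall_mem_insert ..).2 ⟨?_, fun y hy => ?_⟩
  · rw [Function.update_self, flat_snoc hj hjd, act_append, h.act_eq x hx, act_cons, act_nil]
  · rw [hold hy, h.act_eq y hy]
  · rw [Function.update_self]
    exact (h.packed x hx).snoc hS hdS hj hjd
  · rw [hold hy]
    exact h.packed y hy
  · rw [Function.update_self, flat_snoc hj hjd, List.length_append, hcard]
    exact Nat.succ_lt_succ (h.length_lt x hx)
  · rw [hold hy, hcard]
    exact (h.length_lt y hy).trans (Nat.lt_succ_self _)
  · rw [Function.update_self, hnewcode, snoc, h.code_eq x hx]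
    split_ifs <;> simp
  · rw [hold hy, hcode y hy, h.code_eq y hy]
  · rw [hnewtop]
    split_ifs
    exacts [Finset.mem_insert_of_mem (h.top_mem x hx), Finset.mem_insert_of_mem hx]
  · exact htop y hy ▸ Finset.mem_insert_of_mem (h.top_mem y hy)
  · rw [hnewtop, Function.update_self, apply_ite (Function.update cs _ _), hold hx,
      hold (h.top_mem x hx), h.top_eq x hx, snoc, ← h.code_eq x hx]
    split_ifs <;> rw [List.dropLast_concat]
  · rw [htop y hy, hold hy, hold (h.top_mem y hy), h.top_eq y hy]

end Search

section Setting

/-- The variables of the decision procedure: the degree `n`, the number `N` of points, the bound `S`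
on the codes of words, and local variables. -/
inductive Var where
  | n | N | S | v | r | s | tl | p | x | j | y | xj | yj | ok | cx | cj | cv | i | k | mid | lo | z
  | zMid | o | c | q | e | eA | oA | oB | rA | rB | res | R | m | t | found
  deriving DecidableEq

/-- The arrays of the decision procedure: the input, the table of the action of words, and local
arrays. -/
inductive Arr where
  | inp | tab | qu | phi | top | code | buf | cand | vis | rep | rsz | cnt
  deriving DecidableEq

/-- The letters `1, …, d` permute the points below `N`, the other letters act trivially, `S` is
large enough for the codes of all words of length `κ`, and `Z` bounds all numbers that occur. -/
structure Setting (d N S Z κ : ℕ) (G : ℕ → ℕ → ℕ) : Prop where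
  actsOn : ActsOn G (Finset.range N)
  triv : ∀ j x, ¬ (1 ≤ j ∧ j ≤ d) → G j x = x
  d_pos : 0 < d
  κ_pos : 0 < κ
  pow_le : (d + 1) ^ κ ≤ S
  tab_le : S * N ≤ Z
  code_le : S * (d + 1) + (d + 1) < Z
  lt_Z : N * (d + 10) + 100 < Z

/-- The array `tab` holds the action of all words with code below `S`. -/
structure Tables (d N S : ℕ) (G : ℕ → ℕ → ℕ) (σ : Store Var Arr) : Prop where
  N_eq : σ.var .N = N
  S_eq : σ.var .S = S
  tab : ∀ c < S, ∀ y < N, σ.arr .tab (c * N + y) = act G (word d c) y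

variable {d N S Z κ : ℕ} {G : ℕ → ℕ → ℕ} {σ σ' : Store Var Arr}

theorem Tables.congr (h : Tables d N S G σ) (hN : σ'.var .N = σ.var .N := by rfl)
    (hS : σ'.var .S = σ.var .S := by rfl) (ht : σ'.arr .tab = σ.arr .tab := by rfl) :
    Tables d N S G σ' :=
  ⟨hN.trans h.N_eq, hS.trans h.S_eq, ht ▸ h.tab⟩

theorem Tables.of_frame {P : Cmd Var Arr} (h : Tables d N S G σ) (hf : P.Frame σ σ')
    (hN : P.assigns .N = false := by rfl) (hS : P.assigns .S = false := by rfl)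
    (ht : P.writes .tab = false := by rfl) : Tables d N S G σ' :=
  h.congr (hf.var _ hN) (hf.var _ hS) (hf.arr _ ht)

namespace Setting

theorem d_lt (hG : Setting d N S Z κ G) : d < S :=
  (Nat.le_self_pow hG.κ_pos.ne' (d + 1)).trans hG.pow_le

theorem apply_lt (hG : Setting d N S Z κ G) (j : ℕ) {x : ℕ} (hx : x < N) : G j x < N :=
  Finset.mem_range.1 (hG.actsOn.mapsTo j x (Finset.mem_range.2 hx))

theorem act_lt (hG : Setting d N S Z κ G) (l : List ℕ) {x : ℕ} (hx : x < N) : act G l x < N :=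
  Finset.mem_range.1 (hG.actsOn.act_mem (Finset.mem_range.2 hx) l)

theorem mem_orb (hG : Setting d N S Z κ G) {x y : ℕ} (hx : x < N) :
    y ∈ orb G (Finset.range N) x ↔ Reach G x y :=
  hG.actsOn.mem_orb (Finset.mem_range.2 hx)

theorem tab_lt (hG : Setting d N S Z κ G) {c y : ℕ} (hc : c < S) (hy : y < N) : c * N + y < Z :=
  calc c * N + y < (c + 1) * N := by rw [Nat.succ_mul]; omega
    _ ≤ S * N := Nat.mul_le_mul_right _ hc
    _ ≤ Z := hG.tab_le

theorem code_lt (hG : Setting d N S Z κ G) {c j : ℕ} (hc : c < S) (hj : j ≤ d) :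
    c * (d + 1) + j < Z := by
  have hle : c * (d + 1) ≤ S * (d + 1) := Nat.mul_le_mul_right _ hc.le
  have := hG.code_le
  omega

theorem mul_d_lt (hG : Setting d N S Z κ G) : N * d + 10 * N + 100 < Z := by
  have := hG.lt_Z
  rw [Nat.mul_add] at this
  omega

theorem d_lt_Z (hG : Setting d N S Z κ G) : d + 1 < Z := by
  have := hG.code_le
  omega

theorem tab_letter (hG : Setting d N S Z κ G) (hσ : Tables d N S G σ) {j y : ℕ} (hj : 1 ≤ j)
    (hjd : j ≤ d) (hy : y < N) : σ.arr .tab (j * N + y) = G j y := by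
  rw [hσ.tab j (hjd.trans_lt hG.d_lt) y hy, word_letter hj hjd]
  rfl

end Setting

end Setting

section Search

/-- The point that the word leading from `r` to `x` in the search tree reaches from `s`. -/
def image (d : ℕ) (G : ℕ → ℕ → ℕ) (s : ℕ) (cs : ℕ → List ℕ) (x : ℕ) : ℕ := act G (flat d (cs x)) s

/-- The edge with label `j` from `x` to `y` shows that the relations of `r` and `s` differ. -/
structure Conflict (d : ℕ) (G : ℕ → ℕ → ℕ) (s : ℕ) (T : Finset ℕ) (cs : ℕ → List ℕ) (x j y : ℕ) :
    Prop where
  source_mem : x ∈ T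
  target_mem : y ∈ T
  pos : 1 ≤ j
  le : j ≤ d
  apply_eq : G j x = y
  apply_ne : G j (image d G s cs x) ≠ image d G s cs y

/-- The invariant of the breadth-first search from the pair `r`, `s`. The queue `qu` of length `tl`
enumerates the set `T` of the vertices found so far, and `phi` maps them to their images, shifted by
one so that `0` marks the other points. The edges are numbered such that edge `e` leaves vertex
`e / d` of the queue with label `e % d + 1`; those before `p` have been explored. -/
structure Search (d N S κ : ℕ) (G : ℕ → ℕ → ℕ) (r s : ℕ) (σ : Store Var Arr) (T : Finset ℕ)
    (cs : ℕ → List ℕ) : Prop where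
  tree : SearchTree d S κ G r T (σ.arr .top) (σ.arr .code) cs
  root_mem : r ∈ T
  root_eq : cs r = []
  queue : Set.BijOn (σ.arr .qu) (Set.Iio (σ.var .tl)) T
  phi : ∀ x < N, σ.arr .phi x = if x ∈ T then image d G s cs x + 1 else 0
  edge_le : σ.var .p ≤ σ.var .tl * d
  closed : ∀ e < σ.var .p, G (e % d + 1) (σ.arr .qu (e / d)) ∈ T
  hom : σ.var .ok = 1 → ∀ e < σ.var .p, image d G s cs (G (e % d + 1) (σ.arr .qu (e / d))) =
    G (e % d + 1) (image d G s cs (σ.arr .qu (e / d)))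
  conflict : σ.var .ok ≠ 1 → Conflict d G s T cs (σ.var .cx) (σ.var .cj) (σ.var .cv)

/-- The result of the breadth-first search from the pair `r`, `s`. -/
structure Searched (d N S κ : ℕ) (G : ℕ → ℕ → ℕ) (r s : ℕ) (σ : Store Var Arr)
    (cs : ℕ → List ℕ) : Prop where
  tree : SearchTree d S κ G r (orb G (Finset.range N) r) (σ.arr .top) (σ.arr .code) cs
  queue : Set.BijOn (σ.arr .qu) (Set.Iio (σ.var .tl)) (orb G (Finset.range N) r)
  hom : σ.var .ok = 1 → ∀ l l', act G l r = act G l' r → act G l s = act G l' s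
  conflict : σ.var .ok ≠ 1 →
    Conflict d G s (orb G (Finset.range N) r) cs (σ.var .cx) (σ.var .cj) (σ.var .cv)

/-- Explore the edge number `p`. -/
def searchStep (d : ℕ) : Cmd Var Arr := .block [
  .assign .x (.idx .qu (.var .p / .lit d)),
  .assign .j (.var .p % .lit d + 1),
  .assign .y (.idx .phi (.var .x) - 1),
  .assign .xj (.idx .tab (.var .j * .var .N + .var .x)),
  .assign .yj (.idx .tab (.var .j * .var .N + .var .y)),
  .ite .eq (.idx .phi (.var .xj)) 0
    (.block [
      .write .phi (.var .xj) (.var .yj + 1),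
      .write .qu (.var .tl) (.var .xj),
      .assign .tl (.var .tl + 1),
      .ite .lt (.idx .code (.var .x) * .lit (d + 1) + .var .j) (.var .S)
        (.block [
          .write .code (.var .xj) (.idx .code (.var .x) * .lit (d + 1) + .var .j),
          .write .top (.var .xj) (.idx .top (.var .x))])
        (.block [
          .write .code (.var .xj) (.var .j),
          .write .top (.var .xj) (.var .x)])])
    (.ite .ne (.idx .phi (.var .xj)) (.var .yj + 1)
      (.block [
        .assign .ok 0,
        .assign .cx (.var .x),
        .assign .cj (.var .j),
        .assign .cv (.var .xj)])
      .skip),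
  .assign .p (.var .p + 1)]

/-- Start the search with the pair `r`, `s`. -/
def searchInit : Cmd Var Arr := .block [
  .write .qu 0 (.var .r),
  .write .phi (.var .r) (.var .s + 1),
  .write .top (.var .r) (.var .r),
  .write .code (.var .r) 0,
  .assign .tl 1,
  .assign .ok 1,
  .assign .p 0]

/-- Erase the images of the vertices in the queue. -/
def clearImages : Cmd Var Arr := .block [
  .assign .i 0,
  .loop .lt (.var .i) (.var .tl) (.block [
    .write .phi (.idx .qu (.var .i)) 0,
    .assign .i (.var .i + 1)])]

/-- Breadth-first search in the component of `r`, carried along in the component of `s`. -/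
def search (d : ℕ) : Cmd Var Arr := .block [
  searchInit,
  .loop .lt (.var .p) (.var .tl * .lit d) (searchStep d),
  clearImages]

variable {d N S Z κ r s j x y : ℕ} {G : ℕ → ℕ → ℕ} {σ σ' : Store Var Arr} {T : Finset ℕ}
  {cs : ℕ → List ℕ}

theorem image_update_of_mem {L : List ℕ} (hx : x ∈ T) (hy : y ∉ T) :
    image d G s (Function.update cs y L) x = image d G s cs x := by
  rw [image, Function.update_of_ne (ne_of_mem_of_not_mem hx hy), image]

theorem image_update_snoc (hj : 1 ≤ j) (hjd : j ≤ d) :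
    image d G s (Function.update cs y (snoc d S (cs x) j)) y = G j (image d G s cs x) := by
  rw [image, Function.update_self, flat_snoc hj hjd, act_append, image, act_cons, act_nil]

theorem bijOn_update_succ {f : ℕ → ℕ} {n : ℕ} (h : Set.BijOn f (Set.Iio n) T) (hy : y ∉ T) :
    Set.BijOn (Function.update f n y) (Set.Iio (n + 1)) (insert y T : Finset ℕ) := by
  have hcongr : Set.EqOn f (Function.update f n y) (Set.Iio n) := fun i hi =>
    (Function.update_of_ne (ne_of_lt hi) ..).symm
  have hinsert := (h.congr hcongr).insert (a := n) (by simpa using hy)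
  have hIio : Set.Iio (n + 1) = insert n (Set.Iio n) := by
    ext i
    simp only [Set.mem_Iio, Set.mem_insert_iff]
    omega
  rwa [Function.update_self, ← hIio, ← Finset.coe_insert] at hinsert

theorem Searched.of_frame {P : Cmd Var Arr} (h : Searched d N S κ G r s σ cs) (hf : P.Frame σ σ')
    (hvar : ∀ u ∈ [Var.tl, .ok, .cx, .cj, .cv], P.assigns u = false := by decide)
    (harr : ∀ B ∈ [Arr.qu, .top, .code], P.writes B = false := by decide) :
    Searched d N S κ G r s σ' cs := by
  simp only [List.forall_mem_cons] at hvar harr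
  obtain ⟨htl, hok, hcx, hcj, hcv, -⟩ := hvar
  obtain ⟨hqu, htop, hcode, -⟩ := harr
  refine ⟨?_, ?_, ?_, ?_⟩
  · simpa only [hf.arr _ htop, hf.arr _ hcode] using h.tree
  · simpa only [hf.arr _ hqu, hf.var _ htl] using h.queue
  · simpa only [hf.var _ hok] using h.hom
  · simpa only [hf.var _ hok, hf.var _ hcx, hf.var _ hcj, hf.var _ hcv] using h.conflict

namespace Search

theorem tick (h : Search d N S κ G r s σ T cs) : Search d N S κ G r s σ.tick T cs :=
  ⟨h.tree, h.root_mem, h.root_eq, h.queue, h.phi, h.edge_le, h.closed, h.hom, h.conflict⟩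

theorem queue_mem (h : Search d N S κ G r s σ T cs) {e : ℕ} (he : e < σ.var .tl * d) :
    σ.arr .qu (e / d) ∈ T :=
  h.queue.mapsTo (Nat.div_lt_of_lt_mul (he.trans_eq (Nat.mul_comm ..)))

theorem mem_iff (h : Search d N S κ G r s σ T cs) (hx : x < N) : σ.arr .phi x ≠ 0 ↔ x ∈ T := by
  rw [h.phi x hx]
  split_ifs with hT <;> simp [hT]

theorem mem_lt (hG : Setting d N S Z κ G) (hr : r < N) (h : Search d N S κ G r s σ T cs)
    (hx : x ∈ T) : x < N := h.tree.act_eq x hx ▸ hG.act_lt _ hr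

theorem length_le (hG : Setting d N S Z κ G) (hr : r < N) (h : Search d N S κ G r s σ T cs) :
    σ.var .tl ≤ N := by
  rw [← Finset.card_range N, ← Nat.card_Iio (σ.var .tl)]
  exact Finset.card_le_card_of_injOn (σ.arr .qu)
    (fun i hi => Finset.mem_coe.2 (Finset.mem_range.2
      (h.mem_lt hG hr (h.queue.mapsTo (by simpa using hi)))))
    (by simpa using h.queue.injOn)

theorem addVertex (hG : Setting d N S Z κ G) (h : Search d N S κ G r s σ T cs)
    (hp : σ.var .p < σ.var .tl * d) (hx : σ.arr .qu (σ.var .p / d) = x) (hj : σ.var .p % d + 1 = j)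
    (hy : G j x = y) (hnew : y ∉ T)
    (hok : σ'.var .ok = σ.var .ok) (hcx : σ'.var .cx = σ.var .cx) (hcj : σ'.var .cj = σ.var .cj)
    (hcv : σ'.var .cv = σ.var .cv) (htl : σ'.var .tl = σ.var .tl + 1)
    (hp' : σ'.var .p = σ.var .p + 1)
    (hqu : σ'.arr .qu = Function.update (σ.arr .qu) (σ.var .tl) y)
    (hphi : σ'.arr .phi = Function.update (σ.arr .phi) y (G j (image d G s cs x) + 1))
    (htop : σ'.arr .top = Function.update (σ.arr .top) y
      (if σ.arr .code x * (d + 1) + j < S then σ.arr .top x else x))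
    (hcode : σ'.arr .code = Function.update (σ.arr .code) y
      (if σ.arr .code x * (d + 1) + j < S then σ.arr .code x * (d + 1) + j else j)) :
    Search d N S κ G r s σ' (insert y T) (Function.update cs y (snoc d S (cs x) j)) := by
  have hj1 : 1 ≤ j := by omega
  have hjd : j ≤ d := hj ▸ Nat.mod_lt _ hG.d_pos
  have hxT : x ∈ T := hx ▸ h.queue_mem hp
  have hne {z : ℕ} (hz : z ∈ T) : z ≠ y := ne_of_mem_of_not_mem hz hnew
  have hcard : (insert y T).card = T.card + 1 := Finset.card_insert_of_notMem hnew
  have hquOld {e : ℕ} (he : e < σ.var .tl * d) : σ'.arr .qu (e / d) = σ.arr .qu (e / d) := by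
    rw [hqu, Function.update_of_ne]
    exact (Nat.div_lt_of_lt_mul (he.trans_eq (Nat.mul_comm ..))).ne
  have himg {z : ℕ} (hz : z ∈ T) := image_update_of_mem (d := d) (G := G) (s := s) (cs := cs)
    (L := snoc d S (cs x) j) hz hnew
  constructor
  · subst hy
    exact h.tree.grow hG.pow_le hG.d_lt hj1 hjd hxT hnew
      (fun z hz => by rw [htop, Function.update_of_ne (hne hz)])
      (fun z hz => by rw [hcode, Function.update_of_ne (hne hz)])
      (by rw [htop, Function.update_self]) (by rw [hcode, Function.update_self])
  · exact Finset.mem_insert_of_mem h.root_mem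
  · rw [Function.update_of_ne (hne h.root_mem), h.root_eq]
  · rw [hqu, htl]
    exact bijOn_update_succ h.queue hnew
  · intro z hz
    rw [hphi]
    rcases eq_or_ne z y with rfl | hzy
    · rw [Function.update_self, if_pos (Finset.mem_insert_self ..), image_update_snoc hj1 hjd]
    · rw [Function.update_of_ne hzy, h.phi z hz]
      by_cases hzT : z ∈ T <;> simp [hzT, hzy, himg]
  · rw [hp', htl, Nat.add_mul]
    exact Nat.add_le_add hp.le (by have := hG.d_pos; omega)
  · intro e he
    rcases Nat.lt_succ_iff_lt_or_eq.1 (he.trans_eq hp') with he | rfl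
    · rw [hquOld (he.trans hp)]
      exact Finset.mem_insert_of_mem (h.closed e he)
    · rw [hquOld hp, hx, hj, hy]
      exact Finset.mem_insert_self ..
  · intro hok' e he
    rcases Nat.lt_succ_iff_lt_or_eq.1 (he.trans_eq hp') with he | rfl
    · rw [hquOld (he.trans hp), himg (h.queue_mem (he.trans hp)), himg (h.closed e he)]
      exact h.hom (hok ▸ hok') e he
    · rw [hquOld hp, hx, hj, hy, himg hxT, image_update_snoc hj1 hjd]
  · intro hok'
    rw [hcx, hcj, hcv]
    obtain ⟨hs, ht, h1, hd, heq, hne⟩ := h.conflict (hok ▸ hok')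
    exact ⟨Finset.mem_insert_of_mem hs, Finset.mem_insert_of_mem ht, h1, hd, heq,
      by rwa [himg hs, himg ht]⟩

theorem keepVertices (h : Search d N S κ G r s σ T cs)
    (hp : σ.var .p < σ.var .tl * d) (hx : σ.arr .qu (σ.var .p / d) = x) (hj : σ.var .p % d + 1 = j)
    (hold : G j x ∈ T) (htl : σ'.var .tl = σ.var .tl)
    (hp' : σ'.var .p = σ.var .p + 1) (hqu : σ'.arr .qu = σ.arr .qu)
    (hphi : σ'.arr .phi = σ.arr .phi) (htop : σ'.arr .top = σ.arr .top)
    (hcode : σ'.arr .code = σ.arr .code)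
    (hhom : σ'.var .ok = 1 →
      σ.var .ok = 1 ∧ image d G s cs (G j x) = G j (image d G s cs x))
    (hconf : σ'.var .ok ≠ 1 → Conflict d G s T cs (σ'.var .cx) (σ'.var .cj) (σ'.var .cv)) :
    Search d N S κ G r s σ' T cs where
  tree := htop ▸ hcode ▸ h.tree
  root_mem := h.root_mem
  root_eq := h.root_eq
  queue := hqu ▸ htl ▸ h.queue
  phi := hphi ▸ h.phi
  edge_le := by rw [hp', htl]; exact hp
  closed e he := by
    rw [hqu]
    rcases Nat.lt_succ_iff_lt_or_eq.1 (he.trans_eq hp') with he | rfl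
    exacts [h.closed e he, hx ▸ hj ▸ hold]
  hom hok e he := by
    rw [hqu]
    rcases Nat.lt_succ_iff_lt_or_eq.1 (he.trans_eq hp') with he | rfl
    exacts [h.hom (hhom hok).1 e he, hx ▸ hj ▸ (hhom hok).2]
  conflict := hconf

theorem start (hr : r < N) (hphi : ∀ x < N, σ.arr .phi x = 0)
    (hqu : σ'.arr .qu 0 = r) (hphi' : σ'.arr .phi = Function.update (σ.arr .phi) r (s + 1))
    (htop : σ'.arr .top r = r) (hcode : σ'.arr .code r = 0) (htl : σ'.var .tl = 1)
    (hok : σ'.var .ok = 1) (hp : σ'.var .p = 0) :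
    Search d N S κ G r s σ' {r} (fun _ => []) where
  tree := .singleton htop hcode
  root_mem := Finset.mem_singleton_self r
  root_eq := rfl
  queue := by
    rw [htl, show Set.Iio 1 = {0} by ext; simp, Finset.coe_singleton, Set.bijOn_singleton, hqu]
  phi x hx := by
    rw [hphi']
    rcases eq_or_ne x r with rfl | hne
    · simp [image, flat]
    · simp [hne, hphi x hx]
  edge_le := by omega
  closed := by omega
  hom := by omega
  conflict := by omega

theorem exists_edge (hG : Setting d N S Z κ G) (h : Search d N S κ G r s σ T cs)
    (hp : σ.var .tl * d ≤ σ.var .p) (hx : x ∈ T) (hj : 1 ≤ j) (hjd : j ≤ d) :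
    ∃ e < σ.var .p, e % d + 1 = j ∧ σ.arr .qu (e / d) = x := by
  obtain ⟨i, hi, rfl⟩ := h.queue.surjOn hx
  have hlt : i * d + (j - 1) < (i + 1) * d := by rw [Nat.succ_mul]; omega
  refine ⟨i * d + (j - 1), (hlt.trans_le (Nat.mul_le_mul_right d hi)).trans_le hp, ?_, ?_⟩
  · rw [Nat.mul_add_mod', Nat.mod_eq_of_lt (by omega)]
    omega
  · rw [Nat.add_comm, Nat.add_mul_div_right _ _ hG.d_pos, Nat.div_eq_of_lt (by omega), Nat.zero_add]

theorem apply_mem (hG : Setting d N S Z κ G) (h : Search d N S κ G r s σ T cs)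
    (hp : σ.var .tl * d ≤ σ.var .p) (hx : x ∈ T) : G j x ∈ T := by
  by_cases hj : 1 ≤ j ∧ j ≤ d
  · obtain ⟨e, he, rfl, rfl⟩ := h.exists_edge hG hp hx hj.1 hj.2
    exact h.closed e he
  · rwa [hG.triv j x hj]

theorem image_apply (hG : Setting d N S Z κ G) (h : Search d N S κ G r s σ T cs)
    (hp : σ.var .tl * d ≤ σ.var .p) (hok : σ.var .ok = 1) (hx : x ∈ T) :
    image d G s cs (G j x) = G j (image d G s cs x) := by
  by_cases hj : 1 ≤ j ∧ j ≤ d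
  · obtain ⟨e, he, rfl, rfl⟩ := h.exists_edge hG hp hx hj.1 hj.2
    exact h.hom hok e he
  · rw [hG.triv j _ hj, hG.triv j _ hj]

theorem act_mem (hG : Setting d N S Z κ G) (h : Search d N S κ G r s σ T cs)
    (hp : σ.var .tl * d ≤ σ.var .p) (l : List ℕ) (hx : x ∈ T) : act G l x ∈ T := by
  induction l generalizing x with
  | nil => exact hx
  | cons j _ ih => exact ih (h.apply_mem hG hp hx)

theorem image_act (hG : Setting d N S Z κ G) (h : Search d N S κ G r s σ T cs)
    (hp : σ.var .tl * d ≤ σ.var .p) (hok : σ.var .ok = 1) (l : List ℕ) (hx : x ∈ T) :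
    image d G s cs (act G l x) = act G l (image d G s cs x) := by
  induction l generalizing x with
  | nil => rfl
  | cons j l ih =>
    rw [act_cons, ih (h.apply_mem hG hp hx), h.image_apply hG hp hok hx, act_cons]

theorem eq_orb (hG : Setting d N S Z κ G) (hr : r < N) (h : Search d N S κ G r s σ T cs)
    (hp : σ.var .tl * d ≤ σ.var .p) : T = orb G (Finset.range N) r := by
  ext x
  rw [hG.mem_orb hr]
  exact ⟨h.tree.reach, fun ⟨l, hl⟩ => hl ▸ h.act_mem hG hp l h.root_mem⟩

theorem searched (hG : Setting d N S Z κ G) (hr : r < N) (h : Search d N S κ G r s σ T cs)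
    (hp : σ.var .tl * d ≤ σ.var .p) : Searched d N S κ G r s σ cs := by
  obtain rfl := h.eq_orb hG hr hp
  refine ⟨h.tree, h.queue, fun hok l l' hl => ?_, h.conflict⟩
  have hs : image d G s cs r = s := by rw [image, h.root_eq]; rfl
  rw [← hs, ← h.image_act hG hp hok l h.root_mem, hl, h.image_act hG hp hok l' h.root_mem]

end Search

end Search

section Search

variable {d N S Z κ r s : ℕ} {G : ℕ → ℕ → ℕ} {σ σ' : Store Var Arr} {T : Finset ℕ}
  {cs : ℕ → List ℕ}

theorem wp_searchStep (hG : Setting d N S Z κ G) (hσ : Tables d N S G σ) (hr : r < N) (hs : s < N)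
    (h : Search d N S κ G r s σ T cs) (hp : σ.var .p < σ.var .tl * d) :
    wp Z (searchStep d) (fun σ' => (∃ T cs, Search d N S κ G r s σ' T cs) ∧
      σ'.var .p = σ.var .p + 1 ∧ σ'.time ≤ σ.time + 20) σ := by
  obtain ⟨x, hx⟩ : ∃ x, σ.arr .qu (σ.var .p / d) = x := ⟨_, rfl⟩
  obtain ⟨j, hj⟩ : ∃ j, σ.var .p % d + 1 = j := ⟨_, rfl⟩
  have hj1 : 1 ≤ j := by omega
  have hjd : j ≤ d := hj ▸ Nat.mod_lt _ hG.d_pos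
  have hxT : x ∈ T := hx ▸ h.queue_mem hp
  have hxN := h.mem_lt hG hr hxT
  have hphi : σ.arr .phi x = image d G s cs x + 1 := by rw [h.phi x hxN, if_pos hxT]
  have hyN : image d G s cs x < N := hG.act_lt _ hs
  have htx := hG.tab_letter hσ hj1 hjd hxN
  have hty := hG.tab_letter hσ hj1 hjd hyN
  have hxjN := hG.apply_lt j hxN
  have hyjN := hG.apply_lt j hyN
  have htl : σ.var .tl * d ≤ N * d := Nat.mul_le_mul_right _ (h.length_le hG hr)
  have htlN := h.length_le hG hr
  have hNd := hG.mul_d_lt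
  have hcode := hG.code_lt (h.tree.code_lt (by have := hG.d_lt; omega) hxT) hjd
  have hdS := hG.d_lt
  have htabx := hG.tab_lt (hjd.trans_lt hdS) hxN
  have htaby := hG.tab_lt (hjd.trans_lt hdS) hyN
  have hdZ : d + 1 < Z := by have := hG.code_le; omega
  have hpd : σ.var .p / d ≤ σ.var .p := Nat.div_le_self ..
  simp only [searchStep, Cmd.block, wp_seq, wp_assign, Exp.good_idx, Exp.good_div, Exp.good_var,
    Exp.good_lit, true_and, Exp.val_div, Exp.val_var, Exp.val_lit, Exp.val_idx, hx, Exp.good_add,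
    Exp.good_mod, Exp.good_ofNat, Exp.val_mod, Store.var_assign, reduceCtorEq, ↓reduceIte,
    Exp.val_ofNat, hj, Exp.val_add, Exp.good_sub, Exp.val_sub, Store.arr_assign, hphi,
    add_tsub_cancel_right, Exp.good_mul, hσ.N_eq, Exp.val_mul, and_self_right, htx, hty, wp_ite,
    Rel.holds_eq, wp_write, Store.var_tick, Store.var_write, Store.arr_write, Store.arr_tick,
    hσ.S_eq, Rel.holds_lt, Store.time_assign, Store.time_write, Store.time_tick,
    add_le_add_iff_right, not_lt, and_self_left, Rel.holds_ne, ne_eq, Decidable.not_not, wp_skip]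
  refine ⟨by omega, by omega, by omega, by omega, by omega, by omega, by omega,
    fun hnew => ?_, fun hold => ?_⟩
  · have hnew : G j x ∉ T := fun hm => (h.mem_iff hxjN).2 hm hnew
    refine ⟨by omega, by omega, by omega, by omega, by omega, fun hlt => ?_, fun hle => ?_⟩
    · exact ⟨by omega, by omega, by omega, by omega, by omega,
        ⟨_, _, h.addVertex hG hp hx hj rfl hnew rfl rfl rfl rfl rfl rfl rfl rfl (by simp [hlt])
          (by simp [hlt])⟩, by omega⟩
    · exact ⟨by omega, by omega,
        ⟨_, _, h.addVertex hG hp hx hj rfl hnew rfl rfl rfl rfl rfl rfl rfl rfl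
          (by simp [hle.not_gt]) (by simp [hle.not_gt])⟩, by omega⟩
  · have hold : G j x ∈ T := (h.mem_iff hxjN).1 hold
    rw [h.phi _ hxjN, if_pos hold]
    refine ⟨by omega, by omega, fun hne => ?_, fun heq => ?_⟩
    · exact ⟨by omega, by omega, ⟨_, _, h.keepVertices hp hx hj hold rfl rfl rfl rfl rfl rfl
        (fun hok => by simp at hok)
        fun _ => ⟨hxT, hold, hj1, hjd, rfl, fun he => hne (congrArg (· + 1) he.symm)⟩⟩, by omega⟩
    · exact ⟨by omega, ⟨_, _, h.keepVertices hp hx hj hold rfl rfl rfl rfl rfl rfl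
        (fun hok => ⟨hok, by omega⟩) h.conflict⟩, by omega⟩

theorem wp_searchInit (hG : Setting d N S Z κ G) (hr : σ.var .r < N) (hs : σ.var .s < N)
    (hphi : ∀ x < N, σ.arr .phi x = 0) :
    wp Z searchInit (fun σ' => Search d N S κ G (σ.var .r) (σ.var .s) σ' {σ.var .r} (fun _ => []) ∧
      σ'.var .p = 0 ∧ σ'.time ≤ σ.time + 7) σ := by
  have hNd := hG.mul_d_lt
  simp only [searchInit, Cmd.block, wp_seq, wp_write, Exp.good_ofNat, Exp.good_var, Exp.val_ofNat,
    Exp.val_var, Exp.good_add, Store.var_write, true_and, Exp.val_add, wp_assign, Store.var_assign,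
    ↓reduceIte, Store.time_assign, Store.time_write, Std.le_refl, and_self, and_true, and_self_left]
  exact ⟨by omega, by omega, by omega, by omega, by omega, by omega, by omega,
    Search.start hr hphi (by simp) (by simp) (by simp) (by simp) (by simp) (by simp) (by simp)⟩

theorem wp_clearImages (htl : σ.var .tl < Z) (hqu : ∀ i < σ.var .tl, σ.arr .qu i < Z)
    (hphi : ∀ x < N, σ.arr .phi x ≠ 0 → ∃ i < σ.var .tl, σ.arr .qu i = x) :
    wp Z clearImages (fun σ' => (∀ x < N, σ'.arr .phi x = 0) ∧
      σ'.time ≤ σ.time + 3 * σ.var .tl + 2) σ := by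
  simp only [clearImages, Cmd.block, wp_seq, wp_assign, Exp.good_zero, Exp.val_zero]
  refine ⟨by omega, wp_loop (fun τ => τ.var .i ≤ σ.var .tl ∧
    (∀ x < N, τ.arr .phi x ≠ 0 → ∃ i, τ.var .i ≤ i ∧ i < σ.var .tl ∧ σ.arr .qu i = x) ∧
    τ.time ≤ σ.time + 3 * τ.var .i + 1) (fun τ => σ.var .tl - τ.var .i)
    ⟨Nat.zero_le _, fun x hx hne => ?_, le_rfl⟩ fun τ hf ⟨_, hτ, _⟩ => ?_⟩
  · obtain ⟨i, hi, hx⟩ := hphi x hx hne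
    exact ⟨i, by simp, hi, hx⟩
  have htl' : τ.var .tl = σ.var .tl := hf.var .tl rfl
  have hqu' : τ.arr .qu = σ.arr .qu := hf.arr .qu rfl
  refine ⟨trivial, trivial, fun hlt => ?_, fun hge => ?_⟩
  · simp only [Exp.val_var, Rel.holds_lt, htl'] at hlt
    have := hqu _ hlt
    simp only [ne_eq, wp_seq, wp_write, Exp.good_idx, Exp.good_var, Exp.val_var, Store.var_tick,
      true_and, Exp.good_ofNat, Exp.val_idx, Store.arr_tick, hqu', Exp.val_ofNat, wp_assign,
      Exp.good_add, Store.var_write, Exp.val_add, Store.var_assign, ↓reduceIte,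
      Order.add_one_le_iff, Store.arr_assign, Store.arr_write, Store.time_assign, Store.time_write,
      Store.time_tick, add_le_add_iff_right]
    refine ⟨by omega, by omega, by omega, ⟨by omega, by omega⟩,
      ⟨hlt, fun x hx hne => ?_, by omega⟩, by omega⟩
    rcases eq_or_ne x (σ.arr .qu (τ.var .i)) with rfl | hxi
    · simp at hne
    · rw [Function.update_of_ne hxi] at hne
      obtain ⟨i, hle, hi, rfl⟩ := hτ x hx hne
      exact ⟨i, lt_of_le_of_ne hle fun he => hxi (he ▸ rfl), hi, rfl⟩
  · simp only [Exp.val_var, Rel.holds_lt, htl'] at hge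
    refine ⟨fun x hx => by_contra fun hne => ?_, by simp only [Store.time_tick]; omega⟩
    obtain ⟨i, hle, hi, -⟩ := hτ x hx hne
    omega

theorem wp_search (hG : Setting d N S Z κ G) (hσ : Tables d N S G σ) (hr : σ.var .r < N)
    (hs : σ.var .s < N) (hphi : ∀ x < N, σ.arr .phi x = 0) :
    wp Z (search d) (fun σ' => (∀ x < N, σ'.arr .phi x = 0) ∧
      (∃ cs, Searched d N S κ G (σ.var .r) (σ.var .s) σ' cs) ∧
      σ'.time ≤ σ.time + (21 * d + 20) * σ'.var .tl) σ := by
  have hNd := hG.mul_d_lt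
  have hdZ := hG.d_lt_Z
  simp only [search, Cmd.block, wp_seq]
  refine wp_call (wp_searchInit hG hr hs hphi) fun σ₁ hf₁ ⟨h₁, _, _⟩ => ?_
  refine wp_loop (fun τ => (∃ T cs, Search d N S κ G (σ.var .r) (σ.var .s) τ T cs) ∧
    τ.time ≤ σ.time + 7 + 21 * τ.var .p) (fun τ => N * d - τ.var .p) ⟨⟨_, _, h₁⟩, by omega⟩
    fun τ hf ⟨⟨T, cs, h⟩, _⟩ => ?_
  have htl : τ.var .tl * d ≤ N * d := Nat.mul_le_mul_right _ (h.length_le hG hr)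
  have hlt {i : ℕ} (hi : i < τ.var .tl) : τ.arr .qu i < N := h.mem_lt hG hr (h.queue.mapsTo hi)
  refine ⟨trivial, by simp; omega, fun hp => ?_, fun hp => ?_⟩
  · replace hp : τ.var .p < τ.var .tl * d := hp
    refine wp_mono _ (fun τ' ⟨hτ', hp', ht'⟩ => ⟨⟨hτ', ?_⟩, ?_⟩) _
      (wp_searchStep hG ((hσ.of_frame hf₁).of_frame hf).congr hr hs h.tick hp)
    all_goals simp only [Store.var_tick, Store.time_tick] at hp' ht'; omega
  · replace hp : τ.var .tl * d ≤ τ.var .p := not_lt.1 hp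
    refine wp_call (wp_clearImages (σ := τ.tick) (N := N)
      ((h.length_le hG hr).trans_lt (by omega)) (fun i hi => (hlt hi).trans (by omega))
      fun x hx hne => h.queue.surjOn ((h.mem_iff hx).1 hne)) fun σ' hf' ⟨hphi', ht'⟩ =>
        ⟨hphi', ⟨cs, (h.searched hG hr hp).of_frame hf'.of_tick⟩, ?_⟩
    have htl' : σ'.var .tl = τ.var .tl := hf'.var .tl rfl
    have hpos : 0 < τ.var .tl := by
      obtain ⟨i, hi, -⟩ := h.queue.surjOn h.root_mem
      exact (Nat.zero_le i).trans_lt hi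
    have hp_le := h.edge_le
    have hring : (21 * d + 20) * τ.var .tl = 21 * (τ.var .tl * d) + 20 * τ.var .tl := by ring
    replace ht' : σ'.time ≤ τ.time + 1 + 3 * τ.var .tl + 2 := ht'
    rw [htl', hring]
    omega

end Search

section Words

/-- Append the path to `x` in the search tree, last code first, to the buffer. -/
def pushPath : Cmd Var Arr := .loop .ne (.idx .code (.var .x)) 0 (.block [
  .write .buf (.var .k) (.idx .code (.var .x)),
  .assign .k (.var .k + 1),
  .assign .x (.idx .top (.var .x))])

/-- Apply the word between the positions `lo` and `i` of the buffer to `z`. -/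
def applyWord : Cmd Var Arr := .loop .lt (.var .lo) (.var .i) (.block [
  .assign .i (.var .i - 1),
  .assign .z (.idx .tab (.idx .buf (.var .i) * .var .N + .var .z))])

/-- Apply the two words in the buffer, which are separated by position `mid`, to `y`. -/
def applyWords : Cmd Var Arr := .block [
  .assign .z (.var .y),
  .assign .lo 0,
  .assign .i (.var .mid),
  applyWord,
  .assign .zMid (.var .z),
  .assign .z (.var .y),
  .assign .lo (.var .mid),
  .assign .i (.var .k),
  applyWord]

/-- If the two words in the buffer agree on candidate number `q`, swap it with number `e`, the
first one on which they do not. -/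
def partitionStep : Cmd Var Arr := .block [
  .assign .y (.idx .cand (.var .o + .var .q)),
  applyWords,
  .ite .eq (.var .zMid) (.var .z)
    (.block [
      .write .cand (.var .o + .var .q) (.idx .cand (.var .o + .var .e)),
      .write .cand (.var .o + .var .e) (.var .y),
      .assign .e (.var .e + 1)])
    .skip,
  .assign .q (.var .q + 1)]

/-- Move the candidates on which the two words in the buffer agree to the front. -/
def partition : Cmd Var Arr := .block [
  .assign .q 0,
  .assign .e 0,
  .loop .lt (.var .q) (.var .c) partitionStep]

/-- The list is stored in the array from address `lo` on, in reverse order. -/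
def Stored (buf : ℕ → ℕ) (lo : ℕ) : List ℕ → Prop
  | [] => True
  | c :: cs => buf (lo + cs.length) = c ∧ Stored buf lo cs

/-- The buffer holds two words, given by their codes. -/
structure Words (S : ℕ) (cs₁ cs₂ : List ℕ) (σ : Store Var Arr) : Prop where
  fst : Stored (σ.arr .buf) 0 cs₁
  mid_eq : σ.var .mid = cs₁.length
  snd : Stored (σ.arr .buf) (σ.var .mid) cs₂
  k_eq : σ.var .k = σ.var .mid + cs₂.length
  fst_lt : ∀ c ∈ cs₁, c < S
  snd_lt : ∀ c ∈ cs₂, c < S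

/-- The words with the given codes agree at `y`. -/
abbrev Agree (d : ℕ) (G : ℕ → ℕ → ℕ) (cs₁ cs₂ : List ℕ) (y : ℕ) : Prop :=
  act G (flat d cs₁) y = act G (flat d cs₂) y

/-- The `c` entries of the array from address `o` on enumerate the set `U`. -/
def Lists (B : ℕ → ℕ) (o c : ℕ) (U : Finset ℕ) : Prop :=
  Set.BijOn (fun i => B (o + i)) (Set.Iio c) U

/-- Among the entries of the array from address `o` on, which enumerate `U`, the first `e` ones have
the property `p` and those after them, up to number `q`, do not have it. -/
structure Parted (p : ℕ → Prop) (B : ℕ → ℕ) (o c e q : ℕ) (U : Finset ℕ) : Prop where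
  lists : Lists B o c U
  le : e ≤ q
  pos : ∀ i < e, p (B (o + i))
  neg : ∀ i, e ≤ i → i < q → ¬ p (B (o + i))

variable {d N S Z κ r lo o c e q : ℕ} {G : ℕ → ℕ → ℕ} {σ σ' : Store Var Arr} {T U : Finset ℕ}
  {cs : ℕ → List ℕ} {L cs₁ cs₂ : List ℕ} {B B' buf buf' : ℕ → ℕ}

theorem Stored.congr (h : Stored buf lo L) (hbuf : ∀ q < lo + L.length, buf' q = buf q) :
    Stored buf' lo L := by
  induction L with
  | nil => trivial
  | cons c L ih =>
    rw [List.length_cons] at hbuf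
    exact ⟨(hbuf _ (by omega)).trans h.1, ih h.2 fun q hq => hbuf q (by omega)⟩

theorem Words.congr (h : Words S cs₁ cs₂ σ) (hmid : σ'.var .mid = σ.var .mid := by rfl)
    (hk : σ'.var .k = σ.var .k := by rfl) (hbuf : σ'.arr .buf = σ.arr .buf := by rfl) :
    Words S cs₁ cs₂ σ' := by
  obtain ⟨h₁, h₂, h₃, h₄, h₅, h₆⟩ := h
  refine ⟨?_, ?_, ?_, ?_, h₅, h₆⟩ <;> simpa only [hmid, hk, hbuf]

namespace Lists

theorem congr (h : Lists B o c U) (hB : ∀ i < c, B' (o + i) = B (o + i)) : Lists B' o c U :=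
  Set.BijOn.congr h fun i hi => (hB i hi).symm

theorem card_eq (h : Lists B o c U) : U.card = c := by
  rw [← Set.ncard_coe_finset, ← Set.BijOn.image_eq h, (Set.BijOn.injOn h).ncard_image,
    Set.ncard_eq_toFinset_card', Set.toFinset_Iio, Nat.card_Iio]

theorem mem (h : Lists B o c U) {i : ℕ} (hi : i < c) : B (o + i) ∈ U := Set.BijOn.mapsTo h hi

theorem swap (h : Lists B o c U) {i j : ℕ} (hi : i < c) (hj : j < c) :
    Lists (Function.update (Function.update B (o + i) (B (o + j))) (o + j) (B (o + i))) o c U := by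
  have hswap : Set.BijOn (Equiv.swap i j) (Set.Iio c) (Set.Iio c) := by
    refine ⟨fun a ha => ?_, (Equiv.injective _).injOn, fun a ha => ⟨Equiv.swap i j a, ?_, by simp⟩⟩
    all_goals
      rw [Set.mem_Iio, Equiv.swap_apply_def] at *
      split_ifs <;> assumption
  refine (Set.BijOn.comp h hswap).congr fun a _ => ?_
  simp only [Function.comp_apply, Function.update_apply, Equiv.swap_apply_def]
  split_ifs <;> grind

theorem filter (h : Lists B o c U) (p : ℕ → Prop) [DecidablePred p] {e o' : ℕ}
    (hp : ∀ i < c, p (B (o + i)) ↔ o' ≤ i ∧ i < o' + e) (he : o' + e ≤ c) :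
    Lists B (o + o') e (U.filter p) := by
  refine ⟨fun i hi => ?_, fun i hi i' hi' heq => ?_, fun x hx => ?_⟩
  · rw [Set.mem_Iio] at hi
    simp only [Nat.add_assoc]
    exact Finset.mem_coe.2 (Finset.mem_filter.2
      ⟨h.mem (by omega), (hp _ (by omega)).2 (by omega)⟩)
  · rw [Set.mem_Iio] at hi hi'
    simp only [Nat.add_assoc] at heq
    exact Nat.add_left_cancel (Set.BijOn.injOn h (by simp; omega) (by simp; omega) heq)
  · obtain ⟨hxU, hpx⟩ := Finset.mem_filter.1 (Finset.mem_coe.1 hx)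
    obtain ⟨i, hi, rfl⟩ := Set.BijOn.surjOn h hxU
    have hio := (hp i hi).1 hpx
    exact ⟨i - o', by simp; omega, by simp only [Nat.add_assoc, Nat.add_sub_cancel' hio.1]⟩

end Lists

namespace Parted

variable {p : ℕ → Prop}

theorem zero (h : Lists B o c U) : Parted p B o c 0 0 U := ⟨h, le_rfl, by simp, by simp⟩

theorem step_pos (h : Parted p B o c e q U) (hq : q < c) (hp : p (B (o + q))) :
    Parted p (Function.update (Function.update B (o + q) (B (o + e))) (o + e) (B (o + q))) o c
      (e + 1) (q + 1) U where
  lists := h.lists.swap hq (h.le.trans_lt hq)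
  le := Nat.succ_le_succ h.le
  pos i hi := by
    rcases Nat.lt_succ_iff_lt_or_eq.1 hi with hi | rfl
    · rw [Function.update_of_ne (by omega), Function.update_of_ne (by have := h.le; omega)]
      exact h.pos i hi
    · rwa [Function.update_self]
  neg i hle hi := by
    rw [Function.update_of_ne (by omega)]
    rcases Nat.lt_succ_iff_lt_or_eq.1 hi with hi | rfl
    · rw [Function.update_of_ne (by omega)]
      exact h.neg i (by omega) hi
    · rw [Function.update_self]
      exact h.neg e le_rfl hle

theorem step_neg (h : Parted p B o c e q U) (hp : ¬ p (B (o + q))) :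
    Parted p B o c e (q + 1) U where
  lists := h.lists
  le := h.le.trans (Nat.le_succ q)
  pos := h.pos
  neg i hle hi := by
    rcases Nat.lt_succ_iff_lt_or_eq.1 hi with hi | rfl
    exacts [h.neg i hle hi, hp]

theorem congr (h : Parted p B o c e c U) (hB : ∀ i < c, B' (o + i) = B (o + i)) :
    Parted p B' o c e c U where
  lists := h.lists.congr hB
  le := h.le
  pos i hi := by
    rw [hB i (hi.trans_le h.le)]
    exact h.pos i hi
  neg i hle hi := by
    rw [hB i hi]
    exact h.neg i hle hi

theorem filter [DecidablePred p] (h : Parted p B o c e c U) :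
    Lists B o e (U.filter p) ∧ Lists B (o + e) (c - e) (U.filter (¬ p ·)) := by
  have hp (i : ℕ) (hi : i < c) : p (B (o + i)) ↔ i < e :=
    ⟨fun hp => not_le.1 fun hle => h.neg i hle hi hp, h.pos i⟩
  have hle := h.le
  exact ⟨h.lists.filter p (o' := 0) (fun i hi => by rw [hp i hi]; omega) (by omega),
    h.lists.filter (¬ p ·) (fun i hi => by rw [hp i hi]; omega) (by omega)⟩

end Parted

theorem wp_pushPath (h : SearchTree d S κ G r T (σ.arr .top) (σ.arr .code) cs)
    (hT : ∀ x ∈ T, x < Z) (hx : σ.var .x ∈ T) (hL : Stored (σ.arr .buf) lo L)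
    (hk : σ.var .k = lo + L.length) (hZ : σ.var .k + (cs (σ.var .x)).length < Z) :
    wp Z pushPath (fun σ' => Stored (σ'.arr .buf) lo (cs (σ.var .x) ++ L) ∧
      σ'.var .k = lo + (cs (σ.var .x) ++ L).length ∧
      (∀ q < σ.var .k, σ'.arr .buf q = σ.arr .buf q) ∧
      σ'.time ≤ σ.time + 4 * (cs (σ.var .x)).length + 1) σ := by
  refine wp_loop (fun τ => τ.var .x ∈ T ∧ (∀ q < σ.var .k, τ.arr .buf q = σ.arr .buf q) ∧
    τ.time + 4 * (cs (τ.var .x)).length ≤ σ.time + 4 * (cs (σ.var .x)).length ∧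
    σ.var .k ≤ τ.var .k ∧ ∃ L', cs (σ.var .x) ++ L = cs (τ.var .x) ++ L' ∧
      Stored (τ.arr .buf) lo L' ∧ τ.var .k = lo + L'.length) (fun τ => (cs (τ.var .x)).length)
    ⟨hx, fun _ _ => rfl, le_rfl, le_rfl, L, rfl, hL, hk⟩
    fun τ hf ⟨hxT, hbuf, _, _, L', heq, hL', hk'⟩ => ?_
  have htop : τ.arr .top = σ.arr .top := hf.arr .top rfl
  have hcode : τ.arr .code = σ.arr .code := hf.arr .code rfl
  have hxZ := hT _ hxT
  have hlen := congrArg List.length heq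
  simp only [List.length_append] at hlen
  refine ⟨⟨trivial, hxZ⟩, Exp.good_zero Z τ |>.2 (by omega), fun hne => ?_, fun hzero => ?_⟩
  · replace hne : σ.arr .code (τ.var .x) ≠ 0 := hcode ▸ hne
    have hcs := h.eq_append hxT hne
    have hlen' := congrArg List.length hcs
    simp only [List.length_append, List.length_singleton] at hlen'
    simp only [Cmd.block, wp_seq, wp_write, Exp.good_var, Exp.good_idx, Exp.val_var, Store.var_tick,
      true_and, Exp.val_idx, Store.arr_tick, hcode, wp_assign, Exp.good_add, Exp.good_ofNat,
      Store.var_write, Exp.val_ofNat, Exp.val_add, Store.var_assign, reduceCtorEq, ↓reduceIte,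
      Store.arr_assign, Store.arr_write, htop, Store.time_assign, Store.time_write, Store.time_tick]
    refine ⟨hxZ, by omega, ⟨by omega, by omega⟩, hxZ, ⟨h.top_mem _ hxT, fun q hq => ?_, by omega,
      by omega, σ.arr .code (τ.var .x) :: L', ?_, ⟨?_, hL'.congr fun q hq => ?_⟩, ?_⟩, by omega⟩
    · rw [Function.update_of_ne (by omega), hbuf q hq]
    · rw [heq, hcs, List.append_assoc, List.singleton_append]
    · rw [hk', Function.update_self]
    · exact Function.update_of_ne (by omega) ..
    · rw [List.length_cons]
      omega
  · replace hzero : σ.arr .code (τ.var .x) = 0 := hcode ▸ not_not.1 hzero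
    rw [h.eq_nil hxT hzero, List.nil_append] at heq
    rw [heq]
    exact ⟨hL', hk', hbuf, by simp only [Store.time_tick]; omega⟩

theorem wp_applyWord (hG : Setting d N S Z κ G) (hσ : Tables d N S G σ)
    (hL : Stored (σ.arr .buf) (σ.var .lo) L) (hS : ∀ c ∈ L, c < S)
    (hi : σ.var .i = σ.var .lo + L.length) (hz : σ.var .z < N) (hZ : σ.var .i < Z) :
    wp Z applyWord (fun σ' => σ'.var .z = act G (flat d L) (σ.var .z) ∧
      σ'.time ≤ σ.time + 3 * L.length + 1) σ := by
  refine wp_loop (fun τ => τ.var .z < N ∧ ∃ L', Stored (σ.arr .buf) (σ.var .lo) L' ∧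
      (∀ c ∈ L', c < S) ∧ τ.var .i = σ.var .lo + L'.length ∧ L'.length ≤ L.length ∧
      act G (flat d L') (τ.var .z) = act G (flat d L) (σ.var .z) ∧
      τ.time + 3 * L'.length ≤ σ.time + 3 * L.length) (fun τ => τ.var .i)
    ⟨hz, L, hL, hS, hi, le_rfl, rfl, le_rfl⟩
    fun τ hf ⟨hz', L', hL', hS', hi', hlen, hact, ht⟩ => ?_
  have hlo : τ.var .lo = σ.var .lo := hf.var .lo rfl
  have hbuf : τ.arr .buf = σ.arr .buf := hf.arr .buf rfl
  refine ⟨trivial, trivial, fun hlt => ?_, fun hge => ?_⟩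
  · replace hlt : τ.var .lo < τ.var .i := hlt
    rcases L' with - | ⟨c, L'⟩
    · simp only [List.length_nil] at hi'
      omega
    obtain ⟨hc, hL'⟩ := hL'
    simp only [List.forall_mem_cons, List.length_cons] at hS' hlen hi' ht
    have htab := hG.tab_lt hS'.1 hz'
    have hval := (hσ.of_frame hf).tab c hS'.1 _ hz'
    have hpred : σ.var .lo + (L'.length + 1) - 1 = σ.var .lo + L'.length := by omega
    simp only [Cmd.block, hi', wp_seq, wp_assign, Exp.good_sub, Exp.good_var, Exp.good_ofNat,
      true_and, Exp.val_sub, Exp.val_var, Store.var_tick, Exp.val_ofNat, hpred, Exp.good_idx,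
      Exp.good_add, Exp.good_mul, Store.var_assign, ↓reduceIte, Exp.val_idx, Store.arr_assign,
      Store.arr_tick, hbuf, hc, reduceCtorEq, (hσ.of_frame hf).N_eq, Exp.val_mul, Exp.val_add,
      and_self_right, hval, Nat.add_left_cancel_iff, Store.time_assign, Store.time_tick,
      add_lt_add_iff_left, lt_add_iff_pos_right, Order.lt_one_iff, and_true]
    exact ⟨by omega, ⟨⟨by omega, by omega⟩, by omega⟩, hG.act_lt _ hz', L', hL', hS'.2, rfl,
      by omega, by rw [← hact, ← act_append]; rfl, by omega⟩
  · replace hge : ¬ τ.var .lo < τ.var .i := hge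
    obtain rfl : L' = [] := List.length_eq_zero_iff.1 (by omega)
    exact ⟨hact, by simp only [Store.time_tick, List.length_nil] at ht ⊢; omega⟩

theorem wp_applyWords (hG : Setting d N S Z κ G) (hσ : Tables d N S G σ)
    (hw : Words S cs₁ cs₂ σ) (hy : σ.var .y < N) (hZ : σ.var .k < Z) :
    wp Z applyWords (fun σ' => σ'.var .zMid = act G (flat d cs₁) (σ.var .y) ∧
      σ'.var .z = act G (flat d cs₂) (σ.var .y) ∧
      σ'.time ≤ σ.time + 3 * (cs₁.length + cs₂.length) + 9) σ := by
  have hk := hw.k_eq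
  simp only [applyWords, Cmd.block, wp_seq, wp_assign, Exp.good_var, Exp.good_zero, Exp.val_var,
    Exp.val_zero, true_and]
  refine ⟨by omega, wp_call (wp_applyWord hG hσ.congr (L := cs₁) hw.fst hw.fst_lt
    (by simp [hw.mid_eq]) hy (by simp; omega)) fun τ hf ⟨hz, ht⟩ => ?_⟩
  have hy' : τ.var .y = σ.var .y := hf.var .y rfl
  have hmid : τ.var .mid = σ.var .mid := hf.var .mid rfl
  have hk' : τ.var .k = σ.var .k := hf.var .k rfl
  have hbuf : τ.arr .buf = σ.arr .buf := hf.arr .buf rfl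
  refine ⟨trivial, trivial, trivial, trivial, wp_call (wp_applyWord hG
    (hσ.congr.of_frame hf).congr (L := cs₂) ?_ hw.snd_lt ?_ ?_ ?_) fun τ' hf' ⟨hz', ht'⟩ => ?_⟩
  · simpa [hbuf, hmid] using hw.snd
  · simpa [hmid, hk'] using hk
  · simpa [hy'] using hy
  · simpa [hk'] using hZ
  · have hzMid : τ'.var .zMid = τ.var .z := hf'.var .zMid rfl
    simp only [Store.var_assign, reduceCtorEq, ↓reduceIte, Store.time_assign,
      Exp.val_var] at hz ht hz' ht'
    exact ⟨hzMid.trans hz, by rw [hz', hy'], by omega⟩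

theorem wp_partitionStep (hG : Setting d N S Z κ G) (hσ : Tables d N S G σ)
    (hw : Words S cs₁ cs₂ σ) (hk : σ.var .k < Z) (hN : ∀ x ∈ U, x < N)
    (hc : σ.var .q < c) (ho : σ.var .o + c + 1 < Z)
    (hp : Parted (Agree d G cs₁ cs₂) (σ.arr .cand) (σ.var .o) c (σ.var .e) (σ.var .q) U) :
    wp Z partitionStep (fun σ' =>
      Parted (Agree d G cs₁ cs₂) (σ'.arr .cand) (σ.var .o) c (σ'.var .e) (σ.var .q + 1) U ∧
      (∀ i, i < σ.var .o ∨ σ.var .o + c ≤ i → σ'.arr .cand i = σ.arr .cand i) ∧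
      σ'.var .q = σ.var .q + 1 ∧
      σ'.time ≤ σ.time + (3 * (cs₁.length + cs₂.length) + 19)) σ := by
  have hle := hp.le
  simp only [partitionStep, Cmd.block, wp_seq, wp_assign]
  refine ⟨by simp; omega, wp_call (wp_applyWords hG hσ.congr (hw.congr rfl rfl rfl) ?_ ?_)
    fun σ' hf ⟨hzMid, hz, ht⟩ => ?_⟩
  · simpa using hN _ (hp.lists.mem hc)
  · simpa using hk
  have hq : σ'.var .q = σ.var .q := hf.var .q rfl
  have he : σ'.var .e = σ.var .e := hf.var .e rfl
  have ho' : σ'.var .o = σ.var .o := hf.var .o rfl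
  have hy : σ'.var .y = σ.arr .cand (σ.var .o + σ.var .q) := by simpa using hf.var .y rfl
  have hcand : σ'.arr .cand = σ.arr .cand := hf.arr .cand rfl
  replace ht : σ'.time ≤ σ.time + 1 + 3 * (cs₁.length + cs₂.length) + 9 := ht
  simp only [Exp.val_idx, Exp.val_add, Exp.val_var, Store.var_assign, ↓reduceIte] at hzMid hz
  simp only [wp_seq, wp_ite, Exp.good_var, Exp.val_var, hzMid, hz, Rel.holds_eq, wp_write,
    Exp.good_add, Store.var_tick, ho', hq, true_and, Exp.good_idx, he, Exp.val_add, and_self,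
    Exp.val_idx, Store.arr_tick, hcand, Store.var_write, hy, wp_assign, Exp.good_ofNat,
    Exp.val_ofNat, Store.var_assign, reduceCtorEq, ↓reduceIte, Store.arr_assign, Store.arr_write,
    Store.time_assign, Store.time_write, Store.time_tick, Order.add_one_le_iff, and_self_left,
    wp_skip, implies_true]
  refine ⟨fun hagree => ⟨by omega, by omega, by omega, by omega, ⟨by omega, by omega⟩,
    ⟨by omega, by omega⟩, hp.step_pos hc hagree, fun i hi => ?_, by omega⟩,
    fun hagree => ⟨⟨by omega, by omega⟩, hp.step_neg hagree, by omega⟩⟩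
  rw [Function.update_of_ne (by omega), Function.update_of_ne (by omega)]

theorem wp_partition (hG : Setting d N S Z κ G) (hσ : Tables d N S G σ)
    (hw : Words S cs₁ cs₂ σ) (hk : σ.var .k < Z)
    (hU : Lists (σ.arr .cand) (σ.var .o) (σ.var .c) U) (hN : ∀ x ∈ U, x < N)
    (ho : σ.var .o + σ.var .c + 1 < Z) :
    wp Z partition (fun σ' =>
      Parted (Agree d G cs₁ cs₂) (σ'.arr .cand) (σ.var .o) (σ.var .c) (σ'.var .e) (σ.var .c) U ∧
      (∀ i, i < σ.var .o ∨ σ.var .o + σ.var .c ≤ i → σ'.arr .cand i = σ.arr .cand i) ∧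
      σ'.time ≤ σ.time + σ.var .c * (3 * (cs₁.length + cs₂.length) + 20) + 3) σ := by
  simp only [partition, Cmd.block, wp_seq, wp_assign, Exp.good_zero, Exp.val_zero]
  refine ⟨by omega, by omega, wp_loop (fun τ => τ.var .q ≤ σ.var .c ∧
      Parted (Agree d G cs₁ cs₂) (τ.arr .cand) (σ.var .o) (σ.var .c) (τ.var .e) (τ.var .q) U ∧
      (∀ i, i < σ.var .o ∨ σ.var .o + σ.var .c ≤ i → τ.arr .cand i = σ.arr .cand i) ∧
      τ.time ≤ σ.time + τ.var .q * (3 * (cs₁.length + cs₂.length) + 20) + 2)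
    (fun τ => σ.var .c - τ.var .q)
    ⟨Nat.zero_le _, .zero hU, fun _ _ => rfl, by simp⟩ fun τ hf ⟨_, hp, hout, ht⟩ => ?_⟩
  have hoτ : τ.var .o = σ.var .o := hf.var .o rfl
  have hcτ : τ.var .c = σ.var .c := hf.var .c rfl
  refine ⟨trivial, trivial, fun hlt => ?_, fun hge => ?_⟩
  · replace hlt : τ.var .q < σ.var .c := hcτ ▸ hlt
    have hkτ : τ.var .k = σ.var .k := hf.var .k rfl
    refine wp_mono _ ?_ _
      (wp_partitionStep hG (hσ.congr.of_frame hf).congr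
        (hw.congr (hf.var .mid rfl) hkτ (hf.arr .buf rfl)) (by simpa [hkτ] using hk) hN
        (by simpa using hlt) (by simpa [hoτ] using ho) (by simpa [hoτ] using hp))
    rintro τ' ⟨hp', hout', hq', ht'⟩
    simp only [Store.var_tick, Store.arr_tick, Store.time_tick, hoτ] at hp' hout' hq' ht'
    have hmul := Nat.succ_mul (τ.var .q) (3 * (cs₁.length + cs₂.length) + 20)
    rw [hq']
    exact ⟨⟨hlt, hp', fun i hi => (hout' i hi).trans (hout i hi), by
      rw [Nat.succ_eq_add_one] at hmul; omega⟩, by omega⟩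
  · obtain hq : τ.var .q = σ.var .c := by
      replace hge : ¬ τ.var .q < σ.var .c := hcτ ▸ hge
      omega
    rw [hq] at hp ht
    exact ⟨hp, hout, by simp only [Store.time_tick]; omega⟩

end Words

section Matched

variable {ι α : Type*} {G : ι → α → α} {X UA UB : Finset α} {r s x y : α}

/-- Every isomorphism from the component of `r` to that of `s` maps the set `UA` onto `UB`. -/
structure Matched (G : ι → α → α) (X : Finset α) (r s : α) (UA UB : Finset α) : Prop where
  subset_left : UA ⊆ orb G X r
  subset_right : UB ⊆ orb G X s
  mem_iff : ∀ x ∈ orb G X r, ∀ y ∈ orb G X s, SameRel G x y → (x ∈ UA ↔ y ∈ UB)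

namespace Matched

theorem whole : Matched G X r s (orb G X r) (orb G X s) :=
  ⟨subset_rfl, subset_rfl, fun _ hx _ hy _ => iff_of_true hx hy⟩

theorem filter (h : Matched G X r s UA UB) (p : α → Prop) [DecidablePred p]
    (hp : ∀ x y, SameRel G x y → (p x ↔ p y)) :
    Matched G X r s (UA.filter p) (UB.filter p) where
  subset_left := (Finset.filter_subset _ _).trans h.subset_left
  subset_right := (Finset.filter_subset _ _).trans h.subset_right
  mem_iff x hx y hy hxy := by
    rw [Finset.mem_filter, Finset.mem_filter, h.mem_iff x hx y hy hxy, hp x y hxy]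

theorem card_eq (h : Matched G X r s UA UB) (hX : ActsOn G X) (hr : r ∈ X) (hs : s ∈ X)
    (hrs : SameType G r s) : UA.card = UB.card := by
  obtain ⟨l, hl⟩ := hrs
  obtain ⟨f, hf⟩ := hX.exists_isoOn_orb hX hr (hX.act_mem hs l) hl
  rw [hX.orb_eq hs (Reach.act s l)] at hf
  have hmem (x : α) (hx : x ∈ orb G X r) : x ∈ UA ↔ f x ∈ UB :=
    h.mem_iff x hx _ (hf.bijOn.mapsTo hx) (hf.sameRel (hX.restrict_orb hr) hx)
  refine Finset.card_nbij f (fun x hx => (hmem x (h.subset_left hx)).1 hx)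
    (hf.bijOn.injOn.mono (Finset.coe_subset.2 h.subset_left)) fun y hy => ?_
  obtain ⟨x, hx, rfl⟩ := hf.bijOn.surjOn (h.subset_right hy)
  exact ⟨x, (hmem x hx).2 hy, rfl⟩

theorem sameType_iff (h : Matched G X r s UA UB) (hX : ActsOn G X) (hr : r ∈ X) (hs : s ∈ X)
    (hx : x ∈ UA) (hy : y ∈ UB) : SameType G x y ↔ SameType G r s := by
  replace hx := (hX.mem_orb hr).1 (h.subset_left hx)
  replace hy := (hX.mem_orb hs).1 (h.subset_right hy)
  rw [hX.sameType_congr_right hs hy]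
  exact ⟨(hX.sameType_of_reach hr hx).trans,
    (hX.sameType_of_reach (hX.reach_mem hr hx) (hX.reach_symm hr hx)).trans⟩

end Matched

end Matched

section Pair

/-- Append the queue to the candidates, from address `o` on. -/
def copyQueue : Cmd Var Arr := .block [
  .assign .i 0,
  .loop .lt (.var .i) (.var .tl) (.block [
    .write .cand (.var .o + .var .i) (.idx .qu (.var .i)),
    .assign .i (.var .i + 1)])]

/-- Write into the buffer the two words for the two ways to reach the target of the conflicting
edge. -/
def conflictWords : Cmd Var Arr := .block [
  .write .buf 0 (.var .cj),
  .assign .k 1,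
  .assign .x (.var .cx),
  pushPath,
  .assign .mid (.var .k),
  .assign .x (.var .cv),
  pushPath]

/-- Partition both lists of candidates. -/
def partitionBoth : Cmd Var Arr := .block [
  .assign .o (.var .oA),
  partition,
  .assign .eA (.var .e),
  .assign .o (.var .oB),
  partition]

/-- Keep the smaller half of the candidates, if the halves have matching sizes. -/
def keepHalf : Cmd Var Arr :=
  .ite .ne (.var .eA) (.var .e) (.assign .res 0)
    (.ite .le (.var .e + .var .e) (.var .c) (.assign .c (.var .e)) (.block [
      .assign .oA (.var .oA + .var .e),
      .assign .oB (.var .oB + .var .e),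
      .assign .c (.var .c - .var .e)]))

/-- Compare the first candidates of the two lists. -/
def pairStep (d : ℕ) : Cmd Var Arr := .block [
  .assign .r (.idx .cand (.var .oA)),
  .assign .s (.idx .cand (.var .oB)),
  search d,
  .ite .eq (.var .ok) 1 (.assign .res 1) (.block [conflictWords, partitionBoth, keepHalf])]

/-- List the vertices of the components of `rA` and `rB` as candidates. -/
def pairInit (d : ℕ) : Cmd Var Arr := .block [
  .assign .r (.var .rA),
  .assign .s (.var .rA),
  search d,
  .assign .o 0,
  copyQueue,
  .assign .r (.var .rB),
  .assign .s (.var .rB),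
  search d,
  .assign .o (.var .N),
  copyQueue,
  .assign .c (.var .tl),
  .assign .oA 0,
  .assign .oB (.var .N)]

/-- Decide whether the components of `rA` and `rB`, which have the same size, are isomorphic. -/
def pair (d : ℕ) : Cmd Var Arr := .block [
  pairInit d,
  .assign .res 2,
  .loop .eq (.var .res) 2 (pairStep d)]

/-- The candidates for a pair of corresponding points in the components of `r` and `s`, listed in
the array from the addresses `oA` and `oB` on. -/
structure Candidates (N : ℕ) (G : ℕ → ℕ → ℕ) (r s : ℕ) (B : ℕ → ℕ) (oA oB c : ℕ)
    (UA UB : Finset ℕ) : Prop where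
  left : Lists B oA c UA
  right : Lists B oB c UB
  matched : Matched G (Finset.range N) r s UA UB
  pos : 0 < c
  left_le : oA + c ≤ N
  le_right : N ≤ oB
  right_le : oB + c ≤ 2 * N

/-- The answer `res` to the question whether the components of `r` and `s` are isomorphic is
correct. -/
def Verdict (G : ℕ → ℕ → ℕ) (r s res : ℕ) : Prop :=
  res = 1 ∧ SameType G r s ∨ res = 0 ∧ ¬ SameType G r s

/-- Either the question is decided, or there remain at most `c` candidates. -/
def Narrowed (N : ℕ) (G : ℕ → ℕ → ℕ) (r s c : ℕ) (σ : Store Var Arr) : Prop :=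
  Verdict G r s (σ.var .res) ∨ σ.var .res = 2 ∧ σ.var .c ≤ c ∧
    ∃ UA UB, Candidates N G r s (σ.arr .cand) (σ.var .oA) (σ.var .oB) (σ.var .c) UA UB

variable {d N S Z κ r s oA oB c e m : ℕ} {G : ℕ → ℕ → ℕ} {σ σ' : Store Var Arr}
  {UA UB : Finset ℕ} {cs : ℕ → List ℕ} {cs₁ cs₂ : List ℕ} {B : ℕ → ℕ}

theorem Verdict.ne_two {res : ℕ} : Verdict G r s res → res ≠ 2 := by
  rintro (⟨rfl, -⟩ | ⟨rfl, -⟩) <;> decide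

namespace Candidates

variable {p : ℕ → Prop} [DecidablePred p]

theorem head (h : Candidates N G r s B oA oB c UA UB) (hp : ∀ x y, SameRel G x y → (p x ↔ p y))
    (hA : Parted p B oA c e c UA) (hB : Parted p B oB c e c UB) (he : 0 < e) :
    Candidates N G r s B oA oB e (UA.filter p) (UB.filter p) := by
  have hle := hA.le
  obtain ⟨-, -, hm, -, h₁, h₂, h₃⟩ := h
  exact ⟨hA.filter.1, hB.filter.1, hm.filter p hp, he, by omega, h₂, by omega⟩

theorem tail (h : Candidates N G r s B oA oB c UA UB) (hp : ∀ x y, SameRel G x y → (p x ↔ p y))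
    (hA : Parted p B oA c e c UA) (hB : Parted p B oB c e c UB) (he : e < c) :
    Candidates N G r s B (oA + e) (oB + e) (c - e) (UA.filter (¬ p ·)) (UB.filter (¬ p ·)) := by
  obtain ⟨-, -, hm, -, h₁, h₂, h₃⟩ := h
  exact ⟨hA.filter.2, hB.filter.2, hm.filter _ fun x y hxy => not_congr (hp x y hxy), by omega,
    by omega, by omega, by omega⟩

end Candidates

theorem wp_copyQueue (hZ : σ.var .o + σ.var .tl + 1 < Z) :
    wp Z copyQueue (fun σ' =>
      (∀ i < σ.var .tl, σ'.arr .cand (σ.var .o + i) = σ.arr .qu i) ∧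
      (∀ i, i < σ.var .o ∨ σ.var .o + σ.var .tl ≤ i → σ'.arr .cand i = σ.arr .cand i) ∧
      σ'.time ≤ σ.time + 3 * σ.var .tl + 2) σ := by
  simp only [copyQueue, Cmd.block, wp_seq, wp_assign, Exp.good_zero, Exp.val_zero]
  refine ⟨by omega, wp_loop (fun τ => τ.var .i ≤ σ.var .tl ∧
      (∀ i < τ.var .i, τ.arr .cand (σ.var .o + i) = σ.arr .qu i) ∧
      (∀ i, i < σ.var .o ∨ σ.var .o + σ.var .tl ≤ i → τ.arr .cand i = σ.arr .cand i) ∧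
      τ.time ≤ σ.time + 3 * τ.var .i + 1) (fun τ => σ.var .tl - τ.var .i)
    ⟨Nat.zero_le _, by simp, fun _ _ => rfl, by simp⟩ fun τ hf ⟨_, hcopy, hout, ht⟩ => ?_⟩
  have ho : τ.var .o = σ.var .o := hf.var .o rfl
  have htl : τ.var .tl = σ.var .tl := hf.var .tl rfl
  have hqu : τ.arr .qu = σ.arr .qu := hf.arr .qu rfl
  refine ⟨trivial, trivial, fun hlt => ?_, fun hge => ?_⟩
  · replace hlt : τ.var .i < σ.var .tl := htl ▸ hlt
    simp only [wp_seq, wp_write, Exp.good_add, Exp.good_var, Exp.val_var, Store.var_tick, ho,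
      true_and, Exp.good_idx, Exp.val_add, Exp.val_idx, Store.arr_tick, hqu, wp_assign,
      Exp.good_ofNat, Store.var_write, Exp.val_ofNat, Store.var_assign, ↓reduceIte,
      Order.add_one_le_iff, Order.lt_add_one_iff, Store.arr_assign, Store.arr_write,
      Store.time_assign, Store.time_write, Store.time_tick, add_le_add_iff_right]
    refine ⟨by omega, by omega, by omega, ⟨by omega, by omega⟩, ⟨hlt, fun i hi' => ?_,
      fun i hi' => ?_, by omega⟩, by omega⟩
    · rcases hi'.lt_or_eq with hi' | rfl
      · rw [Function.update_of_ne (by omega), hcopy i hi']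
      · rw [Function.update_self]
    · rw [Function.update_of_ne (by omega), hout i hi']
  · replace hge : ¬ τ.var .i < σ.var .tl := htl ▸ hge
    obtain hi : τ.var .i = σ.var .tl := by omega
    rw [hi] at hcopy ht
    exact ⟨hcopy, hout, by simp only [Store.time_tick]; omega⟩

theorem Packed.length_le (h : Packed d S κ cs₁) (hκ : 0 < κ) (hm : (flat d cs₁).length < m) :
    cs₁.length ≤ m / κ + 1 := by
  have hle : (cs₁.length - 1) * κ ≤ m := by
    have := h.length_mul_le
    rw [Nat.sub_one_mul]
    omega
  have := (Nat.le_div_iff_mul_le hκ).2 hle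
  omega

theorem Conflict.agree {T : Finset ℕ} {top code : ℕ → ℕ} {x j y : ℕ} (h : Conflict d G s T cs x j y)
    (hT : SearchTree d S κ G r T top code cs) : Agree d G (cs x ++ [j]) (cs y) r := by
  rw [Agree, flat_append, flat_singleton, word_letter h.pos h.le, act_append,
    hT.act_eq x h.source_mem, hT.act_eq y h.target_mem]
  exact h.apply_eq

theorem Conflict.not_agree {T : Finset ℕ} {x j y : ℕ} (h : Conflict d G s T cs x j y) :
    ¬ Agree d G (cs x ++ [j]) (cs y) s := by
  rw [Agree, flat_append, flat_singleton, word_letter h.pos h.le, act_append]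
  exact h.apply_ne

theorem wp_conflictWords (hG : Setting d N S Z κ G)
    (hcs : Searched d N S κ G r s σ cs) (hok : σ.var .ok ≠ 1)
    (hm : (orb G (Finset.range N) r).card = m) :
    wp Z conflictWords (fun σ' => σ'.var .k < Z ∧ ∃ cs₁ cs₂, Words S cs₁ cs₂ σ' ∧
      cs₁.length + cs₂.length ≤ 2 * (m / κ) + 3 ∧
      Agree d G cs₁ cs₂ r ∧ ¬ Agree d G cs₁ cs₂ s ∧ σ'.time ≤ σ.time + 8 * (m / κ) + 15) σ := by
  have hconf := hcs.conflict hok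
  have hNd := hG.mul_d_lt
  have hmN : m ≤ N := hm ▸ (card_orb_le.trans_eq (Finset.card_range N))
  have hmκ : m / κ ≤ m := Nat.div_le_self m κ
  have hlen {x : ℕ} (hx : x ∈ orb G (Finset.range N) r) : (cs x).length ≤ m / κ + 1 :=
    (hcs.tree.packed x hx).length_le hG.κ_pos (hm ▸ hcs.tree.length_lt x hx)
  have hT (x : ℕ) (hx : x ∈ orb G (Finset.range N) r) : x < Z := by
    have := Finset.mem_range.1 (orb_subset hx)
    omega
  have hx := hlen hconf.source_mem
  have hy := hlen hconf.target_mem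
  simp only [conflictWords, Cmd.block, wp_seq, wp_write, wp_assign]
  refine ⟨by simp; omega, trivial, by simp; omega, by simp; omega, trivial,
    wp_call (wp_pushPath (lo := 0) (L := [σ.var .cj]) (by exact hcs.tree) hT
      (by exact hconf.source_mem) ⟨by simp, trivial⟩ rfl (by simp; omega)) fun σ₁ hf₁ h₁ => ?_⟩
  obtain ⟨hst₁, hk₁, -, ht₁⟩ := h₁
  have hcv : σ₁.var .cv = σ.var .cv := hf₁.var .cv rfl
  have htop : σ₁.arr .top = σ.arr .top := hf₁.arr .top rfl
  have hcode : σ₁.arr .code = σ.arr .code := hf₁.arr .code rfl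
  simp only [Exp.val_ofNat, Exp.val_var, Store.var_assign, reduceCtorEq, ↓reduceIte,
    Store.var_write, List.length_append, List.length_cons, List.length_nil, zero_add,
    Store.time_assign, Store.time_write] at hst₁ hk₁ ht₁
  refine ⟨trivial, trivial, wp_call (wp_pushPath (lo := σ₁.var .k) (L := []) (cs := cs) (G := G)
    (by simpa [htop, hcode] using hcs.tree) hT (by simpa [hcv] using hconf.target_mem) trivial rfl
    (by simp [hcv]; omega)) fun σ' hf' ⟨hst', hk', hbuf', ht'⟩ => ?_⟩
  have hmid : σ'.var .mid = σ₁.var .k := hf'.var .mid rfl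
  simp only [Exp.val_var, Store.var_assign, reduceCtorEq, ↓reduceIte, hcv, List.append_nil,
    Store.arr_assign, Store.time_assign] at hst' hk' hbuf' ht'
  refine ⟨by omega, cs (σ.var .cx) ++ [σ.var .cj], cs (σ.var .cv), ⟨?_, ?_, ?_, ?_, ?_, ?_⟩, ?_, ?_,
    ?_, by omega⟩
  · exact hst₁.congr fun q hq => hbuf' q (by simp at hq; omega)
  · simp [hmid, hk₁]
  · rwa [hmid]
  · rw [hk', hmid]
  · have hcj : σ.var .cj < S := hconf.le.trans_lt hG.d_lt
    simpa [or_imp, forall_and, hcj] using (hcs.tree.packed _ hconf.source_mem).lt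
  · exact (hcs.tree.packed _ hconf.target_mem).lt
  · simp; omega
  · exact hconf.agree hcs.tree
  · exact hconf.not_agree

theorem wp_partitionBoth (hG : Setting d N S Z κ G) (hσ : Tables d N S G σ)
    (hw : Words S cs₁ cs₂ σ) (hk : σ.var .k < Z)
    (hc : Candidates N G r s (σ.arr .cand) (σ.var .oA) (σ.var .oB) (σ.var .c) UA UB) :
    wp Z partitionBoth (fun σ' =>
      Parted (Agree d G cs₁ cs₂) (σ'.arr .cand) (σ.var .oA) (σ.var .c) (σ'.var .eA) (σ.var .c) UA ∧
      Parted (Agree d G cs₁ cs₂) (σ'.arr .cand) (σ.var .oB) (σ.var .c) (σ'.var .e) (σ.var .c) UB ∧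
      σ'.time ≤ σ.time + 2 * (σ.var .c * (3 * (cs₁.length + cs₂.length) + 20)) + 9) σ := by
  obtain ⟨hA, hB, hm, -, h₁, h₂, h₃⟩ := hc
  have hNd := hG.mul_d_lt
  have hUA (x : ℕ) (hx : x ∈ UA) : x < N := Finset.mem_range.1 (orb_subset (hm.subset_left hx))
  have hUB (x : ℕ) (hx : x ∈ UB) : x < N := Finset.mem_range.1 (orb_subset (hm.subset_right hx))
  simp only [partitionBoth, Cmd.block, wp_seq, wp_assign]
  refine ⟨trivial, wp_call (wp_partition hG hσ.congr hw.congr hk hA hUA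
    (by simp; omega)) fun σ₁ hf₁ ⟨hp₁, hout₁, ht₁⟩ => ?_⟩
  have hc₁ : σ₁.var .c = σ.var .c := hf₁.var .c rfl
  have ho₁ : σ₁.var .oB = σ.var .oB := hf₁.var .oB rfl
  have hk₁ : σ₁.var .k = σ.var .k := hf₁.var .k rfl
  have hw₁ : Words S cs₁ cs₂ σ₁ := hw.congr (hf₁.var .mid rfl) hk₁ (hf₁.arr .buf rfl)
  simp only [Exp.val_var, Store.var_assign, ↓reduceIte, reduceCtorEq, Store.arr_assign,
    Store.time_assign] at hp₁ hout₁ ht₁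
  have hB₁ : Lists (σ₁.arr .cand) (σ₁.var .oB) (σ₁.var .c) UB := by
    rw [ho₁, hc₁]
    exact hB.congr fun i _ => hout₁ _ (by omega)
  refine ⟨trivial, trivial, wp_call (wp_partition (U := UB) hG (hσ.congr.of_frame hf₁).congr
    hw₁.congr (by simpa [hk₁] using hk) hB₁ hUB
    (by simp [hc₁, ho₁]; omega)) fun σ' hf' ⟨hp', hout', ht'⟩ => ?_⟩
  have heA : σ'.var .eA = σ₁.var .e := hf'.var .eA rfl
  simp only [Exp.val_var, Store.var_assign, reduceCtorEq, ↓reduceIte, ho₁, hc₁, Store.arr_assign,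
    Store.time_assign] at hp' hout' ht'
  exact ⟨by simpa [heA] using hp₁.congr fun i _ => hout' _ (by omega), hp', by omega⟩

theorem wp_keepHalf {p : ℕ → Prop} (hG : Setting d N S Z κ G) (hr : r < N)
    (hs : s < N) (hp : ∀ x y, SameRel G x y → (p x ↔ p y))
    (hc : Candidates N G r s (σ.arr .cand) (σ.var .oA) (σ.var .oB) (σ.var .c) UA UB)
    (hA : Parted p (σ.arr .cand) (σ.var .oA) (σ.var .c) (σ.var .eA) (σ.var .c) UA)
    (hB : Parted p (σ.arr .cand) (σ.var .oB) (σ.var .c) (σ.var .e) (σ.var .c) UB)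
    (hpos : ∃ x ∈ UA, p x) (hneg : ∃ y ∈ UB, ¬ p y) (hres : σ.var .res = 2) :
    wp Z keepHalf (fun σ' => Narrowed N G r s (σ.var .c / 2) σ' ∧ σ'.time ≤ σ.time + 5) σ := by
  classical
  have hNd := hG.mul_d_lt
  have hle := hc.left_le
  have hle' := hc.right_le
  have heA : (UA.filter p).card = σ.var .eA := hA.filter.1.card_eq
  have heB : (UB.filter p).card = σ.var .e := hB.filter.1.card_eq
  have heB' : (UB.filter (¬ p ·)).card = σ.var .c - σ.var .e := hB.filter.2.card_eq
  have heA0 : 0 < σ.var .eA := by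
    obtain ⟨x, hx, hpx⟩ := hpos
    exact heA ▸ Finset.card_pos.2 ⟨x, Finset.mem_filter.2 ⟨hx, hpx⟩⟩
  have hec : σ.var .e < σ.var .c := by
    obtain ⟨y, hy, hpy⟩ := hneg
    have : 0 < (UB.filter (¬ p ·)).card := Finset.card_pos.2 ⟨y, Finset.mem_filter.2 ⟨hy, hpy⟩⟩
    omega
  simp only [keepHalf, Cmd.block, Narrowed, Verdict, wp_ite, Exp.good_var, Exp.val_var,
    Rel.holds_ne, ne_eq, wp_assign, Exp.good_ofNat, Exp.val_ofNat, Store.var_assign, ↓reduceIte,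
    zero_ne_one, false_and, true_and, false_or, OfNat.zero_ne_ofNat, reduceCtorEq, Store.var_tick,
    Store.arr_assign, Store.arr_tick, or_false, Store.time_assign, Store.time_tick,
    add_le_add_iff_right, and_true, Decidable.not_not, Exp.good_add, Exp.val_add, Rel.holds_le,
    hres, OfNat.ofNat_ne_one, OfNat.ofNat_ne_zero, or_self, not_le, wp_seq, Exp.good_sub, and_self,
    Exp.val_sub, tsub_le_iff_right, Std.le_refl]
  refine ⟨fun hne => ⟨by omega, fun hrs => hne ?_, by omega⟩, fun heq =>
    ⟨by omega, fun hle => ?_, fun hlt => ?_⟩⟩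
  · exact heA.symm.trans (((hc.matched.filter p hp).card_eq hG.actsOn (Finset.mem_range.2 hr)
      (Finset.mem_range.2 hs) hrs).trans heB)
  · have hcand := hc.head hp (heq ▸ hA) hB (heq ▸ heA0)
    exact ⟨⟨by omega, _, _, hcand⟩, by omega⟩
  · have hcand := hc.tail hp (heq ▸ hA) hB hec
    exact ⟨by omega, by omega, by omega, _, _, hcand⟩

theorem Searched.lists (h : Searched d N S κ G r s σ cs) :
    Lists (σ.arr .qu) 0 (σ.var .tl) (orb G (Finset.range N) r) := by
  simpa only [Lists, Nat.zero_add] using h.queue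

theorem Searched.sameType (hG : Setting d N S Z κ G) (h : Searched d N S κ G r s σ cs)
    (hr : r < N) (hs : s < N) (hok : σ.var .ok = 1)
    (hcard : (orb G (Finset.range N) r).card = (orb G (Finset.range N) s).card) :
    SameType G r s :=
  (hG.actsOn.sameRel_of_hom (Finset.mem_range.2 hr) (Finset.mem_range.2 hs) (h.hom hok)
    hcard).sameType

/-- The time of one round on lists of `c` candidates from components of size `m`. -/
def stepTime (d κ m c : ℕ) : ℕ := (21 * d + 61) * m + c * (12 * (m / κ) + 58)

theorem wp_narrow (hG : Setting d N S Z κ G) (hσ : Tables d N S G σ) (hr : r < N) (hs : s < N)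
    (hc : Candidates N G r s (σ.arr .cand) (σ.var .oA) (σ.var .oB) (σ.var .c) UA UB)
    {x y : ℕ} (hx : x ∈ UA) (hy : y ∈ UB) (hm : (orb G (Finset.range N) x).card = m)
    (hcs : Searched d N S κ G x y σ cs) (hok : σ.var .ok ≠ 1) (hres : σ.var .res = 2) :
    wp Z (.block [conflictWords, partitionBoth, keepHalf]) (fun σ' =>
      Narrowed N G r s (σ.var .c / 2) σ' ∧
      σ'.time ≤ σ.time + 8 * (m / κ) + 29 + σ.var .c * (12 * (m / κ) + 58)) σ := by
  simp only [Cmd.block, wp_seq]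
  refine wp_call (wp_conflictWords hG hcs hok hm)
    fun σ₁ hf₁ ⟨hk, cs₁, cs₂, hw, hlen, hagree, hnot, _⟩ => ?_
  have hc₁ : σ₁.var .c = σ.var .c := hf₁.var .c rfl
  have hres₁ : σ₁.var .res = σ.var .res := hf₁.var .res rfl
  have hcand₁ : Candidates N G r s (σ₁.arr .cand) (σ₁.var .oA) (σ₁.var .oB) (σ₁.var .c) UA UB := by
    rwa [hf₁.arr .cand rfl, hf₁.var .oA rfl, hf₁.var .oB rfl, hc₁]
  rw [wp_seq]
  refine wp_call (wp_partitionBoth hG (hσ.of_frame hf₁) hw hk hcand₁)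
    fun σ₂ hf₂ ⟨hA, hB, ht₂⟩ => ?_
  have hc₂ : σ₂.var .c = σ₁.var .c := hf₂.var .c rfl
  have hres₂ : σ₂.var .res = σ₁.var .res := hf₂.var .res rfl
  rw [← hc₂, ← show σ₂.var .oA = σ₁.var .oA from hf₂.var .oA rfl] at hA
  rw [← hc₂, ← show σ₂.var .oB = σ₁.var .oB from hf₂.var .oB rfl] at hB
  have hcand₂ : Candidates N G r s (σ₂.arr .cand) (σ₂.var .oA) (σ₂.var .oB) (σ₂.var .c) UA UB :=
    ⟨hA.lists, hB.lists, hcand₁.matched, hc₂ ▸ hcand₁.pos,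
      by rw [hf₂.var .oA rfl, hc₂]; exact hcand₁.left_le,
      by rw [hf₂.var .oB rfl]; exact hcand₁.le_right,
      by rw [hf₂.var .oB rfl, hc₂]; exact hcand₁.right_le⟩
  refine wp_call (wp_keepHalf hG hr hs (fun x y h => h _ _) hcand₂ hA hB ⟨x, hx, hagree⟩
    ⟨y, hy, hnot⟩ (by omega)) fun σ' _ ⟨hnar, ht⟩ => ?_
  rw [hc₂, hc₁] at hnar
  rw [hc₁] at ht₂
  have hmul : 2 * (σ.var .c * (3 * (cs₁.length + cs₂.length) + 20)) ≤
      σ.var .c * (12 * (m / κ) + 58) := by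
    rw [Nat.mul_left_comm]
    exact Nat.mul_le_mul_left _ (by omega)
  exact ⟨hnar, by omega⟩

theorem wp_pairStep (hG : Setting d N S Z κ G) (hσ : Tables d N S G σ) (hr : r < N) (hs : s < N)
    (hmr : (orb G (Finset.range N) r).card = m) (hms : (orb G (Finset.range N) s).card = m)
    (hphi : ∀ x < N, σ.arr .phi x = 0)
    (hc : Candidates N G r s (σ.arr .cand) (σ.var .oA) (σ.var .oB) (σ.var .c) UA UB)
    (hres : σ.var .res = 2) :
    wp Z (pairStep d) (fun σ' => (∀ x < N, σ'.arr .phi x = 0) ∧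
      Narrowed N G r s (σ.var .c / 2) σ' ∧ σ'.time + 1 ≤ σ.time + stepTime d κ m (σ.var .c)) σ := by
  have hNd := hG.mul_d_lt
  have hr' := Finset.mem_range.2 hr
  have hs' := Finset.mem_range.2 hs
  have hle := hc.left_le
  have hle' := hc.right_le
  have hx : σ.arr .cand (σ.var .oA) ∈ UA := hc.left.mem hc.pos
  have hy : σ.arr .cand (σ.var .oB) ∈ UB := hc.right.mem hc.pos
  have hxr := hc.matched.subset_left hx
  have hys := hc.matched.subset_right hy
  have hxN := Finset.mem_range.1 (orb_subset hxr)
  have hyN := Finset.mem_range.1 (orb_subset hys)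
  have hmx : (orb G (Finset.range N) (σ.arr .cand (σ.var .oA))).card = m := by
    rw [hG.actsOn.orb_eq hr' ((hG.mem_orb hr).1 hxr), hmr]
  have hmy : (orb G (Finset.range N) (σ.arr .cand (σ.var .oB))).card = m := by
    rw [hG.actsOn.orb_eq hs' ((hG.mem_orb hs).1 hys), hms]
  have hm : 0 < m := hmx ▸ Finset.card_pos.2 ⟨_, hG.actsOn.self_mem_orb (Finset.mem_range.2 hxN)⟩
  have hmκ : m / κ ≤ m := Nat.div_le_self m κ
  have hring : (21 * d + 61) * m = (21 * d + 20) * m + 41 * m := by ring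
  have hpos := hc.pos
  simp only [pairStep, stepTime, Cmd.block, wp_seq, wp_assign]
  refine ⟨⟨trivial, by simp; omega⟩, ⟨trivial, by simp; omega⟩,
    wp_call (wp_search hG hσ.congr hxN hyN hphi) fun σ₁ hf₁ ⟨hphi₁, ⟨cs, hcs⟩, ht₁⟩ => ?_⟩
  have hc₁ : σ₁.var .c = σ.var .c := hf₁.var .c rfl
  have hres₁ : σ₁.var .res = σ.var .res := hf₁.var .res rfl
  replace hcs : Searched d N S κ G (σ.arr .cand (σ.var .oA)) (σ.arr .cand (σ.var .oB)) σ₁ cs := hcs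
  have htl : σ₁.var .tl = m := hcs.lists.card_eq.symm.trans hmx
  have hcand₁ : Candidates N G r s (σ₁.arr .cand) (σ₁.var .oA) (σ₁.var .oB) (σ₁.var .c) UA UB := by
    rwa [hf₁.arr .cand rfl, hf₁.var .oA rfl, hf₁.var .oB rfl, hc₁]
  simp only [Exp.val_idx, Exp.val_var, Store.var_assign, reduceCtorEq, ↓reduceIte, Store.arr_assign,
    Store.time_assign, htl] at ht₁
  rw [wp_ite]
  refine ⟨trivial, by simp; omega, fun hok => ?_, fun hok => ?_⟩
  · simp only [Order.add_one_le_iff, wp_assign, Exp.good_ofNat, Exp.val_ofNat, Store.arr_assign,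
      Store.arr_tick, Store.time_assign, Store.time_tick]
    refine ⟨by omega, hphi₁, .inl (.inl ⟨rfl, ?_⟩), by omega⟩
    exact (hc.matched.sameType_iff hG.actsOn hr' hs' hx hy).1
      (hcs.sameType hG hxN hyN hok (hmx.trans hmy.symm))
  · refine wp_call (wp_narrow (cs := cs) hG (hσ.congr.of_frame hf₁).congr hr hs hcand₁ hx hy hmx ?_
      hok (hres₁.trans hres)) fun σ' hf' ⟨hnar, ht'⟩ => ⟨?_, by simpa [hc₁] using hnar, ?_⟩
    · exact hcs.of_frame (P := .skip) ⟨fun _ _ => rfl, fun _ _ => rfl⟩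
    · rw [hf'.arr .phi rfl]
      exact hphi₁
    · simp only [Store.time_tick, Store.var_tick, hc₁] at ht'
      omega

/-- Bounds the time of the remaining rounds when `c` candidates are left: there are at most
`log₂ c + 1` of them, and the costs of partitioning form a geometric series. -/
def roundsTime (d κ m c : ℕ) : ℕ :=
  (21 * d + 61) * m * (Nat.log 2 c + 1) + 2 * (c * (12 * (m / κ) + 58))

theorem stepTime_le_roundsTime (d κ m c : ℕ) : stepTime d κ m c ≤ roundsTime d κ m c := by
  rw [stepTime, roundsTime]
  exact Nat.add_le_add (Nat.le_mul_of_pos_right _ (Nat.succ_pos _))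
    (Nat.le_mul_of_pos_left _ two_pos)

theorem stepTime_add_roundsTime_le {c' : ℕ} (hc : 0 < c') (h : c' ≤ c / 2) :
    stepTime d κ m c + roundsTime d κ m c' ≤ roundsTime d κ m c := by
  have hlog : Nat.log 2 c' + 1 ≤ Nat.log 2 c := by
    rw [Nat.log_of_one_lt_of_le (n := c) one_lt_two (by omega)]
    exact Nat.succ_le_succ (Nat.log_mono_right h)
  have hmul : 2 * (c' * (12 * (m / κ) + 58)) ≤ c * (12 * (m / κ) + 58) := by
    rw [← Nat.mul_assoc]
    exact Nat.mul_le_mul_right _ (by omega)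
  have hrounds := Nat.mul_le_mul_left ((21 * d + 61) * m) hlog
  rw [stepTime, roundsTime, roundsTime, Nat.mul_add_one _ (Nat.log 2 c)]
  omega

/-- Bounds the time of comparing two components of size `m`. -/
def pairTime (d κ m : ℕ) : ℕ := (42 * d + 46) * m + 15 + roundsTime d κ m m

theorem wp_pairInit (hG : Setting d N S Z κ G) (hσ : Tables d N S G σ)
    (hrA : σ.var .rA < N) (hrB : σ.var .rB < N)
    (hmA : (orb G (Finset.range N) (σ.var .rA)).card = m)
    (hmB : (orb G (Finset.range N) (σ.var .rB)).card = m) (hphi : ∀ x < N, σ.arr .phi x = 0) :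
    wp Z (pairInit d) (fun σ' => (∀ x < N, σ'.arr .phi x = 0) ∧ σ'.var .c = m ∧
      (∃ UA UB, Candidates N G (σ.var .rA) (σ.var .rB) (σ'.arr .cand) (σ'.var .oA) (σ'.var .oB)
        (σ'.var .c) UA UB) ∧ σ'.time ≤ σ.time + (42 * d + 46) * m + 13) σ := by
  have hNd := hG.mul_d_lt
  have hmN : m ≤ N := hmA ▸ (card_orb_le.trans_eq (Finset.card_range N))
  have hring : (42 * d + 46) * m = 2 * ((21 * d + 20) * m) + 6 * m := by ring
  simp only [pairInit, Cmd.block, wp_seq, wp_assign]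
  refine ⟨trivial, trivial,
    wp_call (wp_search hG hσ.congr hrA hrA hphi) fun σ₁ hf₁ ⟨hphi₁, ⟨_, hcs₁⟩, ht₁⟩ => ?_⟩
  have htl₁ : σ₁.var .tl = m := hcs₁.lists.card_eq.symm.trans hmA
  simp only [wp_seq, wp_assign]
  refine ⟨by simp; omega, wp_call (wp_copyQueue (by simp [htl₁]; omega))
    fun σ₂ hf₂ ⟨hcopy₂, _, ht₂⟩ => ?_⟩
  have hrB₂ : σ₂.var .rB = σ.var .rB := (hf₂.var .rB rfl).trans (hf₁.var .rB rfl)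
  have hphi₂ : σ₂.arr .phi = σ₁.arr .phi := hf₂.arr .phi rfl
  have hσ₂ : Tables d N S G σ₂ := (hσ.congr.of_frame hf₁).congr.of_frame hf₂
  simp only [wp_seq, wp_assign]
  refine ⟨trivial, trivial, wp_call (wp_search hG hσ₂.congr (by simpa [hrB₂] using hrB)
    (by simpa [hrB₂] using hrB) (by simpa [hphi₂] using hphi₁))
    fun σ₃ hf₃ ⟨hphi₃, ⟨_, hcs₃⟩, ht₃⟩ => ?_⟩
  have htl₃ : σ₃.var .tl = m :=
    hcs₃.lists.card_eq.symm.trans (by simpa [hrB₂] using hmB)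
  have hN₃ : σ₃.var .N = N := (hσ₂.congr.of_frame hf₃).N_eq
  have hcand₃ : σ₃.arr .cand = σ₂.arr .cand := hf₃.arr .cand rfl
  simp only [wp_seq, wp_assign]
  refine ⟨trivial, wp_call (wp_copyQueue (by simp [htl₃, hN₃]; omega))
    fun σ₄ hf₄ ⟨hcopy₄, hout₄, ht₄⟩ => ?_⟩
  have hN₄ : σ₄.var .N = N := (hf₄.var .N rfl).trans hN₃
  have htl₄ : σ₄.var .tl = m := (hf₄.var .tl rfl).trans htl₃
  have hphi₄ : σ₄.arr .phi = σ₃.arr .phi := hf₄.arr .phi rfl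
  simp only [Exp.val_var, Store.var_assign, reduceCtorEq, ↓reduceIte, hrB₂, Exp.val_ofNat, htl₁,
    zero_add, Store.arr_assign, hN₃, htl₃, hcand₃,
    Store.time_assign] at hcs₁ hcs₃ hcopy₂ hcopy₄ hout₄ ht₁ ht₂ ht₃ ht₄
  simp only [wp_seq, wp_assign, Exp.good_var, Exp.val_var, htl₄, Exp.good_ofNat, Exp.val_ofNat,
    Store.var_assign, reduceCtorEq, ↓reduceIte, hN₄, Store.arr_assign, hphi₄, Store.time_assign,
    add_le_add_iff_right, true_and]
  refine ⟨by omega, hphi₃, ⟨orb G (Finset.range N) (σ.var .rA), orb G (Finset.range N) (σ.var .rB),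
    ?_, ?_, .whole, ?_, by omega, le_rfl, by omega⟩, by omega⟩
  · refine (htl₁ ▸ hcs₁.lists).congr fun i hi => ?_
    rw [Nat.zero_add, hout₄ i (.inl (by omega)), hcopy₂ i hi]
  · have h := htl₃ ▸ hcs₃.lists
    simp only [Lists, Nat.zero_add] at h
    exact h.congr fun i hi => (hcopy₄ i hi).symm
  · exact hmA ▸ Finset.card_pos.2 ⟨_, hG.actsOn.self_mem_orb (Finset.mem_range.2 hrA)⟩

theorem wp_pair (hG : Setting d N S Z κ G) (hσ : Tables d N S G σ)
    (hrA : σ.var .rA < N) (hrB : σ.var .rB < N)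
    (hmA : (orb G (Finset.range N) (σ.var .rA)).card = m)
    (hmB : (orb G (Finset.range N) (σ.var .rB)).card = m) (hphi : ∀ x < N, σ.arr .phi x = 0) :
    wp Z (pair d) (fun σ' => (∀ x < N, σ'.arr .phi x = 0) ∧
      Verdict G (σ.var .rA) (σ.var .rB) (σ'.var .res) ∧
      σ'.time ≤ σ.time + pairTime d κ m) σ := by
  have hNd := hG.mul_d_lt
  simp only [pair, pairTime, Cmd.block, wp_seq]
  refine wp_call (wp_pairInit hG hσ hrA hrB hmA hmB hphi)
    fun σ₁ hf₁ ⟨hphi₁, hc₁, hcand₁, _⟩ => ?_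
  rw [wp_seq, wp_assign]
  refine ⟨by simp; omega, ?_⟩
  refine wp_loop (fun τ => (∀ x < N, τ.arr .phi x = 0) ∧
      Narrowed N G (σ.var .rA) (σ.var .rB) m τ ∧
      τ.time + (if τ.var .res = 2 then roundsTime d κ m (τ.var .c) else 0) ≤
        σ₁.time + 1 + roundsTime d κ m m)
    (fun τ => if τ.var .res = 2 then τ.var .c + 1 else 0)
    ⟨hphi₁, .inr ⟨by simp, by simp [hc₁], by simpa using hcand₁⟩, by simp [hc₁]⟩
    fun τ hf ⟨hphi', hnar, ht⟩ => ⟨trivial, by simp; omega, fun hres => ?_, fun hres => ?_⟩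
  · replace hres : τ.var .res = 2 := by simpa using hres
    obtain hv | ⟨-, hcm, UA, UB, hcand⟩ := hnar
    · exact absurd hres hv.ne_two
    have hpos := hcand.pos
    have hτ : Tables d N S G τ := (hσ.of_frame hf₁).congr.of_frame hf
    rw [if_pos hres] at ht
    refine wp_mono _ (fun σ' ⟨hphi'', hnar', ht'⟩ => ?_) _
      (wp_pairStep hG hτ.congr hrA hrB hmA hmB hphi' hcand hres)
    have hstep := stepTime_le_roundsTime d κ m (τ.var .c)
    simp only [Store.var_tick, Store.time_tick, Order.add_one_le_iff] at hnar' ht'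
    rw [if_pos hres]
    rcases hnar' with hv | ⟨hres', hc', UA', UB', hcand'⟩
    · rw [if_neg hv.ne_two, if_neg hv.ne_two]
      exact ⟨⟨hphi'', .inl hv, by omega⟩, by omega⟩
    · have hrounds := stepTime_add_roundsTime_le (d := d) (κ := κ) (m := m) hcand'.pos hc'
      rw [if_pos hres', if_pos hres']
      exact ⟨⟨hphi'', .inr ⟨hres', by omega, _, _, hcand'⟩, by omega⟩, by omega⟩
  · replace hres : τ.var .res ≠ 2 := by simpa using hres
    rw [if_neg hres] at ht
    exact ⟨hphi', hnar.resolve_right fun h => hres h.1, by simp only [Store.time_tick]; omega⟩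

end Pair

section Table

/-- Compute the number of vertices and the size of the table, about `max (d + 1) √n`. -/
def tableSize (d : ℕ) : Cmd Var Arr := .block [
  .assign .N (.var .n + .var .n),
  .assign .S (.lit (d + 1)),
  .loop .lt (.var .S * .var .S) (.var .n) (.assign .S (.var .S + 1))]

/-- Compute the entry `i` of the table: words of at most one letter act as in the input, the other
ones are split before the last letter. -/
def tableStep (d : ℕ) : Cmd Var Arr := .block [
  .assign .x (.var .i / .var .N),
  .assign .y (.var .i % .var .N),
  .ite .eq (.var .x) 0 (.write .tab (.var .i) (.var .y))
    (.ite .le (.var .x) (.lit d)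
      (.ite .lt (.var .y) (.var .n)
        (.write .tab (.var .i) (.idx .inp ((.var .x - 1) * .var .n + .var .y)))
        (.write .tab (.var .i) (.var .n +
          .idx .inp (.lit d * .var .n + ((.var .x - 1) * .var .n + (.var .y - .var .n))))))
      (.write .tab (.var .i) (.idx .tab (.var .x % .lit (d + 1) * .var .N +
        .idx .tab (.var .x / .lit (d + 1) * .var .N + .var .y))))),
  .assign .i (.var .i + 1)]

/-- Compute the table of the actions of all words with code below `S`. -/
def table (d : ℕ) : Cmd Var Arr := .block [
  .assign .i 0,
  .loop .lt (.var .i) (.var .S * .var .N) (tableStep d)]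

/-- The bound on sizes and entries of arrays for inputs of size `n`. -/
def memSize (d n : ℕ) : ℕ := (2 * n + 2 * d + 10) * (2 * n + 2 * d + 10)

/-- The length of the words that the table covers. -/
def blockLen (d n : ℕ) : ℕ := Nat.log (d + 1) (max (d + 1) (Nat.sqrt n))

/-- The array `inp` holds the functions `G 1, …, G d`: first the restrictions to the first `n`
vertices, then the restrictions to the last `n` vertices, renumbered from zero on. -/
def Describes (d n : ℕ) (G : ℕ → ℕ → ℕ) (inp : ℕ → ℕ) : Prop :=
  ∀ j, 1 ≤ j → j ≤ d → ∀ y < 2 * n,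
    (y < n → inp ((j - 1) * n + y) = G j y) ∧
    (n ≤ y → n + inp (d * n + ((j - 1) * n + (y - n))) = G j y)

/-- The first `i` entries of the table are correct. -/
def Filled (d N : ℕ) (G : ℕ → ℕ → ℕ) (tab : ℕ → ℕ) (i : ℕ) : Prop :=
  ∀ i' < i, tab i' = act G (word d (i' / N)) (i' % N)

variable {d n N S Z κ i c x y : ℕ} {G : ℕ → ℕ → ℕ} {σ : Store Var Arr} {tab inp : ℕ → ℕ}

theorem Setting.of_actsOn (hd : 0 < d) (hG : ActsOn G (Finset.range (2 * n)))
    (htriv : ∀ j x, ¬ (1 ≤ j ∧ j ≤ d) → G j x = x) (hdS : d + 1 ≤ S) (hnS : n ≤ S * S)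
    (hS : S ≤ n + d + 1) : Setting d (2 * n) S (memSize d n) (blockLen d n) G where
  actsOn := hG
  triv := htriv
  d_pos := hd
  κ_pos := Nat.log_pos (by omega) (le_max_left _ _)
  pow_le := (Nat.pow_log_le_self _ (by omega)).trans
    (max_le hdS ((Nat.sqrt_le_sqrt hnS).trans_eq (Nat.sqrt_eq S)))
  tab_le := by simp only [memSize]; nlinarith
  code_le := by simp only [memSize]; nlinarith
  lt_Z := by simp only [memSize]; nlinarith

theorem wp_tableSize (hn : σ.var .n = n) :
    wp (memSize d n) (tableSize d) (fun σ' => σ'.var .N = 2 * n ∧ d + 1 ≤ σ'.var .S ∧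
      n ≤ σ'.var .S * σ'.var .S ∧ σ'.var .S ≤ n + d + 1 ∧ σ'.var .S ≤ d + 1 + (Nat.sqrt n + 1) ∧
      σ'.time ≤ σ.time + 2 * σ'.var .S + 5) σ := by
  have hbound (S : ℕ) (hS : S ≤ n + d + 1) : S * S < memSize d n ∧ S + 1 < memSize d n := by
    simp only [memSize]
    constructor <;> nlinarith
  have hnn : n + n < memSize d n := by simp only [memSize]; nlinarith
  have hd := (hbound (d + 1) (by omega)).2
  simp only [tableSize, Cmd.block, wp_seq, wp_assign]
  refine ⟨by simpa [hn] using hnn, by simp; omega,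
    wp_loop (fun τ => τ.var .N = 2 * n ∧ d + 1 ≤ τ.var .S ∧
      (τ.var .S = d + 1 ∨ (τ.var .S - 1) * (τ.var .S - 1) < n) ∧
      τ.time ≤ σ.time + 2 * τ.var .S + 2) (fun τ => n - (τ.var .S - 1))
    (by simp [hn, two_mul]) fun τ hf ⟨hN, hdS, hS, ht⟩ => ?_⟩
  have hn' : τ.var .n = n := (hf.var .n rfl).trans hn
  have hSsqrt : τ.var .S = d + 1 ∨ τ.var .S - 1 ≤ Nat.sqrt n :=
    hS.imp_right fun h => Nat.le_sqrt.2 h.le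
  have hSn : τ.var .S ≤ n + d + 1 := by
    have := Nat.sqrt_le_self n
    omega
  obtain ⟨hmul, hsucc⟩ := hbound _ hSn
  refine ⟨by simpa using hmul, by simp, fun hlt => ?_, fun hge => ?_⟩
  · simp only [Exp.val_mul, Exp.val_var, hn', Rel.holds_lt, Order.add_one_le_iff, wp_assign,
      Exp.good_add, Exp.good_var, Exp.good_ofNat, Store.var_tick, Exp.val_ofNat, true_and,
      Exp.val_add, Store.var_assign, reduceCtorEq, ↓reduceIte, Order.lt_add_one_iff,
      Nat.add_right_cancel_iff, add_tsub_cancel_right, Store.time_assign, Store.time_tick,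
      add_le_add_iff_right] at hlt ⊢
    have hle := Nat.le_mul_self (τ.var .S)
    exact ⟨⟨by omega, hsucc⟩, ⟨hN, by omega, .inr hlt, by omega⟩, by omega⟩
  · simp only [Exp.val_mul, Exp.val_var, hn', Rel.holds_lt, not_lt, Store.var_tick,
      Order.add_one_le_iff, Store.time_tick, add_le_add_iff_right] at hge ⊢
    exact ⟨hN, hdS, hge, hSn, by omega, by omega⟩

theorem Setting.act_word (hG : Setting d N S Z κ G) (hc : c ≠ 0) (y : ℕ) :
    act G (word d c) y = act G (word d (c % (d + 1))) (act G (word d (c / (d + 1))) y) := by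
  rw [word_eq_append hG.d_pos hc, act_append, act_cons, act_nil]
  by_cases h0 : c % (d + 1) = 0
  · rw [h0, word_zero, act_nil, hG.triv 0 _ (by omega)]
  · rw [word_letter (Nat.pos_of_ne_zero h0) (Nat.lt_succ_iff.1 (Nat.mod_lt c d.succ_pos))]
    rfl

namespace Filled

theorem apply (h : Filled d N G tab i) (hx : x < i / N) (hy : y < N) :
    x * N + y < i ∧ tab (x * N + y) = act G (word d x) y := by
  have hN : 0 < N := by omega
  have hlt : x * N + y < i :=
    calc x * N + y < (x + 1) * N := by rw [Nat.succ_mul]; omega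
      _ ≤ i / N * N := Nat.mul_le_mul_right _ hx
      _ ≤ i := Nat.div_mul_le_self i N
  refine ⟨hlt, ?_⟩
  rw [h _ hlt, Nat.mul_add_mod', Nat.mod_eq_of_lt hy, Nat.add_comm, Nat.add_mul_div_right _ _ hN,
    Nat.div_eq_of_lt hy, Nat.zero_add]

theorem update (h : Filled d N G tab i) {v : ℕ} (hv : v = act G (word d (i / N)) (i % N)) :
    Filled d N G (Function.update tab i v) (i + 1) := by
  intro i' hi'
  rcases (Nat.lt_succ_iff.1 hi').lt_or_eq with hlt | rfl
  · rw [Function.update_of_ne hlt.ne, h i' hlt]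
  · rw [Function.update_self, hv]

end Filled

theorem wp_tableStep (hG : Setting d (2 * n) S Z κ G) (hn : σ.var .n = n)
    (hN : σ.var .N = 2 * n) (hZ : 2 * (d * n) ≤ Z) (hSZ : S * (2 * n) + 1 < Z)
    (hinp : Describes d n G (σ.arr .inp)) (hi : σ.var .i < S * (2 * n))
    (htab : Filled d (2 * n) G (σ.arr .tab) (σ.var .i)) :
    wp Z (tableStep d) (fun σ' => σ'.var .i = σ.var .i + 1 ∧
      Filled d (2 * n) G (σ'.arr .tab) (σ.var .i + 1) ∧ σ'.time + 1 ≤ σ.time + 10) σ := by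
  have hNd := hG.mul_d_lt
  have hdZ := hG.d_lt_Z
  have hn0 : 0 < 2 * n := Nat.pos_of_ne_zero fun h => by simp [h] at hi
  have hlt := (Nat.div_lt_iff_lt_mul hn0).2 hi
  have hy := Nat.mod_lt (σ.var .i) hn0
  have hget {x' y' : ℕ} := htab.apply (x := x') (y := y')
  have hput {v : ℕ} := htab.update (v := v)
  generalize hx : σ.var .i / (2 * n) = x at *
  generalize hmod : σ.var .i % (2 * n) = y at *
  have hletter (hx0 : x ≠ 0) (hxd : x ≤ d) : act G (word d x) y = G x y := by
    rw [word_letter (Nat.pos_of_ne_zero hx0) hxd]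
    rfl
  have hmul (hx0 : x ≠ 0) (hxd : x ≤ d) : (x - 1) * n + n ≤ d * n := by
    rw [← Nat.succ_mul]
    exact Nat.mul_le_mul_right _ (by omega)
  simp only [tableStep, Cmd.block, add_le_add_iff_right, wp_seq, wp_assign, Exp.good_div,
    Exp.good_var, and_self, Exp.val_div, Exp.val_var, hN, hx, Exp.good_mod, Exp.val_mod,
    Store.var_assign, reduceCtorEq, ↓reduceIte, hmod, wp_ite, Exp.good_ofNat, Exp.val_ofNat,
    Rel.holds_eq, wp_write, Store.var_tick, Exp.good_add, Store.var_write, true_and, Exp.val_add,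
    Store.arr_assign, Store.arr_write, Store.arr_tick, Store.time_assign, Store.time_write,
    Store.time_tick, Exp.good_lit, Exp.val_lit, Rel.holds_le, hn, Rel.holds_lt, Exp.good_idx,
    Exp.good_mul, Exp.good_sub, Exp.val_sub, Exp.val_mul, and_self_right, Exp.val_idx, not_lt,
    not_le]
  refine ⟨by omega, fun hx0 => ?_, fun hx0 => ⟨by omega, fun hxd => ⟨fun hyn => ?_, fun hyn => ?_⟩,
    fun hxd => ?_⟩⟩
  · exact ⟨by omega, by omega, hput (by rw [hx0, word_zero, act_nil]), by omega⟩
  · have hle := hmul hx0 hxd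
    exact ⟨by omega, by omega, by omega,
      hput (((hinp x (by omega) hxd y hy).1 hyn).trans (hletter hx0 hxd).symm), by omega⟩
  · have hval := (hinp x (by omega) hxd y hy).2 hyn
    have hle := hmul hx0 hxd
    have hlt' := hG.apply_lt x hy
    rw [hval]
    exact ⟨by omega, by omega, by omega, hput (hletter hx0 hxd).symm, by omega⟩
  · have hd := hG.d_pos
    obtain ⟨hlt₁, hget₁⟩ :=
      hget (Nat.div_lt_self (by omega : 0 < x) (by omega : 1 < d + 1)) hy
    have hlt₂ := hG.act_lt (word d (x / (d + 1))) hy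
    obtain ⟨hlt₃, hget₃⟩ := hget ((Nat.mod_lt x (by omega : d + 1 > 0)).trans_le hxd) hlt₂
    rw [hget₁, hget₃]
    exact ⟨by omega, by omega, by omega, hput (hG.act_word hx0 y).symm, by omega⟩

theorem wp_table (hG : Setting d (2 * n) S Z κ G) (hn : σ.var .n = n)
    (hN : σ.var .N = 2 * n) (hS : σ.var .S = S) (hZ : 2 * (d * n) ≤ Z)
    (hSZ : S * (2 * n) + 1 < Z) (hinp : Describes d n G (σ.arr .inp)) :
    wp Z (table d) (fun σ' => Tables d (2 * n) S G σ' ∧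
      σ'.time ≤ σ.time + 10 * (S * (2 * n)) + 2) σ := by
  simp only [table, Cmd.block, wp_seq, wp_assign]
  refine ⟨by simp; omega, wp_loop (fun τ => τ.var .i ≤ S * (2 * n) ∧
      Filled d (2 * n) G (τ.arr .tab) (τ.var .i) ∧ τ.time ≤ σ.time + 10 * τ.var .i + 1)
    (fun τ => S * (2 * n) - τ.var .i)
    ⟨Nat.zero_le _, fun _ h => absurd h (Nat.not_lt_zero _), by simp⟩
    fun τ hf ⟨_, htab, ht⟩ => ?_⟩
  have hN' : τ.var .N = 2 * n := (hf.var .N rfl).trans hN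
  have hS' : τ.var .S = S := (hf.var .S rfl).trans hS
  refine ⟨trivial, by simp [hN', hS']; omega, fun hlt => ?_, fun hge => ?_⟩
  · replace hlt : τ.var .i < S * (2 * n) := by simpa [hN', hS'] using hlt
    refine wp_mono _ (fun σ' ⟨hi', htab', ht'⟩ => ?_) _ (wp_tableStep hG
      ((hf.var .n rfl).trans hn) hN' hZ hSZ (by simpa [hf.arr .inp rfl] using hinp) hlt htab)
    simp only [Store.var_tick, Store.time_tick, add_le_add_iff_right] at hi' htab' ht'
    exact ⟨⟨by omega, hi' ▸ htab', by omega⟩, by omega⟩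
  · replace hge : ¬ τ.var .i < S * (2 * n) := by simpa [hN', hS'] using hge
    obtain hi : τ.var .i = S * (2 * n) := by omega
    rw [hi] at htab ht
    refine ⟨⟨hN', hS', fun c hc y hy => (htab.apply ?_ hy).2⟩,
      by simp only [Store.time_tick]; omega⟩
    rwa [Nat.mul_div_cancel _ (by omega)]

end Table

section Ledger

/-- The cost, per point, of testing two components with `m` points each for isomorphism. -/
def weight (κ m : ℕ) : ℕ := m / κ + Nat.log 2 m + 1

/-- `B` bounds the total weight of any family of pairwise non-isomorphic components. -/
def WeightLe (N κ : ℕ) (G : ℕ → ℕ → ℕ) (B : ℕ) : Prop :=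
  ∀ T ⊆ Finset.range N, (∀ x ∈ T, ∀ y ∈ T, SameType G x y → x = y) →
    ∑ x ∈ T, weight κ (orb G (Finset.range N) x).card ≤ B

/-- The functions preserve the set of the points below `n`. -/
def Sided (N n : ℕ) (G : ℕ → ℕ → ℕ) : Prop := ∀ j, ∀ x < N, (G j x < n ↔ x < n)

open Classical in
/-- The number of points of `U` below `n` in components isomorphic to that of `r`. -/
noncomputable def lowerCount (G : ℕ → ℕ → ℕ) (n : ℕ) (U : Finset ℕ) (r : ℕ) : ℕ :=
  (U.filter fun x => x < n ∧ SameType G r x).card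

open Classical in
/-- The number of points of `U` from `n` on in components isomorphic to that of `r`. -/
noncomputable def upperCount (G : ℕ → ℕ → ℕ) (n : ℕ) (U : Finset ℕ) (r : ℕ) : ℕ :=
  (U.filter fun x => ¬ x < n ∧ SameType G r x).card

/-- The counter `c` after a component with `m` points, among them `v`, has been accounted for. -/
def tally (n v m c : ℕ) : ℕ := if v < n then c + m else c - m

/-- The union `U` of components is classified: `rep` lists representatives of the isomorphism types
in `U`, `rsz` their sizes and `cnt` the surplus of points below `n` over the other points of that
type, shifted by `N` in order not to be negative. -/
structure Ledger (G : ℕ → ℕ → ℕ) (N n : ℕ) (U : Finset ℕ) (R : ℕ) (rep rsz cnt : ℕ → ℕ) :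
    Prop where
  subset : U ⊆ Finset.range N
  orb_subset : ∀ x ∈ U, orb G (Finset.range N) x ⊆ U
  rep_mem : ∀ t < R, rep t ∈ U
  rsz_eq : ∀ t < R, rsz t = (orb G (Finset.range N) (rep t)).card
  separated : ∀ t < R, ∀ t' < R, SameType G (rep t) (rep t') → t = t'
  cover : ∀ x ∈ U, ∃ t < R, SameType G (rep t) x
  balance : ∀ t < R, cnt t + upperCount G n U (rep t) = N + lowerCount G n U (rep t)

variable {d N n κ B R m v r c : ℕ} {G : ℕ → ℕ → ℕ} {X U : Finset ℕ} {rep rsz cnt cnt' : ℕ → ℕ}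

theorem Sided.reach (h : Sided N n G) (hG : ActsOn G (Finset.range N)) {x y : ℕ} (hx : x < N)
    (hxy : Reach G x y) : y < n ↔ x < n := by
  obtain ⟨l, rfl⟩ := hxy
  induction l generalizing x with
  | nil => rfl
  | cons j l ih =>
    rw [act_cons, ih (Finset.mem_range.1 (hG.mapsTo j x (Finset.mem_range.2 hx))), h j x hx]

theorem ActsOn.card_filter_union_orb (hG : ActsOn G X) (hv : v ∈ X)
    (hd : Disjoint U (orb G X v)) {P : ℕ → Prop} [DecidablePred P]
    (hP : ∀ x, Reach G v x → (P x ↔ P v)) :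
    ((U ∪ orb G X v).filter P).card = (U.filter P).card + if P v then (orb G X v).card else 0 := by
  have hfilter : (orb G X v).filter P = if P v then orb G X v else ∅ := by
    split_ifs with h
    · exact Finset.filter_true_of_mem fun x hx => (hP x ((hG.mem_orb hv).1 hx)).2 h
    · exact Finset.filter_false_of_mem fun x hx hPx => h ((hP x ((hG.mem_orb hv).1 hx)).1 hPx)
  rw [Finset.filter_union, Finset.card_union_of_disjoint (Finset.disjoint_filter_filter hd),
    hfilter]
  split_ifs <;> simp

theorem upperCount_le (hU : U ⊆ Finset.range N) : upperCount G n U r ≤ N := by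
  classical
  exact (Finset.card_le_card ((Finset.filter_subset _ _).trans hU)).trans_eq (Finset.card_range N)

theorem lowerCount_le (hU : U ⊆ Finset.range N) : lowerCount G n U r ≤ N := by
  classical
  exact (Finset.card_le_card ((Finset.filter_subset _ _).trans hU)).trans_eq (Finset.card_range N)

section Union

variable (hG : ActsOn G (Finset.range N)) (hs : Sided N n G) (hv : v < N)
  (hd : Disjoint U (orb G (Finset.range N) v))

include hG hs hv hd

open Classical in
theorem lowerCount_union_orb : lowerCount G n (U ∪ orb G (Finset.range N) v) r =
    lowerCount G n U r +
      if v < n ∧ SameType G r v then (orb G (Finset.range N) v).card else 0 :=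
  hG.card_filter_union_orb (Finset.mem_range.2 hv) hd fun _ hx =>
    and_congr (hs.reach hG hv hx) (hG.sameType_congr_right (Finset.mem_range.2 hv) hx)

open Classical in
theorem upperCount_union_orb : upperCount G n (U ∪ orb G (Finset.range N) v) r =
    upperCount G n U r +
      if ¬ v < n ∧ SameType G r v then (orb G (Finset.range N) v).card else 0 :=
  hG.card_filter_union_orb (Finset.mem_range.2 hv) hd fun _ hx =>
    and_congr (hs.reach hG hv hx).not (hG.sameType_congr_right (Finset.mem_range.2 hv) hx)

open Classical in
theorem tally_balance (hU : U ⊆ Finset.range N)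
    (hc : c + upperCount G n U r = N + lowerCount G n U r) :
    (if SameType G r v then tally n v (orb G (Finset.range N) v).card c else c) +
        upperCount G n (U ∪ orb G (Finset.range N) v) r =
      N + lowerCount G n (U ∪ orb G (Finset.range N) v) r := by
  have hle := upperCount_le (G := G) (n := n) (r := r)
    (Finset.union_subset hU (orb_subset (G := G) (x := v)))
  rw [lowerCount_union_orb hG hs hv hd, upperCount_union_orb hG hs hv hd] at *
  by_cases h : SameType G r v <;> by_cases hlt : v < n <;> simp [h, hlt, tally] at hle ⊢ <;> omega

end Union

namespace Ledger

theorem empty : Ledger G N n ∅ 0 rep rsz cnt := by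
  constructor <;> simp

theorem rep_lt (h : Ledger G N n U R rep rsz cnt) {t : ℕ} (ht : t < R) : rep t < N :=
  Finset.mem_range.1 (h.subset (h.rep_mem t ht))

theorem size_le (h : Ledger G N n U R rep rsz cnt) : R ≤ N := by
  simpa using Finset.card_le_card_of_injOn (s := Finset.range R) (t := Finset.range N) rep
    (fun t ht => h.subset (h.rep_mem t (by simpa using ht)))
    (fun t ht t' ht' he => h.separated t (by simpa using ht) t' (by simpa using ht') (he ▸ .refl _))

theorem cnt_le (h : Ledger G N n U R rep rsz cnt) {t : ℕ} (ht : t < R) : cnt t ≤ 2 * N := by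
  have hb := h.balance t ht
  have hle := lowerCount_le (G := G) (n := n) (r := rep t) h.subset
  omega

theorem disjoint_orb (h : Ledger G N n U R rep rsz cnt) (hG : ActsOn G (Finset.range N))
    (hv : v < N) (hvU : v ∉ U) : Disjoint U (orb G (Finset.range N) v) := by
  refine Finset.disjoint_left.2 fun x hx hxv => hvU (h.orb_subset x hx ?_)
  rw [hG.orb_eq (Finset.mem_range.2 hv) ((hG.mem_orb (Finset.mem_range.2 hv)).1 hxv)]
  exact hG.self_mem_orb (Finset.mem_range.2 hv)

theorem orb_subset_union (h : Ledger G N n U R rep rsz cnt) (hG : ActsOn G (Finset.range N))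
    (hv : v < N) : ∀ x ∈ U ∪ orb G (Finset.range N) v,
      orb G (Finset.range N) x ⊆ U ∪ orb G (Finset.range N) v := by
  intro x hx
  rcases Finset.mem_union.1 hx with hx | hx
  · exact (h.orb_subset x hx).trans Finset.subset_union_left
  · rw [hG.orb_eq (Finset.mem_range.2 hv) ((hG.mem_orb (Finset.mem_range.2 hv)).1 hx)]
    exact Finset.subset_union_right

open Classical in
theorem union_of_sameType (h : Ledger G N n U R rep rsz cnt) (hG : ActsOn G (Finset.range N))
    (hs : Sided N n G) (hv : v < N) (hvU : v ∉ U) (hold : ∃ t < R, SameType G (rep t) v)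
    (hcnt : ∀ t < R, cnt' t =
      if SameType G (rep t) v then tally n v (orb G (Finset.range N) v).card (cnt t) else cnt t) :
    Ledger G N n (U ∪ orb G (Finset.range N) v) R rep rsz cnt' where
  subset := Finset.union_subset h.subset SCP.orb_subset
  orb_subset := h.orb_subset_union hG hv
  rep_mem t ht := Finset.mem_union_left _ (h.rep_mem t ht)
  rsz_eq := h.rsz_eq
  separated := h.separated
  cover x hx := by
    rcases Finset.mem_union.1 hx with hx | hx
    · exact h.cover x hx
    · have hv' := Finset.mem_range.2 hv
      obtain ⟨t, ht, hrv⟩ := hold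
      exact ⟨t, ht, (hG.sameType_congr_right hv' ((hG.mem_orb hv').1 hx)).2 hrv⟩
  balance t ht := by
    rw [hcnt t ht]
    exact tally_balance hG hs hv (h.disjoint_orb hG hv hvU) h.subset (h.balance t ht)

theorem count_eq_zero (h : Ledger G N n U R rep rsz cnt) (hG : ActsOn G (Finset.range N))
    (hnew : ∀ t < R, ¬ SameType G (rep t) v) :
    upperCount G n U v = 0 ∧ lowerCount G n U v = 0 := by
  classical
  have hnot (x : ℕ) (hx : x ∈ U) (hvx : SameType G v x) : False := by
    obtain ⟨t, ht, hrx⟩ := h.cover x hx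
    exact hnew t ht (hrx.trans (hG.sameType_symm (h.subset hx) hvx))
  exact ⟨Finset.card_eq_zero.2 (Finset.filter_false_of_mem fun x hx hP => hnot x hx hP.2),
    Finset.card_eq_zero.2 (Finset.filter_false_of_mem fun x hx hP => hnot x hx hP.2)⟩

open Classical in
theorem union_append (h : Ledger G N n U R rep rsz cnt) (hG : ActsOn G (Finset.range N))
    (hs : Sided N n G) (hv : v < N) (hvU : v ∉ U) (hm : (orb G (Finset.range N) v).card = m)
    (hnew : ∀ t < R, ¬ SameType G (rep t) v)
    (hcnt : ∀ t < R, cnt' t = if SameType G (rep t) v then tally n v m (cnt t) else cnt t) :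
    Ledger G N n (U ∪ orb G (Finset.range N) v) (R + 1) (Function.update rep R v)
      (Function.update rsz R m) (Function.update cnt' R (tally n v m N)) := by
  subst hm
  have hv' := Finset.mem_range.2 hv
  have hne {t : ℕ} (ht : t < R) (f : ℕ → ℕ) (a : ℕ) : Function.update f R a t = f t :=
    Function.update_of_ne ht.ne _ _
  have hself (f : ℕ → ℕ) (a : ℕ) : Function.update f R a R = a := Function.update_self ..
  have hbal {t c : ℕ} :=
    tally_balance (r := t) (c := c) hG hs hv (h.disjoint_orb hG hv hvU) h.subset
  refine ⟨Finset.union_subset h.subset SCP.orb_subset, h.orb_subset_union hG hv, ?_, ?_, ?_, ?_, ?_⟩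
  · refine Nat.forall_lt_succ_right.2 ⟨fun t ht => ?_, ?_⟩
    · exact hne ht rep v ▸ Finset.mem_union_left _ (h.rep_mem t ht)
    · exact (hself rep v).symm ▸ Finset.mem_union_right _ (hG.self_mem_orb hv')
  · refine Nat.forall_lt_succ_right.2 ⟨fun t ht => ?_, ?_⟩
    · rw [hne ht, hne ht, h.rsz_eq t ht]
    · rw [hself, hself]
  · simp only [Nat.forall_lt_succ_right, hself]
    refine ⟨fun t ht => ⟨fun t' ht' => ?_, fun hr => ?_⟩, fun t ht hr => ?_, fun _ => trivial⟩
    · rw [hne ht, hne ht']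
      exact h.separated t ht t' ht'
    · exact absurd (hne ht rep v ▸ hr) (hnew t ht)
    · exact absurd (hG.sameType_symm (h.subset (h.rep_mem t ht)) (hne ht rep v ▸ hr)) (hnew t ht)
  · intro x hx
    rcases Finset.mem_union.1 hx with hx | hx
    · obtain ⟨t, ht, hr⟩ := h.cover x hx
      exact ⟨t, ht.trans (Nat.lt_succ_self R), by rwa [hne ht]⟩
    · exact ⟨R, Nat.lt_succ_self R,
        by rw [hself]; exact hG.sameType_of_reach hv' ((hG.mem_orb hv').1 hx)⟩
  · refine Nat.forall_lt_succ_right.2 ⟨fun t ht => ?_, ?_⟩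
    · rw [hne ht, hne ht, hcnt t ht]
      exact hbal (h.balance t ht)
    · obtain ⟨hup, hlow⟩ := h.count_eq_zero hG hnew
      rw [hself, hself]
      simpa only [if_pos (SameType.refl v)] using hbal (t := v) (c := N) (by rw [hup, hlow])

end Ledger

end Ledger

section Scan

/-- Account for the component of `v`, which has `m` points, at the representative number `t`. -/
def addCount : Cmd Var Arr := .ite .lt (.var .v) (.var .n)
  (.write .cnt (.var .t) (.idx .cnt (.var .t) + .var .m))
  (.write .cnt (.var .t) (.idx .cnt (.var .t) - .var .m))

/-- Compare the component of `rB = v` with the representative number `t`. -/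
def scanStep (d : ℕ) : Cmd Var Arr := .block [
  .ite .eq (.idx .rsz (.var .t)) (.var .m)
    (.block [.assign .rA (.idx .rep (.var .t)), pair d,
      .ite .eq (.var .res) 1 (.block [.assign .found 1, addCount]) .skip])
    .skip,
  .assign .t (.var .t + 1)]

/-- Compare the component of `rB = v` with all representatives. -/
def scan (d : ℕ) : Cmd Var Arr := .loop .lt (.var .t) (.var .R) (scanStep d)

/-- Mark the vertices in the queue as visited. -/
def mark : Cmd Var Arr := .block [
  .assign .i 0,
  .loop .lt (.var .i) (.var .tl)
    (.block [.write .vis (.idx .qu (.var .i)) 1, .assign .i (.var .i + 1)])]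

/-- The time to compare a component with `m` points with a representative with `k` points. -/
def scanTime (d κ m k : ℕ) : ℕ := 10 + if k = m then pairTime d κ m else 0

variable {d N n S Z κ B R m : ℕ} {U : Finset ℕ} {G : ℕ → ℕ → ℕ} {rep rsz cnt : ℕ → ℕ}
  {σ : Store Var Arr}

theorem pairTime_le (hm : 0 < m) : pairTime d κ m ≤ m * ((63 * d + 238) * weight κ m) := by
  have hlog : Nat.log 2 m + 1 ≤ weight κ m := by
    simp only [weight, Nat.add_assoc, Nat.le_add_left]
  have hdiv : 12 * (m / κ) + 58 ≤ 58 * weight κ m := by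
    simp only [weight]
    omega
  have hone : 1 ≤ m * weight κ m := Nat.mul_pos hm (Nat.succ_pos _)
  calc pairTime d κ m
      = (42 * d + 46) * (m * 1) + 15 * 1 + ((21 * d + 61) * m * (Nat.log 2 m + 1) +
          2 * (m * (12 * (m / κ) + 58))) := by rw [mul_one]; rfl
    _ ≤ (42 * d + 46) * (m * weight κ m) + 15 * (m * weight κ m) +
          ((21 * d + 61) * m * weight κ m + 2 * (m * (58 * weight κ m))) := by
        gcongr
        exact Nat.succ_pos _
    _ = m * ((63 * d + 238) * weight κ m) := by ring

theorem scanTime_le (hm : 0 < m) (k : ℕ) :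
    scanTime d κ m k ≤ m * (63 * d + 248) * weight κ k := by
  have hone : 1 ≤ m * weight κ k := Nat.mul_pos hm (Nat.succ_pos _)
  unfold scanTime
  split_ifs with hk
  · subst hk
    linarith [pairTime_le (d := d) (κ := κ) hm]
  · nlinarith [Nat.zero_le (m * (63 * d + 238) * weight κ k)]

theorem Ledger.sum_scanTime_le (h : Ledger G N n U R rep rsz cnt) (hB : WeightLe N κ G B)
    (hm : 0 < m) : ∑ t ∈ Finset.range R, scanTime d κ m (rsz t) ≤ m * ((63 * d + 248) * B) := by
  have hinj : Set.InjOn rep (Finset.range R) := fun t ht t' ht' he =>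
    h.separated t (by simpa using ht) t' (by simpa using ht') (he ▸ .refl _)
  have hsum : ∑ t ∈ Finset.range R, weight κ (rsz t) ≤ B := by
    refine (Finset.sum_congr rfl fun t ht => ?_).trans_le
      ((Finset.sum_image hinj).symm.trans_le (hB ((Finset.range R).image rep) ?_ ?_))
    · rw [h.rsz_eq t (Finset.mem_range.1 ht)]
    · exact Finset.image_subset_iff.2 fun t ht => h.subset (h.rep_mem t (Finset.mem_range.1 ht))
    · simp only [Finset.forall_mem_image, Finset.mem_range]
      exact fun t ht t' ht' hs => congrArg rep (h.separated t ht t' ht' hs)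
  calc ∑ t ∈ Finset.range R, scanTime d κ m (rsz t)
      ≤ ∑ t ∈ Finset.range R, m * (63 * d + 248) * weight κ (rsz t) :=
        Finset.sum_le_sum fun t _ => scanTime_le hm _
    _ = m * (63 * d + 248) * ∑ t ∈ Finset.range R, weight κ (rsz t) := by rw [Finset.mul_sum]
    _ ≤ m * (63 * d + 248) * B := Nat.mul_le_mul_left _ hsum
    _ = m * ((63 * d + 248) * B) := by ring

theorem wp_addCount (ht : σ.var .t < Z) (hc : σ.arr .cnt (σ.var .t) + σ.var .m < Z) :
    wp Z addCount (fun σ' => σ'.arr .cnt = Function.update (σ.arr .cnt) (σ.var .t)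
        (tally (σ.var .n) (σ.var .v) (σ.var .m) (σ.arr .cnt (σ.var .t))) ∧
      σ'.time = σ.time + 2) σ := by
  simp only [addCount, tally, wp_ite, Exp.good_var, Exp.val_var, Rel.holds_lt, wp_write,
    Exp.good_add, Exp.good_idx, Store.var_tick, ht, and_self, Exp.val_idx, Store.arr_tick, hc,
    Exp.val_add, Store.arr_write, ↓reduceIte, Store.time_write, Store.time_tick, and_true, true_and,
    not_lt, Exp.good_sub, Exp.val_sub]
  exact ⟨fun h => by rw [if_pos h], fun h => by rw [if_neg h.not_gt]⟩

open Classical in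
theorem wp_scanStep (hG : Setting d N S Z κ G) (hσ : Tables d N S G σ) (hv : σ.var .v < N)
    (hrB : σ.var .rB = σ.var .v)
    (hm : (orb G (Finset.range N) (σ.var .v)).card = σ.var .m)
    (hphi : ∀ x < N, σ.arr .phi x = 0) (hrep : σ.arr .rep (σ.var .t) < N)
    (hrsz : σ.arr .rsz (σ.var .t) = (orb G (Finset.range N) (σ.arr .rep (σ.var .t))).card)
    (ht : σ.var .t < N) (hcnt : σ.arr .cnt (σ.var .t) ≤ 2 * N) :
    wp Z (scanStep d) (fun σ' => σ'.var .t = σ.var .t + 1 ∧ (∀ x < N, σ'.arr .phi x = 0) ∧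
      (σ'.var .found ≠ 0 ↔
        σ.var .found ≠ 0 ∨ SameType G (σ.arr .rep (σ.var .t)) (σ.var .v)) ∧
      (∀ t, σ'.arr .cnt t =
        if t = σ.var .t ∧ SameType G (σ.arr .rep (σ.var .t)) (σ.var .v) then
          tally (σ.var .n) (σ.var .v) (σ.var .m) (σ.arr .cnt t) else σ.arr .cnt t) ∧
      σ'.time + 1 ≤ σ.time + scanTime d κ (σ.var .m) (σ.arr .rsz (σ.var .t))) σ := by
  have hNd := hG.mul_d_lt
  have hmN : σ.var .m ≤ N := hm ▸ card_orb_le.trans_eq (Finset.card_range N)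
  simp only [scanStep, Cmd.block, wp_seq, wp_ite, wp_assign]
  refine ⟨⟨trivial, by simp; omega⟩, trivial, fun heq => ⟨⟨trivial, by simp; omega⟩, ?_⟩,
    fun hne => ?_⟩
  · replace heq : σ.arr .rsz (σ.var .t) = σ.var .m := by simpa using heq
    refine wp_call (wp_pair (m := σ.var .m) hG (by exact hσ.congr) (by simpa using hrep)
      (by simpa [hrB] using hv) (by simpa using hrsz.symm.trans heq) (by simpa [hrB] using hm)
      (by simpa using hphi)) fun σ₁ hf₁ ⟨hphi₁, hres, ht₁⟩ => ?_
    have ht' : σ₁.var .t = σ.var .t := hf₁.var .t rfl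
    have hcnt₁ : σ₁.arr .cnt = σ.arr .cnt := hf₁.arr .cnt rfl
    have hm₁ : σ₁.var .m = σ.var .m := hf₁.var .m rfl
    have hn₁ : σ₁.var .n = σ.var .n := hf₁.var .n rfl
    have hv₁ : σ₁.var .v = σ.var .v := hf₁.var .v rfl
    have hfound₁ : σ₁.var .found = σ.var .found := hf₁.var .found rfl
    simp only [Exp.val_idx, Exp.val_var, Store.var_tick, Store.arr_tick, Store.var_assign,
      ↓reduceIte, reduceCtorEq, hrB, Store.time_assign, Store.time_tick] at hres ht₁
    simp only [wp_ite, wp_seq, wp_assign, scanTime, if_pos heq]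
    refine ⟨trivial, by simp; omega, fun hres₁ => ⟨by simp; omega, ?_⟩, fun hres₁ => ?_⟩
    · have hsame : SameType G (σ.arr .rep (σ.var .t)) (σ.var .v) :=
        (hres.resolve_right fun h => by simp [h.1] at hres₁).2
      refine wp_call (wp_addCount (by simp; omega) (by simp [hcnt₁, ht', hm₁]; omega))
        fun σ₂ hf₂ ⟨hcnt₂, ht₂⟩ => ?_
      have ht₂' : σ₂.var .t = σ.var .t := (hf₂.var .t rfl).trans ht'
      have hfound₂ : σ₂.var .found = 1 := hf₂.var .found rfl
      simp only [Exp.val_ofNat, Store.arr_assign, Store.arr_tick, hcnt₁, Store.var_assign,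
        reduceCtorEq, ↓reduceIte, Store.var_tick, ht', hn₁, hv₁, hm₁, Store.time_assign,
        Store.time_tick] at hcnt₂ ht₂
      simp only [ne_eq, hsame, or_true, iff_true, and_true, Order.add_one_le_iff, wp_assign,
        Exp.good_add, Exp.good_var, Exp.good_ofNat, Exp.val_var, ht₂', Exp.val_ofNat, true_and,
        Exp.val_add, Store.var_assign, ↓reduceIte, Store.arr_assign, hf₂.arr .phi rfl,
        Store.arr_tick, reduceCtorEq, hfound₂, one_ne_zero, not_false_eq_true, hcnt₂,
        Function.update_apply, Store.time_assign]
      exact ⟨by omega, hphi₁, fun t => by split_ifs with h <;> simp [h], by omega⟩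
    · have hdiff : ¬ SameType G (σ.arr .rep (σ.var .t)) (σ.var .v) :=
        (hres.resolve_left fun h => hres₁ h.1).2
      simp only [ne_eq, hdiff, or_false, and_false, ↓reduceIte, Order.add_one_le_iff, wp_skip,
        wp_assign, Exp.good_add, Exp.good_var, Exp.good_ofNat, Exp.val_var, Store.var_tick, ht',
        Exp.val_ofNat, true_and, Exp.val_add, Store.var_assign, Store.arr_assign, Store.arr_tick,
        reduceCtorEq, hfound₁, hcnt₁, implies_true, Store.time_assign, Store.time_tick]
      exact ⟨by omega, hphi₁, by omega⟩
  · replace hne : σ.arr .rsz (σ.var .t) ≠ σ.var .m := by simpa using hne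
    have hdiff : ¬ SameType G (σ.arr .rep (σ.var .t)) (σ.var .v) := fun h => hne <| by
      rw [hrsz, hG.actsOn.card_orb_of_sameType (Finset.mem_range.2 hrep) (Finset.mem_range.2 hv) h,
        hm]
    simp only [ne_eq, hdiff, or_false, and_false, ↓reduceIte, scanTime, hne, add_zero,
      add_le_add_iff_right, wp_skip, wp_assign, Exp.good_add, Exp.good_var, Exp.good_ofNat,
      Exp.val_var, Store.var_tick, Exp.val_ofNat, true_and, Exp.val_add, Store.var_assign,
      Store.arr_assign, Store.arr_tick, reduceCtorEq, implies_true, Store.time_assign,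
      Store.time_tick]
    exact ⟨by omega, hphi, by omega⟩

open Classical in
theorem wp_scan (hG : Setting d N S Z κ G) (hσ : Tables d N S G σ) (hv : σ.var .v < N)
    (hrB : σ.var .rB = σ.var .v)
    (hm : (orb G (Finset.range N) (σ.var .v)).card = σ.var .m)
    (hphi : ∀ x < N, σ.arr .phi x = 0)
    (h : Ledger G N n U (σ.var .R) (σ.arr .rep) (σ.arr .rsz) (σ.arr .cnt))
    (ht : σ.var .t = 0) (hfound : σ.var .found = 0) :
    wp Z (scan d) (fun σ' => σ'.var .t = σ.var .R ∧ (∀ x < N, σ'.arr .phi x = 0) ∧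
      (σ'.var .found ≠ 0 ↔ ∃ t < σ.var .R, SameType G (σ.arr .rep t) (σ.var .v)) ∧
      (∀ t < σ.var .R, σ'.arr .cnt t = if SameType G (σ.arr .rep t) (σ.var .v) then
        tally (σ.var .n) (σ.var .v) (σ.var .m) (σ.arr .cnt t) else σ.arr .cnt t) ∧
      σ'.time ≤ σ.time +
        ∑ t ∈ Finset.range (σ.var .R), scanTime d κ (σ.var .m) (σ.arr .rsz t) + 1) σ := by
  refine wp_loop (fun τ => τ.var .t ≤ σ.var .R ∧ (∀ x < N, τ.arr .phi x = 0) ∧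
      (τ.var .found ≠ 0 ↔ ∃ t < τ.var .t, SameType G (σ.arr .rep t) (σ.var .v)) ∧
      (∀ t, τ.arr .cnt t = if t < τ.var .t ∧ SameType G (σ.arr .rep t) (σ.var .v) then
        tally (σ.var .n) (σ.var .v) (σ.var .m) (σ.arr .cnt t) else σ.arr .cnt t) ∧
      τ.time ≤ σ.time +
        ∑ t ∈ Finset.range (τ.var .t), scanTime d κ (σ.var .m) (σ.arr .rsz t))
    (fun τ => σ.var .R - τ.var .t)
    ⟨by omega, hphi, by simp [ht, hfound], by simp [ht], by simp [ht]⟩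
    fun τ hf ⟨hle, hphi', hfound', hcnt', htime⟩ => ⟨trivial, trivial, fun hlt => ?_, fun hge => ?_⟩
  · have hR : τ.var .R = σ.var .R := hf.var .R rfl
    have hv' : τ.var .v = σ.var .v := hf.var .v rfl
    have hm' : τ.var .m = σ.var .m := hf.var .m rfl
    have hn' : τ.var .n = σ.var .n := hf.var .n rfl
    have hrep : τ.arr .rep = σ.arr .rep := hf.arr .rep rfl
    have hrsz : τ.arr .rsz = σ.arr .rsz := hf.arr .rsz rfl
    have htR : τ.var .t < σ.var .R := by simpa [hR] using hlt
    have hcnt : τ.arr .cnt (τ.var .t) = σ.arr .cnt (τ.var .t) := by simp [hcnt']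
    refine wp_mono _ (fun σ' ⟨ht₁, hphi₁, hfound₁, hcnt₁, htime₁⟩ => ?_) _
      (wp_scanStep hG (hσ.of_frame hf).congr (by simpa [hv'] using hv)
        (by simpa [hv', hf.var .rB rfl] using hrB) (by simpa [hv', hm'] using hm)
        (by simpa using hphi') (by simpa [hrep] using h.rep_lt htR)
        (by simpa [hrep, hrsz] using h.rsz_eq _ htR) (by simpa using htR.trans_le h.size_le)
        (by simpa [hcnt] using h.cnt_le htR))
    simp only [Store.var_tick, ne_eq, Store.arr_tick, hrep, hv', hn', hm', Store.time_tick, hrsz,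
      Order.add_one_le_iff] at ht₁ hfound₁ hcnt₁ htime₁
    refine ⟨⟨by omega, hphi₁, ?_, fun t => ?_, ?_⟩, by omega⟩
    · rw [ht₁, Nat.exists_lt_succ_right, ← hfound']
      exact hfound₁
    · rw [hcnt₁, hcnt', ht₁]
      rcases lt_trichotomy t (τ.var .t) with hlt' | rfl | hlt'
      · simp [hlt', hlt'.ne, hlt'.trans (Nat.lt_succ_self _)]
      · simp
      · simp [hlt'.not_gt, hlt'.ne', (Nat.succ_le_of_lt hlt').not_gt]
    · rw [ht₁, Finset.sum_range_succ]
      omega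
  · have hteq : τ.var .t = σ.var .R := le_antisymm hle (by simpa [hf.var .R rfl] using hge)
    rw [hteq] at hfound' hcnt' htime
    exact ⟨hteq, hphi', hfound', fun t ht => by simp [hcnt', ht], by simpa using htime⟩

theorem wp_mark (hq : ∀ i < σ.var .tl, σ.arr .qu i < Z) (htl : σ.var .tl + 1 < Z) :
    wp Z mark (fun σ' =>
      (∀ x, σ'.arr .vis x ≠ 0 ↔ σ.arr .vis x ≠ 0 ∨ ∃ i < σ.var .tl, σ.arr .qu i = x) ∧
      σ'.time ≤ σ.time + 3 * σ.var .tl + 2) σ := by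
  simp only [mark, Cmd.block, wp_seq, wp_assign]
  refine ⟨by simp; omega, wp_loop (fun τ => τ.var .i ≤ σ.var .tl ∧
      (∀ x, τ.arr .vis x ≠ 0 ↔ σ.arr .vis x ≠ 0 ∨ ∃ i < τ.var .i, σ.arr .qu i = x) ∧
      τ.time ≤ σ.time + 3 * τ.var .i + 1)
    (fun τ => σ.var .tl - τ.var .i) (by simp) fun τ hf ⟨hi, hvis, ht⟩ =>
    ⟨trivial, trivial, fun hlt => ?_, fun hge => ?_⟩⟩
  · have hqu : τ.arr .qu = σ.arr .qu := hf.arr .qu rfl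
    replace hlt : τ.var .i < σ.var .tl := by simpa [hf.var .tl rfl] using hlt
    have hqi := hq _ hlt
    simp only [ne_eq, wp_seq, wp_write, Exp.good_idx, Exp.good_var, Exp.val_var, Store.var_tick,
      true_and, Exp.good_ofNat, Exp.val_idx, Store.arr_tick, hqu, Exp.val_ofNat, wp_assign,
      Exp.good_add, Store.var_write, Exp.val_add, Store.var_assign, ↓reduceIte,
      Order.add_one_le_iff, Store.arr_assign, Store.arr_write, Function.update_apply,
      Order.lt_add_one_iff, Store.time_assign, Store.time_write, Store.time_tick,
      add_le_add_iff_right]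
    refine ⟨by omega, by omega, hqi, by omega, ⟨by omega, fun x => ?_, by omega⟩, by omega⟩
    simp only [← Nat.lt_succ_iff, Nat.exists_lt_succ_right]
    rw [← or_assoc, ← ne_eq (σ.arr .vis x), ← hvis x]
    by_cases hx : x = σ.arr .qu (τ.var .i) <;> simp [hx, eq_comm]
  · replace hge : τ.var .i = σ.var .tl := le_antisymm hi (by simpa [hf.var .tl rfl] using hge)
    rw [hge] at hvis ht
    exact ⟨hvis, by simpa using ht⟩

end Scan

section Classify

/-- Turn `v` into a new representative. -/
def addRep : Cmd Var Arr := .block [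
  .write .rep (.var .R) (.var .v),
  .write .rsz (.var .R) (.var .m),
  .write .cnt (.var .R) (.var .N),
  addCount,
  .assign .R (.var .R + 1)]

/-- Visit the component of `v`, and record it for the next `scan`. -/
def visit (d : ℕ) : Cmd Var Arr := .block [
  .assign .r (.var .v), .assign .s (.var .v), search d, .assign .m (.var .tl), mark,
  .assign .rB (.var .v), .assign .found 0, .assign .t 0]

/-- Turn `v` into a new representative unless the `scan` has found an old one. -/
def conclude : Cmd Var Arr := .ite .eq (.var .found) 0 addRep .skip

/-- Enter the component of `v` into the ledger. -/
def component (d : ℕ) : Cmd Var Arr := .block [visit d, scan d, conclude]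

/-- Enter the component of `v` into the ledger unless it is already there; then pass to `v + 1`. -/
def classifyStep (d : ℕ) : Cmd Var Arr := .block [
  .ite .eq (.idx .vis (.var .v)) 0 (component d) .skip, .assign .v (.var .v + 1)]

/-- Enter all components into the ledger. -/
def classify (d : ℕ) : Cmd Var Arr := .block [
  .assign .v 0, .assign .R 0, .loop .lt (.var .v) (.var .N) (classifyStep d)]

/-- The store contains a ledger of the visited part `U`. -/
structure Classified (N n : ℕ) (G : ℕ → ℕ → ℕ) (U : Finset ℕ) (σ : Store Var Arr) : Prop where
  ledger : Ledger G N n U (σ.var .R) (σ.arr .rep) (σ.arr .rsz) (σ.arr .cnt)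
  vis_iff : ∀ x < N, σ.arr .vis x ≠ 0 ↔ x ∈ U
  phi_eq : ∀ x < N, σ.arr .phi x = 0

/-- The time, per point, to enter a component into the ledger. -/
def componentTime (d B : ℕ) : ℕ := 21 * d + 40 + (63 * d + 248) * B

variable {d N n S Z κ B : ℕ} {U : Finset ℕ} {G : ℕ → ℕ → ℕ} {cnt : ℕ → ℕ}
  {σ : Store Var Arr}

theorem wp_addRep (hR : σ.var .R + 1 < Z) (hmN : σ.var .N + σ.var .m < Z)
    (ht : σ.var .t = σ.var .R) :
    wp Z addRep (fun σ' => σ'.var .R = σ.var .R + 1 ∧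
      σ'.arr .rep = Function.update (σ.arr .rep) (σ.var .R) (σ.var .v) ∧
      σ'.arr .rsz = Function.update (σ.arr .rsz) (σ.var .R) (σ.var .m) ∧
      σ'.arr .cnt = Function.update (σ.arr .cnt) (σ.var .R)
        (tally (σ.var .n) (σ.var .v) (σ.var .m) (σ.var .N)) ∧ σ'.time = σ.time + 6) σ := by
  simp only [addRep, Cmd.block, wp_seq, wp_write]
  refine ⟨trivial, trivial, by simp; omega, trivial, trivial, by simp; omega, trivial, trivial,
    by simp; omega, wp_call (wp_addCount (by simp; omega) (by simpa [ht] using hmN))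
      fun σ' hf ⟨hcnt, htime⟩ => ?_⟩
  simp only [Exp.val_var, Store.var_write, Store.arr_write, ↓reduceIte, reduceCtorEq, ht,
    Function.update_self, Function.update_idem, Store.time_write] at hcnt htime
  simp only [wp_assign, Exp.good_add, Exp.good_var, Exp.good_ofNat, Exp.val_var, hf.var .R rfl,
    Store.var_write, Exp.val_ofNat, hR, and_true, true_and, Exp.val_add, Store.var_assign,
    ↓reduceIte, Store.arr_assign, hf.arr .rep rfl, Store.arr_write, reduceCtorEq, hf.arr .rsz rfl,
    hcnt, Store.time_assign, htime, and_self]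
  omega

theorem wp_visit (hG : Setting d N S Z κ G) (hσ : Tables d N S G σ) (hv : σ.var .v < N)
    (hphi : ∀ x < N, σ.arr .phi x = 0) (hvis : ∀ x < N, σ.arr .vis x ≠ 0 ↔ x ∈ U) :
    wp Z (visit d) (fun σ' => σ'.var .rB = σ.var .v ∧ σ'.var .found = 0 ∧ σ'.var .t = 0 ∧
      (orb G (Finset.range N) (σ.var .v)).card = σ'.var .m ∧ (∀ x < N, σ'.arr .phi x = 0) ∧
      (∀ x < N, σ'.arr .vis x ≠ 0 ↔ x ∈ U ∪ orb G (Finset.range N) (σ.var .v)) ∧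
      σ'.time ≤ σ.time + (21 * d + 23) * σ'.var .m + 8) σ := by
  have hNd := hG.mul_d_lt
  simp only [visit, Cmd.block, wp_seq, wp_assign]
  refine ⟨trivial, trivial, wp_call (wp_search hG (by exact hσ.congr) (by simpa using hv)
    (by simpa using hv) (by simpa using hphi)) fun σ₁ hf₁ ⟨hphi₁, ⟨_, hcs⟩, ht₁⟩ => ?_⟩
  have hcard : (orb G (Finset.range N) (σ.var .v)).card = σ₁.var .tl :=
    by simpa using hcs.lists.card_eq
  have hqueue : Set.BijOn (σ₁.arr .qu) (Set.Iio (σ₁.var .tl))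
    (orb G (Finset.range N) (σ.var .v)) := by simpa using hcs.queue
  have htl : σ₁.var .tl ≤ N := hcard ▸ card_orb_le.trans_eq (Finset.card_range N)
  simp only [wp_seq, wp_assign]
  refine ⟨trivial, wp_call (wp_mark (fun i hi => ?_) (by simp; omega))
    fun σ₂ hf₂ ⟨hvis₂, ht₂⟩ => ?_⟩
  · have hmem := orb_subset (hqueue.mapsTo (Set.mem_Iio.2 (by simpa using hi)))
    have hlt := Finset.mem_range.1 hmem
    simp only [Exp.val_var, Store.arr_assign, gt_iff_lt]
    omega
  · have hv₂ : σ₂.var .v = σ.var .v := (hf₂.var .v rfl).trans (hf₁.var .v rfl)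
    have hm₂ : σ₂.var .m = σ₁.var .tl := hf₂.var .m rfl
    have hphi₂ : σ₂.arr .phi = σ₁.arr .phi := hf₂.arr .phi rfl
    simp only [ne_eq, Exp.val_var, Store.arr_assign, hf₁.arr .vis rfl, Store.var_assign,
      reduceCtorEq, ↓reduceIte, Store.time_assign] at hvis₂ ht₁ ht₂
    simp only [hcard, ne_eq, Finset.mem_union, wp_seq, wp_assign, Exp.good_var, Exp.val_var, hv₂,
      Exp.good_ofNat, Exp.val_ofNat, Store.var_assign, reduceCtorEq, ↓reduceIte, hm₂,
      Store.arr_assign, hphi₂, Store.time_assign, add_le_add_iff_right, true_and, and_self_left]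
    refine ⟨by omega, hphi₁, fun x hx => ?_, by linarith⟩
    rw [hvis₂, ← ne_eq, hvis x hx]
    refine or_congr_right ⟨?_, fun hmem => ?_⟩
    · rintro ⟨i, hi, rfl⟩
      exact hqueue.mapsTo hi
    · obtain ⟨i, hi, rfl⟩ := hqueue.surjOn hmem
      exact ⟨i, hi, rfl⟩

open Classical in
theorem wp_conclude (hG : ActsOn G (Finset.range N)) (hs : Sided N n G) (hNZ : 2 * N + 1 < Z)
    (hN : σ.var .N = N) (hn : σ.var .n = n) (hv : σ.var .v < N) (hvU : σ.var .v ∉ U)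
    (hm : (orb G (Finset.range N) (σ.var .v)).card = σ.var .m) (ht : σ.var .t = σ.var .R)
    (h : Ledger G N n U (σ.var .R) (σ.arr .rep) (σ.arr .rsz) cnt)
    (hfound : σ.var .found ≠ 0 ↔ ∃ t < σ.var .R, SameType G (σ.arr .rep t) (σ.var .v))
    (hcnt : ∀ t < σ.var .R, σ.arr .cnt t = if SameType G (σ.arr .rep t) (σ.var .v) then
      tally n (σ.var .v) (σ.var .m) (cnt t) else cnt t)
    (hvis : ∀ x < N, σ.arr .vis x ≠ 0 ↔ x ∈ U ∪ orb G (Finset.range N) (σ.var .v))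
    (hphi : ∀ x < N, σ.arr .phi x = 0) :
    wp Z conclude (fun σ' => Classified N n G (U ∪ orb G (Finset.range N) (σ.var .v)) σ' ∧
      σ'.time ≤ σ.time + 8) σ := by
  have hmN : σ.var .m ≤ N := hm ▸ card_orb_le.trans_eq (Finset.card_range N)
  have hRN := h.size_le
  simp only [conclude, wp_ite]
  refine ⟨trivial, by simp; omega, fun h0 => ?_, fun h1 => ?_⟩
  · replace h0 : ∀ t < σ.var .R, ¬ SameType G (σ.arr .rep t) (σ.var .v) :=
      fun t ht hst => (hfound.2 ⟨t, ht, hst⟩) h0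
    refine wp_call (wp_addRep (by simp; omega) (by simp; omega) (by simpa using ht))
      fun σ₁ hf₁ ⟨hR₁, hrep₁, hrsz₁, hcnt₁, htime₁⟩ => ?_
    simp only [Store.var_tick, Store.arr_tick, hn, hN,
      Store.time_tick] at hR₁ hrep₁ hrsz₁ hcnt₁ htime₁
    refine ⟨⟨?_, ?_, ?_⟩, by omega⟩
    · rw [hR₁, hrep₁, hrsz₁, hcnt₁]
      exact h.union_append hG hs hv hvU hm h0 hcnt
    · simpa [hf₁.arr .vis rfl] using hvis
    · simpa [hf₁.arr .phi rfl] using hphi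
  · exact ⟨⟨h.union_of_sameType hG hs hv hvU (hfound.1 h1) (hm ▸ hcnt), hvis, hphi⟩, by simp⟩

theorem wp_component (hG : Setting d N S Z κ G) (hB : WeightLe N κ G B) (hs : Sided N n G)
    (hσ : Tables d N S G σ) (hn : σ.var .n = n) (h : Classified N n G U σ) (hv : σ.var .v < N)
    (hvU : σ.var .v ∉ U) :
    wp Z (component d) (fun σ' =>
      Classified N n G (U ∪ orb G (Finset.range N) (σ.var .v)) σ' ∧
      σ'.time ≤ σ.time + (orb G (Finset.range N) (σ.var .v)).card * componentTime d B) σ := by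
  have hNd := hG.mul_d_lt
  simp only [component, Cmd.block, wp_seq]
  refine wp_call (wp_visit hG hσ hv h.phi_eq h.vis_iff)
    fun σ₁ hf₁ ⟨hrB₁, hfound₁, ht₁, hm₁, hphi₁, hvis₁, _⟩ => ?_
  have hv₁ : σ₁.var .v = σ.var .v := hf₁.var .v rfl
  have hn₁ : σ₁.var .n = n := (hf₁.var .n rfl).trans hn
  have hσ₁ := hσ.of_frame hf₁
  have hL₁ : Ledger G N n U (σ₁.var .R) (σ₁.arr .rep) (σ₁.arr .rsz) (σ₁.arr .cnt) := by
    rw [hf₁.var .R rfl, hf₁.arr .rep rfl, hf₁.arr .rsz rfl, hf₁.arr .cnt rfl]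
    exact h.ledger
  rw [wp_seq]
  refine wp_call (wp_scan hG hσ₁ (hv₁ ▸ hv) (hrB₁.trans hv₁.symm) (hv₁ ▸ hm₁) hphi₁ hL₁ ht₁ hfound₁)
    fun σ₂ hf₂ ⟨ht₂, hphi₂, hfound₂, hcnt₂, htime₂⟩ => ?_
  have hR₂ : σ₂.var .R = σ₁.var .R := hf₂.var .R rfl
  have hm₂ : σ₂.var .m = σ₁.var .m := hf₂.var .m rfl
  have hv₂ : σ₂.var .v = σ.var .v := (hf₂.var .v rfl).trans hv₁
  rw [← hR₂, ← hf₂.arr .rep rfl, ← hf₂.arr .rsz rfl] at hL₁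
  rw [← hf₂.arr .rep rfl, ← hR₂, hv₁, ← hv₂] at hfound₂ hcnt₂
  rw [← hm₂, hn₁] at hcnt₂
  refine wp_call (wp_conclude hG.actsOn hs (by omega) (hσ₁.of_frame hf₂).N_eq
    ((hf₂.var .n rfl).trans hn₁) (hv₂ ▸ hv) (hv₂ ▸ hvU) (hv₂ ▸ hm₂ ▸ hm₁) (ht₂.trans hR₂.symm) hL₁
    hfound₂ hcnt₂ (hv₂ ▸ hf₂.arr .vis rfl ▸ hvis₁) hphi₂) fun σ₃ _ ⟨hc₃, _⟩ => ?_
  have hm : 0 < σ₁.var .m :=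
    hm₁ ▸ Finset.card_pos.2 ⟨_, hG.actsOn.self_mem_orb (Finset.mem_range.2 hv)⟩
  have hsum := hL₁.sum_scanTime_le (d := d) hB hm
  rw [hR₂, hf₂.arr .rsz rfl] at hsum
  refine ⟨hv₂ ▸ hc₃, ?_⟩
  rw [hm₁, componentTime, mul_add]
  nlinarith

theorem wp_classifyStep (hG : Setting d N S Z κ G) (hB : WeightLe N κ G B) (hs : Sided N n G)
    (hσ : Tables d N S G σ) (hn : σ.var .n = n) (h : Classified N n G U σ) (hv : σ.var .v < N)
    (hvU : Finset.range (σ.var .v) ⊆ U) :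
    wp Z (classifyStep d) (fun σ' => σ'.var .v = σ.var .v + 1 ∧ ∃ U', Classified N n G U' σ' ∧
      Finset.range (σ.var .v + 1) ⊆ U' ∧
      σ'.time + U.card * componentTime d B ≤ σ.time + U'.card * componentTime d B + 3) σ := by
  have hNd := hG.mul_d_lt
  simp only [classifyStep, Cmd.block, wp_seq, wp_ite]
  refine ⟨by simp; omega, by simp; omega, fun h0 => ?_, fun h1 => ?_⟩
  · have hmem : σ.var .v ∉ U := fun hmem => (h.vis_iff _ hv).2 hmem (by simpa using h0)
    refine wp_call (wp_component hG hB hs hσ.congr (by simpa using hn) (U := U)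
      ⟨h.ledger, h.vis_iff, h.phi_eq⟩ (by simpa using hv) (by simpa using hmem))
      fun σ₁ hf₁ ⟨hU₁, ht₁⟩ => ?_
    have hv₁ : σ₁.var .v = σ.var .v := hf₁.var .v rfl
    have hself := hG.actsOn.self_mem_orb (Finset.mem_range.2 hv)
    simp only [Store.var_tick, Store.time_tick, wp_assign, Exp.good_add, Exp.good_var,
      Exp.good_ofNat, Exp.val_var, hv₁, Exp.val_ofNat, true_and, Exp.val_add, Store.var_assign,
      ↓reduceIte, Store.time_assign] at hU₁ ht₁ ⊢
    refine ⟨by omega, _, ⟨hU₁.ledger, hU₁.vis_iff, hU₁.phi_eq⟩, ?_, ?_⟩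
    · rw [Finset.range_add_one]
      exact Finset.insert_subset (Finset.mem_union_right _ hself)
        (hvU.trans Finset.subset_union_left)
    · rw [Finset.card_union_of_disjoint (h.ledger.disjoint_orb hG.actsOn hv hmem), add_mul]
      omega
  · have hmem : σ.var .v ∈ U := (h.vis_iff _ hv).1 (by simpa using h1)
    simp only [wp_skip, wp_assign, Exp.good_add, Exp.good_var, Exp.good_ofNat, Exp.val_var,
      Store.var_tick, Exp.val_ofNat, true_and, Exp.val_add, Store.var_assign, ↓reduceIte,
      Store.time_assign, Store.time_tick]
    refine ⟨by omega, U, ⟨h.ledger, h.vis_iff, h.phi_eq⟩, ?_, by omega⟩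
    rw [Finset.range_add_one]
    exact Finset.insert_subset hmem hvU

theorem wp_classify (hG : Setting d N S Z κ G) (hB : WeightLe N κ G B) (hs : Sided N n G)
    (hσ : Tables d N S G σ) (hn : σ.var .n = n) (hphi : ∀ x < N, σ.arr .phi x = 0)
    (hvis : ∀ x < N, σ.arr .vis x = 0) :
    wp Z (classify d) (fun σ' => Classified N n G (Finset.range N) σ' ∧
      σ'.time ≤ σ.time + 4 * N + N * componentTime d B + 3) σ := by
  have hNd := hG.mul_d_lt
  simp only [classify, Cmd.block, wp_seq, wp_assign]
  refine ⟨by simp; omega, by simp; omega, wp_loop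
    (fun τ => τ.var .v ≤ N ∧ ∃ U, Classified N n G U τ ∧ Finset.range (τ.var .v) ⊆ U ∧
      τ.time ≤ σ.time + 4 * τ.var .v + U.card * componentTime d B + 2)
    (fun τ => N - τ.var .v) ⟨by simp, ∅, ⟨by simpa using Ledger.empty, by simpa using hvis,
      by simpa using hphi⟩, by simp, by simp⟩
    fun τ hf ⟨hv, U, hU, hvU, ht⟩ => ⟨trivial, trivial, fun hlt => ?_, fun hge => ?_⟩⟩ <;>
  have hτ : Tables d N S G τ := Tables.of_frame hσ.congr hf
  · replace hlt : τ.var .v < N := by simpa [hτ.N_eq] using hlt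
    have hnτ : τ.var .n = n := (hf.var .n rfl).trans hn
    refine wp_mono _ (fun σ₁ ⟨hv₁, U₁, hU₁, hvU₁, ht₁⟩ => ?_) _ (wp_classifyStep hG hB hs hτ.congr
      (by simpa using hnτ) (U := U) ⟨hU.ledger, hU.vis_iff, hU.phi_eq⟩ (by simpa using hlt)
      (by simpa using hvU))
    simp only [Store.var_tick, Store.time_tick] at hv₁ hvU₁ ht₁
    exact ⟨⟨by omega, U₁, hU₁, hv₁ ▸ hvU₁, by omega⟩, by omega⟩
  · have hvN : τ.var .v = N := le_antisymm hv (by simpa [hτ.N_eq] using hge)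
    obtain rfl : U = Finset.range N := hU.ledger.subset.antisymm (hvN ▸ hvU)
    rw [hvN, Finset.card_range] at ht
    exact ⟨⟨hU.ledger, hU.vis_iff, hU.phi_eq⟩, by simp; omega⟩

end Classify

section Decider

/-- Decide whether all surpluses in the ledger vanish. -/
def verdict : Cmd Var Arr := .block [
  .assign .found 1, .assign .t 0,
  .loop .lt (.var .t) (.var .R) (.block [
    .ite .ne (.idx .cnt (.var .t)) (.var .N) (.assign .found 0) .skip,
    .assign .t (.var .t + 1)]),
  .assign .n (.var .found)]

/-- Decide whether the points below `n` and the other points form isomorphic systems. -/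
def decider (d : ℕ) : Cmd Var Arr := .block [tableSize d, table d, classify d, verdict]

/-- The running time in terms of a bound for the total weight of non-isomorphic components. -/
def runTime (d n B : ℕ) : ℕ :=
  20 * ((d + 2 + Nat.sqrt n) * (n + 1)) + 20 * n + 2 * n * componentTime d B + 20

/-- Every type of component has as many points below `n` as from `n` on. -/
def Balanced (N n : ℕ) (G : ℕ → ℕ → ℕ) : Prop :=
  ∀ x < N, lowerCount G n (Finset.range N) x = upperCount G n (Finset.range N) x

variable {d N n B R Z : ℕ} {G : ℕ → ℕ → ℕ} {rep rsz cnt : ℕ → ℕ} {σ : Store Var Arr}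

theorem Ledger.forall_cnt_eq_iff (h : Ledger G N n (Finset.range N) R rep rsz cnt)
    (hG : ActsOn G (Finset.range N)) : (∀ t < R, cnt t = N) ↔ Balanced N n G := by
  refine ⟨fun hcnt x hx => ?_, fun hb t ht => ?_⟩
  · obtain ⟨t, ht, hst⟩ := h.cover x (Finset.mem_range.2 hx)
    have hst' := hG.sameType_symm (Finset.mem_range.2 hx) hst
    have htype : SameType G x = SameType G (rep t) :=
      funext fun y => propext ⟨hst.trans, hst'.trans⟩
    have hbal := h.balance t ht
    rw [hcnt t ht] at hbal
    rw [lowerCount, upperCount, htype]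
    exact (Nat.add_left_cancel hbal).symm
  · have hbal := h.balance t ht
    rw [hb (rep t) (h.rep_lt ht)] at hbal
    exact Nat.add_right_cancel hbal

theorem wp_verdict (hR : σ.var .R + 1 < Z) (hN : σ.var .N < Z) :
    wp Z verdict (fun σ' =>
      σ'.var .n = (if ∀ t < σ.var .R, σ.arr .cnt t = σ.var .N then 1 else 0) ∧
      σ'.time ≤ σ.time + 4 * σ.var .R + 4) σ := by
  simp only [verdict, Cmd.block, wp_seq, wp_assign]
  refine ⟨by simp; omega, by simp; omega, wp_loop
    (fun τ => τ.var .t ≤ σ.var .R ∧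
      τ.var .found = (if ∀ t < τ.var .t, σ.arr .cnt t = σ.var .N then 1 else 0) ∧
      τ.time ≤ σ.time + 4 * τ.var .t + 2)
    (fun τ => σ.var .R - τ.var .t) (by simp)
    fun τ hf ⟨ht, hfound, htime⟩ => ⟨trivial, trivial, fun hlt => ?_, fun hge => ?_⟩⟩
  · have hcnt : τ.arr .cnt = σ.arr .cnt := hf.arr .cnt rfl
    have hNτ : τ.var .N = σ.var .N := hf.var .N rfl
    replace hlt : τ.var .t < σ.var .R := by simpa [hf.var .R rfl] using hlt
    simp only [wp_seq, wp_ite, Exp.good_idx, Exp.good_var, Exp.val_var, Store.var_tick, true_and,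
      Exp.val_idx, Store.arr_tick, hcnt, hNτ, Rel.holds_ne, ne_eq, wp_assign, Exp.good_ofNat,
      Exp.val_ofNat, Exp.good_add, Store.var_assign, reduceCtorEq, ↓reduceIte, Exp.val_add,
      Order.add_one_le_iff, Order.lt_add_one_iff, right_eq_ite_iff, zero_ne_one, imp_false,
      not_forall, Store.time_assign, Store.time_tick, add_le_add_iff_right, Decidable.not_not,
      wp_skip]
    refine ⟨by omega, fun hne => ⟨by omega, ⟨by omega, by omega⟩, ⟨by omega, ⟨_, le_rfl, hne⟩,
      by omega⟩, by omega⟩, fun heq => ⟨⟨by omega, by omega⟩, ⟨by omega, ?_, by omega⟩, by omega⟩⟩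
    rw [hfound]
    simp only [← Nat.lt_succ_iff, Nat.forall_lt_succ_right, heq, and_true]
  · have hteq : τ.var .t = σ.var .R := le_antisymm ht (by simpa [hf.var .R rfl] using hge)
    rw [hteq] at hfound htime
    simp only [wp_assign, Exp.good_var, Exp.val_var, Store.var_tick, hfound, Store.var_assign,
      ↓reduceIte, Store.time_assign, Store.time_tick, add_le_add_iff_right, true_and, ge_iff_le]
    omega

theorem wp_decider (hd : 0 < d) (hG : ActsOn G (Finset.range (2 * n)))
    (htriv : ∀ j x, ¬ (1 ≤ j ∧ j ≤ d) → G j x = x) (hB : WeightLe (2 * n) (blockLen d n) G B)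
    (hs : Sided (2 * n) n G) (hn : σ.var .n = n) (htime : σ.time = 0)
    (hphi : ∀ x < 2 * n, σ.arr .phi x = 0) (hvis : ∀ x < 2 * n, σ.arr .vis x = 0)
    (hinp : Describes d n G (σ.arr .inp)) [Decidable (Balanced (2 * n) n G)] :
    wp (memSize d n) (decider d) (fun σ' =>
      σ'.var .n = (if Balanced (2 * n) n G then 1 else 0) ∧ σ'.time ≤ runTime d n B) σ := by
  have hsize : 2 * (d * n) ≤ memSize d n ∧ 2 * n + 1 < memSize d n := by
    simp only [memSize]
    constructor <;> nlinarith
  simp only [decider, Cmd.block, wp_seq]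
  refine wp_call (wp_tableSize hn) fun σ₁ hf₁ ⟨hN₁, hdS, hnS, hS, _, _⟩ => ?_
  have hset := Setting.of_actsOn hd hG htriv hdS hnS hS
  have hSZ : σ₁.var .S * (2 * n) + 1 < memSize d n := by
    simp only [memSize]
    nlinarith
  rw [wp_seq]
  refine wp_call (wp_table hset ((hf₁.var .n rfl).trans hn) hN₁ rfl hsize.1 hSZ
    (hf₁.arr .inp rfl ▸ hinp)) fun σ₂ hf₂ ⟨htab, _⟩ => ?_
  rw [wp_seq]
  refine wp_call (wp_classify hset hB hs htab
    (((hf₂.var .n rfl).trans (hf₁.var .n rfl)).trans hn)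
    (hf₂.arr .phi rfl ▸ hf₁.arr .phi rfl ▸ hphi) (hf₂.arr .vis rfl ▸ hf₁.arr .vis rfl ▸ hvis))
    fun σ₃ hf₃ ⟨hc, _⟩ => ?_
  have hN₃ := (htab.of_frame hf₃).N_eq
  have hR := hc.ledger.size_le
  refine wp_call (wp_verdict (by omega) (by omega)) fun σ₄ _ ⟨hn₄, _⟩ => ⟨?_, ?_⟩
  · rw [hn₄, hN₃]
    simp only [hc.ledger.forall_cnt_eq_iff hG]
  · have hmul : σ₁.var .S * (n + 1) ≤ (d + 2 + Nat.sqrt n) * (n + 1) :=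
      Nat.mul_le_mul_right _ (by omega)
    rw [runTime]
    linarith

end Decider

section Instance

variable {d N n x : ℕ} {G : ℕ → ℕ → ℕ}

open Classical in
theorem lowerCount_range (hn : n ≤ N) :
    lowerCount G n (Finset.range N) x = ((Finset.range n).filter (SameType G x)).card := by
  rw [lowerCount]
  congr 1
  ext y
  simp only [Finset.mem_filter, Finset.mem_range]
  exact ⟨fun h => h.2, fun h => ⟨h.1.trans_le hn, h⟩⟩

open Classical in
theorem upperCount_range :
    upperCount G n (Finset.range N) x = ((Finset.Ico n N).filter (SameType G x)).card := by
  rw [upperCount]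
  congr 1
  ext y
  simp only [Finset.mem_filter, Finset.mem_range, Finset.mem_Ico, not_lt]
  tauto

theorem ActsOn.range_of_sided (hG : ActsOn G (Finset.range N)) (hs : Sided N n G) (hn : n ≤ N) :
    ActsOn G (Finset.range n) where
  mapsTo j x hx := Finset.mem_range.2
    ((hs j x ((Finset.mem_range.1 hx).trans_le hn)).2 (Finset.mem_range.1 hx))
  injOn j := (hG.injOn j).mono (Finset.coe_subset.2 (Finset.range_mono hn))

theorem ActsOn.Ico_of_sided (hG : ActsOn G (Finset.range N)) (hs : Sided N n G) :
    ActsOn G (Finset.Ico n N) where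
  mapsTo j x hx := by
    obtain ⟨hnx, hxN⟩ := Finset.mem_Ico.1 hx
    have hlt := Finset.mem_range.1 (hG.mapsTo j x (Finset.mem_range.2 hxN))
    exact Finset.mem_Ico.2 ⟨not_lt.1 fun h => hnx.not_gt ((hs j x hxN).1 h), hlt⟩
  injOn j := (hG.injOn j).mono fun _ hx => Finset.mem_range.2 (Finset.mem_Ico.1 hx).2

theorem balanced_iff_exists_isoOn (hG : ActsOn G (Finset.range N)) (hs : Sided N n G)
    (hn : n ≤ N) : Balanced N n G ↔ ∃ f, IsoOn G f (Finset.Ico n N) (Finset.range n) := by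
  classical
  simp only [Balanced, lowerCount_range hn, upperCount_range]
  refine ⟨fun hb => (hG.Ico_of_sided hs).exists_isoOn (hG.range_of_sided hs hn) fun x hx => ?_,
    fun ⟨f, hf⟩ x _ => (hf.card_filter_sameType (hG.Ico_of_sided hs) x).symm⟩
  refine (hb x ?_).symm
  rcases hx with hx | hx
  · exact (Finset.mem_Ico.1 hx).2
  · exact (Finset.mem_range.1 hx).trans_le hn

/-- The instance `(a, b)` as functions `G 1, …, G d` on `{0, …, 2 n - 1}`: the permutations `a` act
on `{0, …, n - 1}` and `b` on `{n, …, 2 n - 1}`. All other functions are the identity. -/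
def pairAct (a b : Fin d → Equiv.Perm (Fin n)) (j x : ℕ) : ℕ :=
  if hj : 1 ≤ j ∧ j ≤ d then
    if hx : x < n then a ⟨j - 1, by omega⟩ ⟨x, hx⟩
    else if hx' : x < 2 * n then n + b ⟨j - 1, by omega⟩ ⟨x - n, by omega⟩ else x
  else x

variable (a b : Fin d → Equiv.Perm (Fin n))

theorem pairAct_left (j : Fin d) (x : Fin n) : pairAct a b (j + 1) x = a j x := by
  rw [pairAct, dif_pos ⟨by omega, j.2⟩, dif_pos x.2]
  rfl

theorem pairAct_right (j : Fin d) (x : Fin n) : pairAct a b (j + 1) (n + x) = n + b j x := by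
  rw [pairAct, dif_pos ⟨by omega, j.2⟩, dif_neg (by omega), dif_pos (by omega)]
  simp

theorem pairAct_of_not {j : ℕ} (hj : ¬ (1 ≤ j ∧ j ≤ d)) (x : ℕ) : pairAct a b j x = x :=
  dif_neg hj

theorem forall_pairAct {P : ℕ → (ℕ → ℕ) → Prop}
    (hid : ∀ j, ¬ (1 ≤ j ∧ j ≤ d) → P j id) (h : ∀ j : Fin d, P (j + 1) (pairAct a b (j + 1)))
    (j : ℕ) : P j (pairAct a b j) := by
  by_cases hj : 1 ≤ j ∧ j ≤ d
  · simpa [Nat.sub_add_cancel hj.1] using h ⟨j - 1, by omega⟩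
  · exact (funext (pairAct_of_not a b hj) : pairAct a b j = id) ▸ hid j hj

theorem forall_lt_two_mul {P : ℕ → Prop} (hl : ∀ x : Fin n, P x) (hr : ∀ x : Fin n, P (n + x))
    (x : ℕ) (hx : x < 2 * n) : P x := by
  by_cases hxn : x < n
  · exact hl ⟨x, hxn⟩
  · simpa [Nat.add_sub_cancel' (not_lt.1 hxn)] using hr ⟨x - n, by omega⟩

theorem pairAct_sided : Sided (2 * n) n (pairAct a b) :=
  forall_pairAct a b (P := fun _ g => ∀ x < 2 * n, g x < n ↔ x < n) (fun _ _ _ _ => Iff.rfl)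
    fun j => forall_lt_two_mul (fun x => by simp [pairAct_left])
      (fun x => by simp [pairAct_right])

theorem pairAct_actsOn : ActsOn (pairAct a b) (Finset.range (2 * n)) := by
  have hmaps (j : ℕ) : ∀ x < 2 * n, pairAct a b j x < 2 * n := by
    refine forall_pairAct a b (P := fun _ g => ∀ x < 2 * n, g x < 2 * n) (fun _ _ _ => id)
      (fun j => forall_lt_two_mul (fun x => ?_) fun x => ?_) j
    · rw [pairAct_left]
      omega
    · rw [pairAct_right]
      omega
  have hinj (j : ℕ) : ∀ x < 2 * n, ∀ y < 2 * n, pairAct a b j x = pairAct a b j y → x = y := by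
    refine forall_pairAct a b
      (P := fun _ g => ∀ x < 2 * n, ∀ y < 2 * n, g x = g y → x = y) (fun _ _ _ _ _ _ => id)
      (fun j => forall_lt_two_mul (fun x => forall_lt_two_mul (fun y h => ?_) fun y h => ?_)
        fun x => forall_lt_two_mul (fun y h => ?_) fun y h => ?_) j
    all_goals simp only [pairAct_left, pairAct_right] at h
    · rw [(a j).injective (Fin.ext h)]
    · omega
    · omega
    · rw [(b j).injective (Fin.ext (Nat.add_left_cancel h))]
  exact ⟨fun j x hx => Finset.mem_range.2 (hmaps j x (Finset.mem_range.1 hx)),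
    fun j x hx y hy => hinj j x (Finset.mem_range.1 hx) y (Finset.mem_range.1 hy)⟩

theorem input_mem_left (j : Fin d) (x : Fin n) : (input a b).mem (j * n + x) = a j x := by
  have hp : (j * n + x : ℕ) = finProdFinEquiv (j, x) := by simp [add_comm, mul_comm]
  have hsymm := finProdFinEquiv.symm_apply_apply (j, x)
  rw [finProdFinEquiv_symm_apply, Prod.mk.injEq] at hsymm
  simp only [hp, input, dif_pos (finProdFinEquiv (j, x)).2, Fin.eta, hsymm]

theorem input_mem_right (j : Fin d) (x : Fin n) :
    (input a b).mem (d * n + (j * n + x)) = b j x := by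
  have hp : (j * n + x : ℕ) = finProdFinEquiv (j, x) := by simp [add_comm, mul_comm]
  have hsymm := finProdFinEquiv.symm_apply_apply (j, x)
  rw [finProdFinEquiv_symm_apply, Prod.mk.injEq] at hsymm
  simp only [hp, input, dif_neg (Nat.le_add_right _ _).not_gt, Nat.add_sub_cancel_left,
    dif_pos (finProdFinEquiv (j, x)).2, Fin.eta, hsymm]

theorem input_mem_of_le {p : ℕ} (hp : d * n + d * n ≤ p) : (input a b).mem p = 0 := by
  simp only [input, dif_neg (show ¬ p < d * n by omega),
    dif_neg (show ¬ p - d * n < d * n by omega)]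

theorem describes_pairAct : Describes d n (pairAct a b) (input a b).mem := by
  intro j hj hjd y hy
  obtain ⟨j, rfl⟩ : ∃ i : Fin d, j = i + 1 := ⟨⟨j - 1, by omega⟩, by simp only; omega⟩
  revert y
  refine forall_lt_two_mul (fun x => ?_) fun x => ?_
  · simp [pairAct_left, input_mem_left]
  · simp [pairAct_right, input_mem_right]

theorem simConj_iff_exists_comm :
    SimConj a b ↔ ∃ τ : Equiv.Perm (Fin n), ∀ j y, τ (b j y) = a j (τ y) := by
  simp only [SimConj, mul_assoc, eq_inv_mul_iff_mul_eq, Equiv.ext_iff, Equiv.Perm.mul_apply]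

theorem simConj_of_isoOn {f : ℕ → ℕ}
    (hf : IsoOn (pairAct a b) f (Finset.Ico n (2 * n)) (Finset.range n)) : SimConj a b := by
  have hmem (y : Fin n) : n + (y : ℕ) ∈ Finset.Ico n (2 * n) := Finset.mem_Ico.2 (by omega)
  have hlt (y : Fin n) : f (n + y) < n := Finset.mem_range.1 (hf.bijOn.mapsTo (hmem y))
  have hinj : Function.Injective fun y : Fin n => (⟨f (n + y), hlt y⟩ : Fin n) := fun y y' h =>
    Fin.ext (Nat.add_left_cancel (hf.bijOn.injOn (hmem y) (hmem y') (Fin.mk.inj h)))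
  refine (simConj_iff_exists_comm a b).2
    ⟨Equiv.ofBijective _ (Finite.injective_iff_bijective.1 hinj), fun j y => Fin.ext ?_⟩
  have hcomm := hf.comm (j + 1) _ (hmem y)
  rw [pairAct_right] at hcomm
  exact hcomm.trans (pairAct_left a b j ⟨f (n + y), hlt y⟩)

theorem SimConj.exists_isoOn {a b : Fin d → Equiv.Perm (Fin n)} (h : SimConj a b) :
    ∃ f, IsoOn (pairAct a b) f (Finset.Ico n (2 * n)) (Finset.range n) := by
  obtain ⟨τ, hτ⟩ := (simConj_iff_exists_comm a b).1 h
  let f (x : ℕ) : ℕ := if h : x - n < n then τ ⟨x - n, h⟩ else 0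
  have hf (y : Fin n) : f (n + y) = τ y := by simp [f]
  have hIco (x : ℕ) (hx : x ∈ Finset.Ico n (2 * n)) : ∃ y : Fin n, n + (y : ℕ) = x := by
    rw [Finset.mem_Ico] at hx
    exact ⟨⟨x - n, by omega⟩, by simp only; omega⟩
  refine ⟨f, ⟨fun x hx => ?_, fun x hx x' hx' h => ?_, fun x hx => ?_⟩, fun j x hx => ?_⟩
  · obtain ⟨y, rfl⟩ := hIco x hx
    exact Finset.mem_range.2 (hf y ▸ (τ y).2)
  · obtain ⟨y, rfl⟩ := hIco x hx
    obtain ⟨y', rfl⟩ := hIco x' hx'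
    rw [hf, hf] at h
    rw [τ.injective (Fin.ext h)]
  · have hx := Finset.mem_range.1 hx
    exact ⟨n + (τ.symm ⟨x, hx⟩ : Fin n), Finset.mem_Ico.2 (by omega), by simp [hf]⟩
  · obtain ⟨y, rfl⟩ := hIco x hx
    refine forall_pairAct a b (P := fun _ g => f (g (n + y)) = g (f (n + y)))
      (fun _ _ => rfl) (fun j => ?_) j
    rw [pairAct_right, hf, hf, pairAct_left, hτ]

theorem balanced_pairAct_iff : Balanced (2 * n) n (pairAct a b) ↔ SimConj a b :=
  (balanced_iff_exists_isoOn (pairAct_actsOn a b) (pairAct_sided a b) (by omega)).trans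
    ⟨fun ⟨_, hf⟩ => simConj_of_isoOn a b hf, SimConj.exists_isoOn⟩

end Instance

section Asymptotics

open Asymptotics Filter

variable {d n N κ q : ℕ} {G : ℕ → ℕ → ℕ} {T : Finset ℕ}

/-- The best bound for the total weight of pairwise non-isomorphic components. -/
noncomputable def maxWeight (d n : ℕ) : ℕ :=
  sInf {B | ∀ G : ℕ → ℕ → ℕ, ActsOn G (Finset.range (2 * n)) →
    (∀ j x, ¬ (1 ≤ j ∧ j ≤ d) → G j x = x) → WeightLe (2 * n) (blockLen d n) G B}

theorem weight_le (κ m : ℕ) : weight κ m ≤ 2 * m + 1 := by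
  have hdiv := Nat.div_le_self m κ
  have hlog := Nat.log_le_self 2 m
  unfold weight
  omega

theorem weightLe_of_card (N κ : ℕ) (G : ℕ → ℕ → ℕ) : WeightLe N κ G (N * (2 * N + 1)) := by
  intro T hT _
  have hcard : T.card ≤ N := (Finset.card_le_card hT).trans_eq (Finset.card_range N)
  have horb (x : ℕ) : (orb G (Finset.range N) x).card ≤ N :=
    card_orb_le.trans_eq (Finset.card_range N)
  calc _ ≤ T.card * (2 * N + 1) := Finset.sum_le_card_nsmul _ _ _ fun x _ =>
        (weight_le _ _).trans (by have := horb x; omega)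
    _ ≤ _ := Nat.mul_le_mul_right _ hcard

theorem weightLe_maxWeight (hG : ActsOn G (Finset.range (2 * n)))
    (htriv : ∀ j x, ¬ (1 ≤ j ∧ j ≤ d) → G j x = x) :
    WeightLe (2 * n) (blockLen d n) G (maxWeight d n) :=
  Nat.sInf_mem (s := {B | ∀ G : ℕ → ℕ → ℕ, ActsOn G (Finset.range (2 * n)) →
    (∀ j x, ¬ (1 ≤ j ∧ j ≤ d) → G j x = x) → WeightLe (2 * n) (blockLen d n) G B})
    ⟨_, fun G _ _ => weightLe_of_card _ _ G⟩ G hG htriv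

theorem ActsOn.sum_card_orb_le (hG : ActsOn G (Finset.range N)) (hT : T ⊆ Finset.range N)
    (hsep : ∀ x ∈ T, ∀ y ∈ T, SameType G x y → x = y) :
    ∑ x ∈ T, (orb G (Finset.range N) x).card ≤ N := by
  rw [← Finset.card_biUnion]
  · exact (Finset.card_le_card (Finset.biUnion_subset.2 fun x _ => orb_subset)).trans_eq
      (Finset.card_range N)
  · refine fun x hx y hy hxy => Finset.disjoint_left.2 fun z hzx hzy => hxy (hsep x hx y hy ?_)
    exact hG.sameType_of_reach (hT hx) (((hG.mem_orb (hT hx)).1 hzx).trans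
      (hG.reach_symm (hT hy) ((hG.mem_orb (hT hy)).1 hzy)))

theorem mul_log_add_one_le {m : ℕ} (hm : 2 ^ (4 * q) ≤ m) : q * (Nat.log 2 m + 1) ≤ m := by
  have hm0 : m ≠ 0 := (Nat.two_pow_pos _).trans_le hm |>.ne'
  have hl : 4 * q ≤ Nat.log 2 m := Nat.le_log_of_pow_le (by omega) hm
  have hpow := Nat.pow_log_le_self 2 hm0
  set l := Nat.log 2 m
  have hhalf : l / 2 < 2 ^ (l / 2) := Nat.lt_two_pow_self
  have hq : 2 * q ≤ l / 2 := by omega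
  have hl1 : l + 1 ≤ 2 * 2 ^ (l / 2) := by omega
  calc q * (l + 1) ≤ (l / 2) * 2 ^ (l / 2) := by nlinarith
    _ ≤ 2 ^ (l / 2) * 2 ^ (l / 2) := Nat.mul_le_mul_right _ hhalf.le
    _ = 2 ^ (l / 2 + l / 2) := (pow_add _ _ _).symm
    _ ≤ 2 ^ l := Nat.pow_le_pow_right (by omega) (by omega)
    _ ≤ m := hpow

theorem mul_weight_le (hq : q ≤ κ) (m : ℕ) : q * weight κ m ≤
    2 * m + if m ≤ 2 ^ (4 * q) then q * (2 ^ (4 * q) + 1) else 0 := by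
  have hdiv : q * (m / κ) ≤ m := (Nat.mul_le_mul_right _ hq).trans (Nat.mul_div_le _ _)
  rw [weight, add_assoc, mul_add]
  split_ifs with hm
  · have hlog : q * (Nat.log 2 m + 1) ≤ q * (2 ^ (4 * q) + 1) :=
      Nat.mul_le_mul_left _ (Nat.add_le_add_right ((Nat.log_le_self 2 m).trans hm) 1)
    omega
  · have hlog := mul_log_add_one_le (not_le.1 hm).le
    omega

/-- A bound for the number of isomorphism types of components with at most `f` points. -/
def typeBound (d f : ℕ) : ℕ := ((f + 1) ^ (f + 1)) ^ d * (f + 1)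

/-- Large components have weight at most `2 m / q` each, and there are boundedly many types of small
components. -/
theorem ActsOn.mul_sum_weight_le (hG : ActsOn G (Finset.range N))
    (htriv : ∀ j x, ¬ (1 ≤ j ∧ j ≤ d) → G j x = x) (hq : q ≤ κ) (hT : T ⊆ Finset.range N)
    (hsep : ∀ x ∈ T, ∀ y ∈ T, SameType G x y → x = y) :
    q * ∑ x ∈ T, weight κ (orb G (Finset.range N) x).card ≤
      2 * N + typeBound d (2 ^ (4 * q)) * (q * (2 ^ (4 * q) + 1)) := by
  classical
  have hsmall : (T.filter fun x => (orb G (Finset.range N) x).card ≤ 2 ^ (4 * q)).card ≤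
      typeBound d (2 ^ (4 * q)) := by
    have hcard := hG.card_le_of_pairwise_not_sameType (J := Finset.Icc 1 d) (f := 2 ^ (4 * q))
      (fun j hj x _ => htriv j x (by simpa using hj)) ((Finset.filter_subset _ T).trans hT)
      (fun x hx => (Finset.mem_filter.1 hx).2)
      (fun x hx y hy => hsep x (Finset.mem_filter.1 hx).1 y (Finset.mem_filter.1 hy).1)
    rwa [Nat.card_Icc, Nat.add_sub_cancel] at hcard
  rw [Finset.mul_sum]
  refine (Finset.sum_le_sum fun x _ => mul_weight_le hq _).trans ?_
  rw [Finset.sum_add_distrib, ← Finset.mul_sum, ← Finset.sum_filter, Finset.sum_const, smul_eq_mul]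
  exact Nat.add_le_add (Nat.mul_le_mul_left _ (hG.sum_card_orb_le hT hsep))
    (Nat.mul_le_mul_right _ hsmall)

theorem le_blockLen (hn : ((d + 1) ^ q) ^ 2 ≤ n) (hd : 0 < d) : q ≤ blockLen d n :=
  Nat.le_log_of_pow_le (by omega) (le_max_of_le_right (Nat.le_sqrt'.2 hn))

theorem mul_maxWeight_le (hd : 0 < d) {k : ℕ} (hk : 0 < k) (hκ : ((d + 1) ^ (5 * k)) ^ 2 ≤ n)
    (hn : typeBound d (2 ^ (4 * (5 * k))) * (5 * k * (2 ^ (4 * (5 * k)) + 1)) + 5 * k ≤ n) :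
    k * maxWeight d n ≤ n := by
  refine (Nat.mul_le_mul_left k (Nat.sInf_le fun G hG htriv T hT hsep => ?_)).trans
    (Nat.mul_div_le n k)
  have hsum := hG.mul_sum_weight_le htriv (le_blockLen hκ hd) hT hsep
  have hmod := Nat.div_add_mod n k
  have hlt := Nat.mod_lt n hk
  refine Nat.le_of_mul_le_mul_left (hsum.trans ?_) (show 0 < 5 * k by omega)
  have hassoc : 5 * k * (n / k) = 5 * (k * (n / k)) := mul_assoc _ _ _
  rw [hassoc]
  omega

theorem isLittleO_maxWeight (hd : 0 < d) :
    (fun n : ℕ => (maxWeight d n : ℝ)) =o[atTop] fun n : ℕ => (n : ℝ) := by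
  refine isLittleO_iff_nat_mul_le.2 fun k => ?_
  rcases k.eq_zero_or_pos with rfl | hk
  · simp
  filter_upwards [eventually_ge_atTop (((d + 1) ^ (5 * k)) ^ 2), eventually_ge_atTop
    (typeBound d (2 ^ (4 * (5 * k))) * (5 * k * (2 ^ (4 * (5 * k)) + 1)) + 5 * k)] with n hκ hn
  simpa only [RCLike.norm_natCast] using mod_cast mul_maxWeight_le hd hk hκ hn

theorem isLittleO_natSqrt :
    (fun n : ℕ => (Nat.sqrt n : ℝ)) =o[atTop] fun n : ℕ => (n : ℝ) := by
  refine isLittleO_iff_nat_mul_le.2 fun k => ?_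
  filter_upwards [eventually_ge_atTop (k * k)] with n hn
  simpa only [RCLike.norm_natCast] using mod_cast
    (Nat.mul_le_mul_right _ (Nat.le_sqrt.2 hn)).trans (Nat.sqrt_le n)

theorem isLittleO_runTime (hd : 0 < d) (K c : ℕ) :
    (fun n : ℕ => ((K * runTime d n (maxWeight d n) + c : ℕ) : ℝ)) =o[atTop]
      fun n : ℕ => (n : ℝ) ^ 2 := by
  have hconst (C : ℝ) : (fun _ : ℕ => C) =o[atTop] fun n : ℕ => (n : ℝ) :=
    (isLittleO_const_id_atTop C).comp_tendsto tendsto_natCast_atTop_atTop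
  have hlin : (fun n : ℕ => (n : ℝ) + 1) =O[atTop] fun n : ℕ => (n : ℝ) :=
    (isBigO_refl _ _).add (hconst 1).isBigO
  have hsqrt := ((hconst (d + 2)).add isLittleO_natSqrt).mul_isBigO hlin
  have hweight := ((hconst (21 * d + 40)).add
    ((isLittleO_maxWeight hd).const_mul_left (63 * d + 248))).mul_isBigO
    (isBigO_refl (fun n : ℕ => (n : ℝ)) atTop)
  have hrest := (hconst 1).mul_isBigO hlin
  have hsum := (((hsqrt.const_mul_left (20 * K)).add (hweight.const_mul_left (2 * K))).add
    (hrest.const_mul_left (20 * K))).add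
    (((hconst 1).mul_isBigO (hconst c).isBigO))
  refine hsum.congr (fun n => ?_) fun n => (sq _).symm
  push_cast [runTime, componentTime]
  ring

end Asymptotics

section Machine

variable {d n w : ℕ}

/-- The layout of the decision procedure: the degree `n` is kept in register `0` and the array `inp`
in the segment at address `0`. -/
def layout : Layout Var Arr where
  reg := ⟨Var.ctorIdx, Function.LeftInverse.injective Var.ofNat_ctorIdx⟩
  seg := ⟨Arr.ctorIdx, Function.LeftInverse.injective Arr.ofNat_ctorIdx⟩
  regs := 37
  segs := 12
  reg_lt u := by cases u <;> decide
  seg_lt B := by cases B <;> decide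

/-- The store at the beginning: the degree, the input, and zeros. -/
def initial (n : ℕ) (inp : ℕ → ℕ) : Store Var Arr where
  var u := if u = .n then n else 0
  arr B i := if B = .inp then inp i else 0
  time := 0

/-- Compute the length of the segments. -/
def prelude (d : ℕ) : Prog :=
  .seq (.const (layout.regs + 1) (2 * d + 10)) (.seq (.arith .add layout.regs 0 0)
    (.seq (.arith .add layout.regs layout.regs (layout.regs + 1))
      (.arith .mul layout.regs layout.regs layout.regs)))

theorem input_mem_segment (a b : Fin d → Equiv.Perm (Fin n)) (B : Arr) (i : ℕ) :
    (input a b).mem (layout.seg B * memSize d n + i) = (initial n (input a b).mem).arr B i := by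
  by_cases hB : B = .inp
  · subst hB
    exact congrArg (input a b).mem ((congrArg (· + i) (Nat.zero_mul _)).trans (Nat.zero_add i))
  · have hpos : 0 < layout.seg B := Nat.pos_of_ne_zero fun h => hB (layout.seg.injective h)
    have hsegment := Nat.le_mul_of_pos_left (memSize d n) hpos
    have hinput : d * n + d * n ≤ memSize d n := by unfold memSize; nlinarith
    exact (input_mem_of_le a b (by omega)).trans (if_neg hB).symm

theorem memSize_le_two_pow (hw : (12 * ((2 * d + 12) * (2 * d + 12)) + 2) * (Nat.log 2 n + 1) ≤ w) :
    layout.segs * memSize d n ≤ 2 ^ w := by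
  set C := 12 * ((2 * d + 12) * (2 * d + 12)) with hC
  set l := Nat.log 2 n + 1
  have hn : n < 2 ^ l := Nat.lt_pow_succ_log_self (by omega) n
  have hlin : 2 * n + 2 * d + 10 ≤ (2 * d + 12) * 2 ^ l := by nlinarith
  calc 12 * memSize d n ≤ 12 * (((2 * d + 12) * 2 ^ l) * ((2 * d + 12) * 2 ^ l)) :=
        Nat.mul_le_mul_left _ (Nat.mul_le_mul hlin hlin)
    _ = C * 2 ^ (2 * l) := by rw [hC]; ring
    _ ≤ 2 ^ (C * l) * 2 ^ (2 * l) := Nat.mul_le_mul_right _ (Nat.lt_two_pow_self.le.trans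
        (Nat.pow_le_pow_right (by omega) (Nat.le_mul_of_pos_right _ (Nat.succ_pos _))))
    _ = 2 ^ ((C + 2) * l) := by rw [← pow_add, Nat.add_mul]
    _ ≤ 2 ^ w := Nat.pow_le_pow_right (by omega) hw

theorem exec_prelude (hw : layout.segs * memSize d n ≤ 2 ^ w) (a b : Fin d → Equiv.Perm (Fin n)) :
    ∃ ρ, Exec w (prelude d) (input a b) ρ 4 ∧
      layout.Repr (memSize d n) (initial n (input a b).mem) ρ := by
  have hlin : 2 * n + 2 * d + 10 ≤ memSize d n := Nat.le_mul_self _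
  change 12 * memSize d n ≤ 2 ^ w at hw
  refine ⟨_, .seq (.const _ _ _) (.seq (.arith _ _ _ _ _) (.seq (.arith _ _ _ _ _)
    (.arith _ _ _ _ _))), fun u => ?_, ?_, fun B i _ => input_mem_segment a b B i⟩
  · have hu := layout.reg_lt u
    simp only [State.setReg, Function.update_of_ne hu.ne,
      Function.update_of_ne (hu.trans (Nat.lt_succ_self _)).ne]
    cases u <;> rfl
  · have hreg : (input a b).reg 0 = n := rfl
    have hd : (2 * d + 10) % 2 ^ w = 2 * d + 10 := Nat.mod_eq_of_lt (by omega)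
    have hn : (n + n) % 2 ^ w = n + n := Nat.mod_eq_of_lt (by omega)
    have hsum : (n + n + (2 * d + 10)) % 2 ^ w = 2 * n + 2 * d + 10 := by
      rw [Nat.mod_eq_of_lt (by omega)]
      omega
    have hprod : memSize d n % 2 ^ w = memSize d n := Nat.mod_eq_of_lt (by omega)
    simp only [State.setReg, layout, Nat.reduceAdd, hd, Op.eval, ne_eq, OfNat.zero_ne_ofNat,
      not_false_eq_true, Function.update_of_ne, hreg, hn, Function.update_self, Nat.succ_ne_self,
      hsum, Function.update_idem]
    exact hprod

end Machine

end SCP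

theorem theorem1 (d : ℕ) (hd : 0 < d) :
    ∃ (P : SCP.Prog) (c : ℕ) (T : ℕ → ℕ),
      Asymptotics.IsLittleO Filter.atTop (fun n : ℕ => (T n : ℝ)) (fun n : ℕ => (n : ℝ) ^ 2) ∧
      ∀ (n w : ℕ), c * (Nat.log 2 n + 1) ≤ w →
        ∀ a b : Fin d → Equiv.Perm (Fin n), SCP.DecidesWithin w P (T n) a b := by
  classical
  refine ⟨.seq (SCP.prelude d) ((SCP.decider d).comp SCP.layout),
    12 * ((2 * d + 12) * (2 * d + 12)) + 2,
    fun n => (SCP.decider d).stepsPerTime * SCP.runTime d n (SCP.maxWeight d n) + 4,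
    SCP.isLittleO_runTime hd _ 4, fun n w hw a b => ?_⟩
  have hmem := SCP.memSize_le_two_pow hw
  have hmem' : SCP.memSize d n ≤ 2 ^ w := (Nat.le_mul_of_pos_left _ (by decide)).trans hmem
  obtain ⟨ρ, hprelude, hρ⟩ := SCP.exec_prelude hmem a b
  have hG := SCP.pairAct_actsOn a b
  have htriv := fun j x hj => SCP.pairAct_of_not a b (j := j) hj x
  have hdecider := SCP.wp_decider hd hG htriv (SCP.weightLe_maxWeight hG htriv)
    (SCP.pairAct_sided a b) (σ := SCP.initial n (SCP.input a b).mem) rfl rfl (fun _ _ => rfl)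
    (fun _ _ => rfl) (SCP.describes_pairAct a b)
  obtain ⟨σ', ρ', t, hexec, hρ', ⟨hres, htime⟩, hcost⟩ :=
    SCP.Cmd.runs_comp hmem hmem' _ le_rfl hdecider hρ
  have hsteps := Nat.mul_le_mul_left (SCP.decider d).stepsPerTime htime
  have hout : ρ'.reg 0 = if SCP.SimConj a b then 1 else 0 := by
    simpa only [SCP.balanced_pairAct_iff] using show ρ'.reg 0 = _ from (hρ'.reg .n).trans hres
  exact ⟨ρ', _, .seq hprelude hexec, by dsimp only; omega, fun h => by rw [hout, if_pos h],
    fun h => by rw [hout, if_neg h]⟩
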